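/- Theorem (Monotonicity formula of Almgren--Poon type). \label{T:poon} Let $n\ge 1$ and $a\in(-1,1)$. Write $X=(x,y)\in\mathbb R^n\times\mathbb R$, $|(X,t)|=\sqrt{|X|^2+|t|}$, and for $r>0$ put $\mathbb S_r^+=\{(x,y,t): x\in\mathbb R^n,\ y>0,\ -r^2<t\le 0\}$ and $S_1=\mathbb R^n\times(-1,0]$. For $t<0$ let $$\overline{\mathscr G}_a(X,t)=\frac{(4\pi)^{-n/2}}{2^a\,\Gamma(\frac{a+1}{2})}\,|t|^{-\frac{n+a+1}{2}}\,e^{-\frac{|X|^2}{4|t|}} .$$ For $F\in L^\infty(\mathbb S_1^+)$ let $\mathfrak S_F(\mathbb S_1^+)$ be the class of functions $U$, continuous on $\{y\ge 0,\ -1<t\le 0\}$ (that is, identified with their continuous representatives), such that: 1) $U$ has bounded support; 2) $\nabla_xU$ and $y^aU_y$ belong to the parabolic H\"older class $H^{\alpha,\alpha/2}(\mathbb S_1^+)$ for some $\alpha\in(0,1]$; 3) $U_t\in L^\infty(\mathbb S_1^+)$; 4) $y^a|\nabla U_{x_i}|^2$ $(1\le i\le n)$ and $y^{-a}\big((y^aU_y)_y\big)^2$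 belong to $L^1(\mathbb S_1^+)$; 5) $\partial_t(y^aU)-\operatorname{div}_X(y^a\nabla_XU)=y^aF$ in $\mathbb S_1^+$ in the sense of distributions, and $\min\{U(x,0,t),-\partial_y^aU(x,0,t)\}=0$ for $(x,t)\in S_1$, where $\partial_y^aU(x,0,t)=\lim_{y\to0^+}y^aU_y(x,y,t)$; 6) $(0,0)\in\partial\{(x,t)\in S_1: U(x,0,t)=0,\ \partial_y^aU(x,0,t)=0\}$, the boundary being taken in $\mathbb R^n\times\mathbb R$. Let $$H(U,r)=\frac1{r^2}\int_{\mathbb S_r^+}U^2\,\overline{\mathscr G}_a\,y^a\,dX\,dt .$$ Let $\ell\ge 2$, $C_\ell\in\mathbb R$ and $\sigma\in(0,1)$. Then there is a constant $C>0$, depending only on $n$, $a$, $\ell$, $C_\ell$ and $\sigma$, such that the following holds for all $F$ and all $U\in\mathfrak S_F(\mathbb S_1^+)$ with $$|F(X,t)|\le C_\ell\,|(X,t)|^{\ell-2}\quad\text{for a.e. }(X,t)\in\mathbb S_1^+ .$$ The integral defining $H(U,r)$ converges for every $r\in(0,1)$; the function $r\mapsto\log\max\{H(U,r),r^{2\ell-2+2\sigma}\}$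 is continuous on $(0,1)$ and differentiable outside a countable set; and the truncated Gaussian frequency $$\Phi_{\ell,\sigma}(U,r)=\tfrac12\, r\,e^{Cr^{1-\sigma}}\frac{d}{dr}\log\max\{H(U,r),r^{2\ell-2+2\sigma}\}+2\big(e^{Cr^{1-\sigma}}-1\big)$$ is nondecreasing on the set of those $r\in(0,1)$ at which this derivative exists. In particular the limit $\Phi_{\ell,\sigma}(U,0^+)=\lim_{r\to0^+}\Phi_{\ell,\sigma}(U,r)$, taken along this set, exists and is finite. -/

import Mathlib

open Set Filter Topology MeasureTheory
open scoped ContDiff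

noncomputable section

namespace ThinObstacle

/-- Points `(x, y, t)` of `ℝⁿ × ℝ × ℝ`; the thick spatial variable is `X = (x, y)`. -/
abbrev Pt (n : ℕ) : Type := EuclideanSpace ℝ (Fin n) × ℝ × ℝ

/-- The Euclidean length `|X|` of the spatial part `X = (x, y)` of a point `(x, y, t)`. -/
def spaceNorm {n : ℕ} (p : Pt n) : ℝ := √(‖p.1‖ ^ 2 + p.2.1 ^ 2)

/-- The parabolic pseudo-norm `|(X, t)| = √(|X|² + |t|)`. -/
def parNorm {n : ℕ} (p : Pt n) : ℝ := √(spaceNorm p ^ 2 + |p.2.2|)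

/-- The half-strip `𝕊_r⁺ = {(x, y, t) | y > 0, -r² < t ≤ 0}`. -/
def strip (n : ℕ) (r : ℝ) : Set (Pt n) := {p | 0 < p.2.1 ∧ -r ^ 2 < p.2.2 ∧ p.2.2 ≤ 0}

/-- The interior `{y > 0, -1 < t < 0}` of `𝕊_1⁺`, where equations and weak derivatives
are tested. -/
def openStrip (n : ℕ) : Set (Pt n) := {p | 0 < p.2.1 ∧ -1 < p.2.2 ∧ p.2.2 < 0}

/-- The half-strip together with its thin face: `{y ≥ 0, -1 < t ≤ 0}`. -/
def closedStrip (n : ℕ) : Set (Pt n) := {p | 0 ≤ p.2.1 ∧ -1 < p.2.2 ∧ p.2.2 ≤ 0}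

/-- The unit vector in the direction `x_i`. -/
def dirX {n : ℕ} (i : Fin n) : Pt n := (EuclideanSpace.single i 1, 0, 0)

/-- The unit vector in the direction `y`. -/
def dirY (n : ℕ) : Pt n := (0, 1, 0)

/-- The unit vector in the direction `t`. -/
def dirT (n : ℕ) : Pt n := (0, 0, 1)

/-- Smooth functions with compact support contained in the open strip. -/
def IsTest {n : ℕ} (φ : Pt n → ℝ) : Prop :=
  ContDiff ℝ ∞ φ ∧ HasCompactSupport φ ∧ tsupport φ ⊆ openStrip n

/-- `g` is the distributional derivative of `f` in the direction `v` on the open strip. -/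
def IsWeakDeriv {n : ℕ} (v : Pt n) (f g : Pt n → ℝ) : Prop :=
  LocallyIntegrableOn f (openStrip n) ∧ LocallyIntegrableOn g (openStrip n) ∧
    ∀ φ : Pt n → ℝ, IsTest φ →
      ∫ p in openStrip n, f p * lineDeriv ℝ φ p v = -∫ p in openStrip n, g p * φ p

/-- The parabolic Hölder class `H^{α, α/2}(S)`, for `0 < α ≤ 1`. -/
def ParabolicHolderOn {n : ℕ} (α : ℝ) (f : Pt n → ℝ) (S : Set (Pt n)) : Prop :=
  ∃ K : ℝ, (∀ p ∈ S, |f p| ≤ K) ∧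
    ∀ p ∈ S, ∀ q ∈ S, |f p - f q| ≤ K * parNorm (p - q) ^ α

/-- The function `y^a ∂_y U`. -/
def weightedDy {n : ℕ} (a : ℝ) (U : Pt n → ℝ) (p : Pt n) : ℝ :=
  p.2.1 ^ a * lineDeriv ℝ U p (dirY n)

/-- The weighted normal derivative `∂_y^a U(x, 0, t) = lim_{y → 0+} y^a ∂_y U(x, y, t)` exists
and equals `d`. -/
def HasWeightedNormalDeriv {n : ℕ} (a : ℝ) (U : Pt n → ℝ) (x : EuclideanSpace ℝ (Fin n))
    (t d : ℝ) : Prop :=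
  Tendsto (fun y : ℝ => weightedDy a U (x, y, t)) (𝓝[>] 0) (𝓝 d)

/-- `∂_t (y^a U) - div_X (y^a ∇_X U) = y^a F` in the strip, in the sense of distributions. -/
def SolvesEquation {n : ℕ} (a : ℝ) (F U : Pt n → ℝ) : Prop :=
  ∀ φ : Pt n → ℝ, IsTest φ →
    ∫ p in openStrip n,
        p.2.1 ^ a * ((∑ i : Fin n, lineDeriv ℝ U p (dirX i) * lineDeriv ℝ φ p (dirX i))
          + lineDeriv ℝ U p (dirY n) * lineDeriv ℝ φ p (dirY n)
          - U p * lineDeriv ℝ φ p (dirT n))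
      = ∫ p in openStrip n, p.2.1 ^ a * F p * φ p

/-- The extended free boundary
`Γ_*(U) = ∂ {(x, t) | -1 < t ≤ 0, U(x, 0, t) = 0, ∂_y^a U(x, 0, t) = 0}`. -/
def extendedFreeBoundary {n : ℕ} (a : ℝ) (U : Pt n → ℝ) : Set (EuclideanSpace ℝ (Fin n) × ℝ) :=
  frontier {z | (-1 < z.2 ∧ z.2 ≤ 0) ∧ U (z.1, 0, z.2) = 0 ∧
    HasWeightedNormalDeriv a U z.1 z.2 0}

/-- The class `𝔖_F(𝕊_1⁺)` of solutions of the thin obstacle problem with zero obstacle and right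
hand side `F ∈ L^∞(𝕊_1⁺)`. A solution is identified with its continuous representative on
`{y ≥ 0, -1 < t ≤ 0}`, so that `U (x, 0, t)` is its trace on the thin space; the values of `U`
outside this set are irrelevant. First order spatial derivatives are classical, the time
derivative and the second order spatial derivatives are distributional. -/
structure SolutionClass (n : ℕ) (a : ℝ) (F U : Pt n → ℝ) : Prop where
  rhs_bounded : MemLp F ⊤ (volume.restrict (strip n 1))
  continuousOn : ContinuousOn U (closedStrip n)
  bounded_support : Bornology.IsBounded {p ∈ strip n 1 | U p ≠ 0}
  differentiable_x : ∀ p ∈ strip n 1, ∀ i : Fin n, LineDifferentiableAt ℝ U p (dirX i)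
  differentiable_y : ∀ p ∈ strip n 1, LineDifferentiableAt ℝ U p (dirY n)
  holder : ∃ α : ℝ, 0 < α ∧ α ≤ 1 ∧
    (∀ i : Fin n, ParabolicHolderOn α (fun p => lineDeriv ℝ U p (dirX i)) (strip n 1)) ∧
    ParabolicHolderOn α (weightedDy a U) (strip n 1)
  time_deriv : ∃ g : Pt n → ℝ, IsWeakDeriv (dirT n) U g ∧
    MemLp g ⊤ (volume.restrict (strip n 1))
  second_xx : ∀ i j : Fin n, ∃ g : Pt n → ℝ,
    IsWeakDeriv (dirX j) (fun p => lineDeriv ℝ U p (dirX i)) g ∧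
      IntegrableOn (fun p => p.2.1 ^ a * g p ^ 2) (strip n 1)
  second_xy : ∀ i : Fin n, ∃ g : Pt n → ℝ,
    IsWeakDeriv (dirY n) (fun p => lineDeriv ℝ U p (dirX i)) g ∧
      IntegrableOn (fun p => p.2.1 ^ a * g p ^ 2) (strip n 1)
  second_yy : ∃ g : Pt n → ℝ, IsWeakDeriv (dirY n) (weightedDy a U) g ∧
    IntegrableOn (fun p => p.2.1 ^ (-a) * g p ^ 2) (strip n 1)
  equation : SolvesEquation a F U
  signorini : ∀ (x : EuclideanSpace ℝ (Fin n)) (t : ℝ), -1 < t → t ≤ 0 →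
    ∃ d : ℝ, HasWeightedNormalDeriv a U x t d ∧ min (U (x, 0, t)) (-d) = 0
  origin_mem : ((0 : EuclideanSpace ℝ (Fin n)), (0 : ℝ)) ∈ extendedFreeBoundary a U

/-- The backward Gaussian
`(4π)^{-n/2} / (2^a Γ((a+1)/2)) |t|^{-(n+a+1)/2} exp(-|X|² / (4|t|))`, for `t < 0`. -/
def gaussianKernel {n : ℕ} (a : ℝ) (p : Pt n) : ℝ :=
  (4 * Real.pi) ^ (-(n : ℝ) / 2) / (2 ^ a * Real.Gamma ((a + 1) / 2))
    * |p.2.2| ^ (-((n : ℝ) + a + 1) / 2) * Real.exp (-(spaceNorm p ^ 2) / (4 * |p.2.2|))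

/-- The height function `H(U, r) = r⁻² ∫_{𝕊_r⁺} U² 𝒢 y^a dX dt`. -/
def height {n : ℕ} (a : ℝ) (U : Pt n → ℝ) (r : ℝ) : ℝ :=
  1 / r ^ 2 * ∫ p in strip n r, U p ^ 2 * gaussianKernel a p * p.2.1 ^ a

/-- `r ↦ log max {H(U, r), r^{2ℓ-2+2σ}}`. -/
def logTruncatedHeight {n : ℕ} (a ℓ σ : ℝ) (U : Pt n → ℝ) (r : ℝ) : ℝ :=
  Real.log (max (height a U r) (r ^ (2 * ℓ - 2 + 2 * σ)))

/-- The truncated Gaussian frequency `Φ_{ℓ,σ}(U, r)` with constant `C`. -/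
def truncatedFrequency {n : ℕ} (a ℓ σ C : ℝ) (U : Pt n → ℝ) (r : ℝ) : ℝ :=
  1 / 2 * r * Real.exp (C * r ^ (1 - σ)) * deriv (logTruncatedHeight a ℓ σ U) r
    + 2 * (Real.exp (C * r ^ (1 - σ)) - 1)

/-- The radii `r ∈ (0, 1)` at which `log max {H(U, r), r^{2ℓ-2+2σ}}` is differentiable, so that
the truncated frequency is defined. -/
def frequencyDomain {n : ℕ} (a ℓ σ : ℝ) (U : Pt n → ℝ) : Set ℝ :=
  {r ∈ Ioo (0 : ℝ) 1 | DifferentiableAt ℝ (logTruncatedHeight a ℓ σ U) r}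

end ThinObstacle

end

/-! The parabolic dilations `dil r` turn every integral at scale r into an integral over one fixed
finite Gaussian measure. Write Z = X·∇U + 2tU_t for the Euler field, H for the height, and, at scale
r, P = ∫ Z U, E = ∫ -t|∇U|², ψ = ∫ 2tF U. Differentiating along dilations gives r H'/2 = P. Testing
the equation with U times the Gaussian gives P = 2E + ψ, the boundary term vanishing by
complementarity. The frequency to be controlled is N = P/H.

The energy E is not differentiated. Testing the equation at scale r with U taken at scale s leaves a
boundary term of known sign, because the flux is nonpositive and the trace of U is nonnegative.
Together with 2∇U·∇V ≤ |∇U|² + |∇V|² this gives Θ(r,s) ≤ E(r) + E(s), where Θ(r,s) pairs Z - 2tF at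
scale r with U at scale s, and Θ(r,r) = 2E(r). Hence E(s) - E(r) ≥ Θ(r,s) - Θ(r,r): up to a
constant, Θ(r,·) is a differentiable minorant of E touching it at r, with slope ∫ (Z - 2tF) Z / r.
The term ψ is not differentiated either: r²ψ is an integral over a strip, and Cauchy–Schwarz on the
shell between two strips bounds its increments.

Completing a square then bounds the lower right Dini derivative of N from below by -c r^{1-σ}(N+2)/r
wherever H ≥ r^{2ℓ-2+2σ}: there the force, of size r^ℓ, is at most r^{1-σ}√H up to a constant, and N
≥ -1 because r²H is nondecreasing. The factor e^{Cr^{1-σ}} absorbs this loss. Where the truncation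
is active the frequency is the constant ℓ-1+σ, and the sign of the derivative of H/r^{2ℓ-2+2σ} at
the ends of the contact region gives the right jumps. A lower bound by -2 yields the limit at 0.

The main steps are `Regular.weak_inequality_dil`, `Regular.pairing_le`,
`Regular.euler_cauchy_schwarz`, `FrequencyData.exists_minorant`,
`FrequencyData.monotone_on_interval` and `FrequencyData.truncated_le_truncated`. -/

namespace ThinObstacle

/-! ### Real-variable lemmas: Dini derivatives and maxima of two functions. -/

theorem self_notMem_Ioi {x : ℝ} : x ∉ Ioi x := by simp

/-- A continuous function whose lower right Dini derivative is nonnegative is nondecreasing. -/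
theorem le_of_slope_right_eventually_gt_neg {f : ℝ → ℝ} {a b : ℝ} (hab : a ≤ b)
    (hf : ContinuousOn f (Icc a b))
    (hslope : ∀ x ∈ Ico a b, ∀ ε > 0, ∀ᶠ z in 𝓝[>] x, -ε < slope f x z) : f a ≤ f b := by
  -- Comparison of -f with a line of slope δ; the claim follows as δ tends to 0.
  have key : ∀ δ > 0, -f b ≤ -f a + δ * (b - a) := by
    intro δ hδ
    have := image_le_of_liminf_slope_right_lt_deriv_boundary' (f := fun x => -f x)
      (f' := fun _ => 0) (B := fun x => -f a + δ * (x - a)) (B' := fun _ => δ)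
      hf.neg ?_ (by simp) (by fun_prop) ?_ (fun _ _ _ => hδ) (right_mem_Icc.2 hab)
    · simpa using this
    · intro x hx r hr
      refine ((hslope x hx r hr).mono fun z hz => ?_).frequently
      have : slope (fun x => -f x) x z = - slope f x z := by
        simp [slope_def_field]; ring
      rw [this]; linarith
    · intro x _
      have : HasDerivAt (fun x => -f a + δ * (x - a)) (δ * 1) x :=
        (((hasDerivAt_id x).sub_const a).const_mul δ).const_add (-f a)
      simpa using this.hasDerivWithinAt
  have hlim : Tendsto (fun δ : ℝ => -f a + δ * (b - a)) (𝓝[>] 0) (𝓝 (-f a)) := by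
    have : Tendsto (fun δ : ℝ => -f a + δ * (b - a)) (𝓝 0) (𝓝 (-f a + 0 * (b - a))) := by
      apply Continuous.tendsto; fun_prop
    simpa using this.mono_left nhdsWithin_le_nhds
  have := ge_of_tendsto hlim (eventually_mem_nhdsWithin.mono fun δ hδ => key δ hδ)
  linarith

/-- Since u and v vanish at x, the slope of the root is the root of the product of the two slopes; s
> x is needed to pull s - x out of the root. It differentiates the modulus in `forcing_variation`.
-/
theorem hasDerivWithinAt_sqrt_mul {u v : ℝ → ℝ} {u' v' x : ℝ} (hu : HasDerivAt u u' x)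
    (hv : HasDerivAt v v' x) (hu0 : u x = 0) (hv0 : v x = 0) :
    HasDerivWithinAt (fun s => √(u s * v s)) (√(u' * v')) (Ioi x) x := by
  rw [hasDerivWithinAt_iff_tendsto_slope' self_notMem_Ioi]
  have h1 := (hasDerivWithinAt_iff_tendsto_slope' self_notMem_Ioi).1
    (hu.hasDerivWithinAt (s := Ioi x))
  have h2 := (hasDerivWithinAt_iff_tendsto_slope' self_notMem_Ioi).1
    (hv.hasDerivWithinAt (s := Ioi x))
  refine ((h1.mul h2).sqrt).congr' ?_
  filter_upwards [self_mem_nhdsWithin] with s hs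
  have hs' : 0 < s - x := sub_pos.2 hs
  simp only [slope_def_field, hu0, hv0, sub_zero, mul_zero, Real.sqrt_zero]
  rw [div_mul_div_comm, Real.sqrt_div' _ (by positivity), Real.sqrt_mul_self hs'.le]

/-- The maximum is (f + g + |f - g|)/2, and |f - g| = o(s - x) because f - g vanishes at x together
with its derivative. -/
theorem hasDerivAt_max_of_eq {f g : ℝ → ℝ} {d x : ℝ} (hf : HasDerivAt f d x)
    (hg : HasDerivAt g d x) (h : f x = g x) : HasDerivAt (fun s => max (f s) (g s)) d x := by
  have h0 : HasDerivAt (fun s => |f s - g s|) 0 x := by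
    have := hf.sub hg
    simp only [sub_self] at this
    rw [hasDerivAt_iff_isLittleO] at this ⊢
    have h' : ∀ s, ((f - g) s - (f - g) x - (s - x) • (0:ℝ)) = f s - g s := by
      intro s; simp [h]
    simp only [h'] at this
    have h'' : ∀ s, (|f s - g s| - |f x - g x| - (s - x) • (0:ℝ)) = |f s - g s| := by
      intro s; simp [h]
    simp only [h'']
    exact this.norm_left
  have h1 := ((hf.add hg).add h0).div_const 2
  have e : (d + d + 0) / 2 = d := by ring
  rw [e] at h1
  refine h1.congr_of_eventuallyEq (Eventually.of_forall fun s => ?_)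
  simp [max_def, abs_eq_max_neg]
  split_ifs <;> grind

theorem continuousOn_log_max {H B : ℝ → ℝ} {I : Set ℝ} (hH : ContinuousOn H I)
    (hB : ContinuousOn B I) (hB0 : ∀ r ∈ I, 0 < B r) :
    ContinuousOn (fun r => Real.log (max (H r) (B r))) I :=
  (ContinuousOn.sup hH hB).log fun r hr => (lt_max_of_lt_right (hB0 r hr)).ne'

/-- A point of nondifferentiability is a contact point H = B with distinct derivatives, hence
isolated from the right in the contact set. Such points form a countable set. -/
theorem countable_not_differentiableAt_log_max {H B : ℝ → ℝ} {I : Set ℝ}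
    (hH : ∀ r ∈ I, DifferentiableAt ℝ H r) (hB : ∀ r ∈ I, DifferentiableAt ℝ B r)
    (hB0 : ∀ r ∈ I, 0 < B r) :
    {r ∈ I | ¬ DifferentiableAt ℝ (fun r => Real.log (max (H r) (B r))) r}.Countable := by
  refine (countable_setOfPred_isolated_right_within
    (s := {r | H r = B r})).mono fun r hr' => ?_
  obtain ⟨hr, hnd⟩ := hr'
  have hpos : 0 < max (H r) (B r) := lt_max_of_lt_right (hB0 r hr)
  have hnd' : ¬ DifferentiableAt ℝ (fun r => max (H r) (B r)) r := fun h =>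
    hnd (h.log hpos.ne')
  have heq : H r = B r := by
    rcases lt_trichotomy (H r) (B r) with h | h | h
    · exfalso
      refine hnd' ((hB r hr).congr_of_eventuallyEq ?_)
      filter_upwards [(hH r hr).continuousAt.eventually_lt (hB r hr).continuousAt h] with s hs
      exact max_eq_right hs.le
    · exact h
    · exfalso
      refine hnd' ((hH r hr).congr_of_eventuallyEq ?_)
      filter_upwards [(hB r hr).continuousAt.eventually_lt (hH r hr).continuousAt h] with s hs
      exact max_eq_left hs.le
  refine ⟨heq, ?_⟩
  have hne : deriv H r - deriv B r ≠ 0 := by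
    intro h
    have h2 := (hB r hr).hasDerivAt
    rw [← sub_eq_zero.1 h] at h2
    exact hnd' (hasDerivAt_max_of_eq (hH r hr).hasDerivAt h2 heq).differentiableAt
  have hev := (((hH r hr).hasDerivAt.sub (hB r hr).hasDerivAt).eventually_ne (c := 0) hne)
  have hev' : ∀ᶠ z in 𝓝[>] r, (H - B) z ≠ 0 :=
    hev.filter_mono (nhdsWithin_mono _ fun z (hz : r < z) => hz.ne')
  change 𝓝[{r | H r = B r} ∩ Ioi r] r = ⊥
  rw [← empty_mem_iff_bot]
  filter_upwards [hev'.filter_mono (nhdsWithin_mono _ inter_subset_right),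
    self_mem_nhdsWithin] with z hz hz'
  exact hz (by simpa [sub_eq_zero] using hz'.1)

/-! ### The abstract monotonicity argument for the truncated frequency. -/

/-- The properties of the height `H`, of its logarithmic derivative numerator `P = r H' / 2`, of the
Dirichlet energy `E` and of the forcing term `ψ` from which the monotonicity of the truncated
frequency follows. -/
structure FrequencyData (A ℓ : ℝ) (H P E ψ θ : ℝ → ℝ) (Θ : ℝ → ℝ → ℝ) : Prop where
  hasDerivAt_height : ∀ r ∈ Ioo (0 : ℝ) 1, HasDerivAt H (2 * P r / r) r
  decomposition : ∀ r ∈ Ioo (0 : ℝ) 1, P r = 2 * E r + ψ r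
  continuousOn_energy : ContinuousOn E (Ioo (0 : ℝ) 1)
  -- `Θ r` minorises `E` up to a constant and touches at r; its slope `θ r` there stands in for a
  -- derivative of `E`.
  energy_sub_ge : ∀ r ∈ Ioo (0 : ℝ) 1, ∀ s ∈ Ioo (0 : ℝ) 1, Θ r s - Θ r r ≤ E s - E r
  hasDerivAt_pairing : ∀ r ∈ Ioo (0 : ℝ) 1, HasDerivAt (Θ r) (θ r) r
  abs_forcing_le : ∀ r ∈ Ioo (0 : ℝ) 1, |ψ r| ≤ A * r ^ ℓ * √(H r)
  -- The force is only bounded, so `ψ` has a modulus of continuity in place of a derivative.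
  forcing_variation : ∀ r ∈ Ioo (0 : ℝ) 1, ∀ s ∈ Ioo (0 : ℝ) 1, r ≤ s →
    |s ^ 2 * ψ s - r ^ 2 * ψ r| ≤
      A * √((s ^ (2 * ℓ + 2) - r ^ (2 * ℓ + 2)) * (s ^ 2 * H s - r ^ 2 * H r))
  sq_height_mono : ∀ r ∈ Ioo (0 : ℝ) 1, ∀ s ∈ Ioo (0 : ℝ) 1, r ≤ s → r ^ 2 * H r ≤ s ^ 2 * H s
  cauchy_schwarz : ∀ r ∈ Ioo (0 : ℝ) 1, 0 < H r →
    2 * P r ^ 2 / H r - 2 * (P r / H r) * ψ r - A ^ 2 * r ^ (2 * ℓ) / 2 ≤ 2 * r * θ r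

namespace FrequencyData

variable {A ℓ : ℝ} {H P E ψ θ : ℝ → ℝ} {Θ : ℝ → ℝ → ℝ}

theorem continuousOn_height (h : FrequencyData A ℓ H P E ψ θ Θ) :
    ContinuousOn H (Ioo (0 : ℝ) 1) :=
  fun r hr => (h.hasDerivAt_height r hr).continuousAt.continuousWithinAt

theorem hasDerivAt_sq_mul_height (h : FrequencyData A ℓ H P E ψ θ Θ) {r : ℝ}
    (hr : r ∈ Ioo (0 : ℝ) 1) :
    HasDerivAt (fun s => s ^ 2 * H s) (2 * r * (H r + P r)) r := by
  have := (hasDerivAt_pow 2 r).mul (h.hasDerivAt_height r hr)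
  have hr0 := hr.1.ne'
  refine this.congr_deriv ?_
  push_cast
  field_simp

/-- The nondecreasing function r²H has derivative 2r(H + P). This is the bound P/H ≥ -1, which makes
the shift N + 2 at least 1 later. -/
theorem height_add_nonneg (h : FrequencyData A ℓ H P E ψ θ Θ) {r : ℝ}
    (hr : r ∈ Ioo (0 : ℝ) 1) : 0 ≤ H r + P r := by
  have h1 := (hasDerivWithinAt_iff_tendsto_slope' self_notMem_Ioi).1
    ((h.hasDerivAt_sq_mul_height hr).hasDerivWithinAt (s := Ioi r))
  have : 0 ≤ 2 * r * (H r + P r) := by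
    refine ge_of_tendsto h1 ?_
    filter_upwards [Ioo_mem_nhdsGT hr.2] with s hs
    rw [slope_def_field]
    exact div_nonneg (sub_nonneg.2 (h.sq_height_mono r hr s ⟨hr.1.trans hs.1, hs.2⟩ hs.1.le))
      (sub_nonneg.2 hs.1.le)
  have hr0 := hr.1
  by_contra hneg
  push Not at hneg
  nlinarith

/-- The right side of `forcing_variation` tends to 0 as s tends to r from either side, so s²ψ is
continuous; then divide by s². -/
theorem continuousAt_forcing (h : FrequencyData A ℓ H P E ψ θ Θ) {r : ℝ}
    (hr : r ∈ Ioo (0 : ℝ) 1) : ContinuousAt ψ r := by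
  have hr0 := hr.1
  have hc : ContinuousAt (fun s => s ^ 2 * ψ s) r := by
    rw [ContinuousAt, tendsto_iff_norm_sub_tendsto_zero]
    -- The absolute values make one majorant serve for s on both sides of r.
    have hlim : Tendsto (fun s => |A| * √|((s ^ (2 * ℓ + 2) - r ^ (2 * ℓ + 2)) *
        (s ^ 2 * H s - r ^ 2 * H r))|) (𝓝 r) (𝓝 0) := by
      have hH := (h.hasDerivAt_sq_mul_height hr).continuousAt
      have hp : ContinuousAt (fun s : ℝ => s ^ (2 * ℓ + 2)) r :=
        Real.continuousAt_rpow_const _ _ (Or.inl hr0.ne')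
      have : ContinuousAt (fun s => |A| * √|((s ^ (2 * ℓ + 2) - r ^ (2 * ℓ + 2)) *
        (s ^ 2 * H s - r ^ 2 * H r))|) r :=
        (((hp.sub continuousAt_const).mul (hH.sub continuousAt_const)).abs.sqrt).const_mul |A|
      simpa [ContinuousAt] using this
    refine squeeze_zero' (Eventually.of_forall fun _ => norm_nonneg _) ?_ hlim
    filter_upwards [isOpen_Ioo.mem_nhds hr] with s hs
    rw [Real.norm_eq_abs]
    rcases le_total r s with hrs | hrs
    · refine (h.forcing_variation r hr s hs hrs).trans ?_
      gcongr
      · exact le_abs_self A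
      · exact le_abs_self _
    · rw [abs_sub_comm]
      refine (h.forcing_variation s hs r hr hrs).trans ?_
      rw [show (r ^ (2 * ℓ + 2) - s ^ (2 * ℓ + 2)) * (r ^ 2 * H r - s ^ 2 * H s) =
        (s ^ (2 * ℓ + 2) - r ^ (2 * ℓ + 2)) * (s ^ 2 * H s - r ^ 2 * H r) by ring]
      gcongr
      · exact le_abs_self A
      · exact le_abs_self _
  have := hc.div (continuousAt_id.pow 2) (pow_ne_zero 2 hr0.ne')
  refine this.congr ?_
  filter_upwards [isOpen_Ioo.mem_nhds hr] with s hs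
  have := hs.1.ne'
  simp; field_simp

theorem continuousOn_numerator (h : FrequencyData A ℓ H P E ψ θ Θ) :
    ContinuousOn P (Ioo (0 : ℝ) 1) := by
  have : ContinuousOn (fun r => 2 * E r + ψ r) (Ioo (0 : ℝ) 1) :=
    (h.continuousOn_energy.const_smul (2:ℝ)).add
      fun r hr => (h.continuousAt_forcing hr).continuousWithinAt
  exact this.congr h.decomposition

/-- A one-sided differentiable minorant of `P`, touching `P` at `r`. -/
theorem exists_minorant (h : FrequencyData A ℓ H P E ψ θ Θ) {r : ℝ} (hr : r ∈ Ioo (0 : ℝ) 1) :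
    ∃ Q : ℝ → ℝ, Q r = P r ∧ (∀ᶠ s in 𝓝[>] r, Q s ≤ P s) ∧
      HasDerivWithinAt Q (2 * θ r - 2 * ψ r / r -
        A * √((2 * ℓ + 2) * r ^ (2 * ℓ + 1) * (2 * r * (H r + P r))) / r ^ 2) (Ioi r) r := by
  have hr0 := hr.1
  let S : ℝ → ℝ := fun s => √((s ^ (2 * ℓ + 2) - r ^ (2 * ℓ + 2)) * (s ^ 2 * H s - r ^ 2 * H r))
  -- The pairing minorises the increment of 2E. The lower bound r²ψ(r) - A S(s) for s²ψ(s), divided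
  -- by s², minorises ψ(s).
  refine ⟨fun s => P r + 2 * (Θ r s - Θ r r) + ((r ^ 2 * ψ r - A * S s) / s ^ 2 - ψ r), ?_, ?_, ?_⟩
  · simp [S]; field_simp; ring
  · filter_upwards [Ioo_mem_nhdsGT hr.2] with s hs
    have hs' : s ∈ Ioo (0:ℝ) 1 := ⟨hr0.trans hs.1, hs.2⟩
    have h1 := h.energy_sub_ge r hr s hs'
    have h2 := (abs_le.1 (h.forcing_variation r hr s hs' hs.1.le)).1
    have h3 : (r ^ 2 * ψ r - A * S s) / s ^ 2 ≤ ψ s := by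
      rw [div_le_iff₀ (pow_pos hs'.1 2)]
      simp only [S]; linarith
    rw [h.decomposition s hs', h.decomposition r hr]
    linarith
  · have hp : HasDerivAt (fun s : ℝ => s ^ (2 * ℓ + 2) - r ^ (2 * ℓ + 2))
        ((2 * ℓ + 2) * r ^ (2 * ℓ + 1)) r := by
      have := (Real.hasDerivAt_rpow_const (x := r) (p := 2 * ℓ + 2) (Or.inl hr0.ne')).sub_const
        (r ^ (2 * ℓ + 2))
      refine this.congr_deriv ?_
      rw [show 2 * ℓ + 2 - 1 = 2 * ℓ + 1 by ring]
    have hS : HasDerivWithinAt S _ (Ioi r) r :=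
      hasDerivWithinAt_sqrt_mul hp ((h.hasDerivAt_sq_mul_height hr).sub_const _)
        (by simp) (by simp)
    have hΘ := ((h.hasDerivAt_pairing r hr).hasDerivWithinAt (s := Ioi r)).sub_const (Θ r r)
    have := (((hΘ.const_mul 2).const_add (P r))).add
      ((((hS.const_mul A).const_sub (r ^ 2 * ψ r)).div
        ((hasDerivAt_pow 2 r).hasDerivWithinAt) (pow_ne_zero 2 hr0.ne')).sub_const (ψ r))
    refine this.congr_deriv ?_
    have hS0 : S r = 0 := by simp [S]
    rw [hS0]
    simp
    field_simp
    ring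


/-- For N = P/H, x = r^ℓ/√H and y = r^{1-σ}. As N ≥ -1, both |N| and √(1+N) are at most N + 2, and N
+ 2 ≥ 1, so each error term is at most a constant times y(N + 2). The summand 1 is to spare. -/
theorem minorant_deriv_nonneg {A N x y p : ℝ} (hA : 0 ≤ A) (hN : 0 ≤ 1 + N) (hx0 : 0 ≤ x) (hxy : x ≤ y)
    (hy : y ≤ 1) (hp : 0 ≤ p) :
    0 ≤ (4 * A + A ^ 2 / 2 + A * p + 1) * y * (N + 2)
      - ((2 * |N| + 2) * A * x + A ^ 2 / 2 * x ^ 2 + A * p * x * √(1 + N)) := by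
  have hy0 : 0 ≤ y := hx0.trans hxy
  have h1 : |N| ≤ N + 2 := abs_le.2 ⟨by linarith, by linarith⟩
  have h2 : √(1 + N) ≤ N + 2 := by
    rw [Real.sqrt_le_left (by linarith)]; nlinarith
  have e1 : (2 * |N| + 2) * A * x ≤ (4 * (N + 2)) * A * y := by
    have : 0 ≤ 4 * (N + 2) * A := mul_nonneg (by linarith) hA
    gcongr; linarith
  have e2 : A ^ 2 / 2 * x ^ 2 ≤ A ^ 2 / 2 * (y * (N + 2)) := by
    have : x ^ 2 ≤ y * (N + 2) := by nlinarith
    gcongr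
  have e3 : A * p * x * √(1 + N) ≤ A * p * y * (N + 2) := by gcongr
  have : 0 ≤ y * (N + 2) := by apply mul_nonneg hy0; linarith
  nlinarith

/-- Replacing P by its minorant Q at r gives a function below N, touching it at r, with r times its
right derivative at least -C(1-σ) r^{1-σ}(N + 2). Differentiating the exponential contributes
exactly the opposite amount, so all lower right Dini derivatives are nonnegative. -/
theorem monotone_on_interval (h : FrequencyData A ℓ H P E ψ θ Θ) (hA : 0 ≤ A)
    {σ : ℝ} (hℓ : 2 ≤ ℓ) (hσ : σ ∈ Ioo (0 : ℝ) 1) {b c : ℝ} (hb : 0 < b) (hbc : b ≤ c) (hc : c < 1)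
    (hH : ∀ r ∈ Icc b c, r ^ (2 * ℓ - 2 + 2 * σ) ≤ H r) {C : ℝ}
    (hC : C = (4 * A + A ^ 2 / 2 + A * √(2 * (2 * ℓ + 2)) + 1) / (1 - σ)) :
    Real.exp (C * b ^ (1 - σ)) * (P b / H b + 2) ≤
      Real.exp (C * c ^ (1 - σ)) * (P c / H c + 2) := by
  have hsub : Icc b c ⊆ Ioo (0 : ℝ) 1 := fun r hr => ⟨hb.trans_le hr.1, hr.2.trans_lt hc⟩
  have hHpos : ∀ r ∈ Icc b c, 0 < H r := fun r hr =>
    (Real.rpow_pos_of_pos (hsub hr).1 _).trans_le (hH r hr)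
  have hσ1 : 0 < 1 - σ := sub_pos.2 hσ.2
  refine le_of_slope_right_eventually_gt_neg
    (f := fun r => Real.exp (C * r ^ (1 - σ)) * (P r / H r + 2)) hbc ?_ ?_
  · refine ContinuousOn.mul (ContinuousOn.rexp ?_) (ContinuousOn.add (ContinuousOn.div
      (h.continuousOn_numerator.mono hsub) (h.continuousOn_height.mono hsub)
      fun r hr => (hHpos r hr).ne') continuousOn_const)
    exact continuousOn_const.mul
      (continuousOn_id.rpow_const fun r hr => Or.inl (hsub hr).1.ne')
  intro r hr ε hε
  have hr' : r ∈ Icc b c := ⟨hr.1, hr.2.le⟩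
  have hrI := hsub hr'
  have hr0 := hrI.1
  have hHr := hHpos r hr'
  obtain ⟨Q, hQr, hQle, hQ⟩ := h.exists_minorant hrI
  have hexp : HasDerivAt (fun s : ℝ => Real.exp (C * s ^ (1 - σ)))
      (Real.exp (C * r ^ (1 - σ)) * (C * ((1 - σ) * r ^ (1 - σ - 1)))) r :=
    ((Real.hasDerivAt_rpow_const (Or.inl hr0.ne')).const_mul C).exp
  have hquot := ((hQ.div (h.hasDerivAt_height r hrI).hasDerivWithinAt hHr.ne').add_const 2)
  have hprod := hexp.hasDerivWithinAt.mul hquot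
  -- The right derivative at r of the exponential times Q/H + 2.
  set d := Real.exp (C * r ^ (1 - σ)) * (C * ((1 - σ) * r ^ (1 - σ - 1))) * (Q r / H r + 2) +
    Real.exp (C * r ^ (1 - σ)) * (((2 * θ r - 2 * ψ r / r -
        A * √((2 * ℓ + 2) * r ^ (2 * ℓ + 1) * (2 * r * (H r + P r))) / r ^ 2) * H r -
        Q r * (2 * P r / r)) / H r ^ 2) with hd
  have hd0 : 0 ≤ d := by
    set N := P r / H r with hN
    have hPN : P r = N * H r := by rw [hN]; field_simp
    have hN1 : 0 ≤ 1 + N := by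
      have := h.height_add_nonneg hrI
      rw [hPN] at this
      by_contra hneg
      push Not at hneg
      nlinarith
    set x := r ^ ℓ / √(H r) with hx
    have hsq : 0 < √(H r) := Real.sqrt_pos.2 hHr
    have hHsq : √(H r) ^ 2 = H r := Real.sq_sqrt hHr.le
    have hx0 : 0 ≤ x := by positivity
    have hxr : x * √(H r) = r ^ ℓ := by rw [hx]; field_simp
    have hr2 : r ^ (2 * ℓ) = x ^ 2 * H r := by
      rw [← hHsq, ← mul_pow, hxr, ← Real.rpow_natCast, ← Real.rpow_mul hr0.le]; ring_nf
    -- The only use of the lower bound on H beyond its positivity: √H ≥ r^{ℓ-1+σ} makes the force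
    -- small relative to √H.
    have hxy : x ≤ r ^ (1 - σ) := by
      rw [hx, div_le_iff₀ hsq]
      have : r ^ (ℓ - 1 + σ) ≤ √(H r) := by
        apply Real.le_sqrt_of_sq_le
        refine le_trans (le_of_eq ?_) (hH r hr')
        rw [← Real.rpow_natCast, ← Real.rpow_mul hr0.le]; push_cast; ring_nf
      calc r ^ ℓ = r ^ (1 - σ) * r ^ (ℓ - 1 + σ) := by
            rw [← Real.rpow_add hr0]; ring_nf
        _ ≤ _ := by gcongr
    have hy1 : r ^ (1 - σ) ≤ 1 := Real.rpow_le_one hr0.le hrI.2.le hσ1.le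
    have hψ : |ψ r| ≤ A * x * H r := by
      refine (h.abs_forcing_le r hrI).trans (le_of_eq ?_)
      rw [← hxr]; linear_combination A * x * hHsq
    have hroot : √((2 * ℓ + 2) * r ^ (2 * ℓ + 1) * (2 * r * (H r + P r))) =
        √(2 * (2 * ℓ + 2)) * (r * x * H r * √(1 + N)) := by
      have e : (2 * ℓ + 2) * r ^ (2 * ℓ + 1) * (2 * r * (H r + P r)) =
          (2 * (2 * ℓ + 2)) * ((r * x * H r) ^ 2 * (1 + N)) := by
        rw [Real.rpow_add hr0, Real.rpow_one, hr2, hPN]; ring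
      rw [e, Real.sqrt_mul (by linarith), Real.sqrt_mul (sq_nonneg (r * x * H r)),
        Real.sqrt_sq (by positivity)]
    have hkey := minorant_deriv_nonneg hA hN1 hx0 hxy hy1 (Real.sqrt_nonneg (2 * (2 * ℓ + 2)))
    have hCS := h.cauchy_schwarz r hrI hHr
    have hpow : r ^ (1 - σ - 1) = r ^ (1 - σ) / r := by
      rw [Real.rpow_sub_one hr0.ne']
    have hdr : r * d = Real.exp (C * r ^ (1 - σ)) * (C * (1 - σ) * r ^ (1 - σ) * (N + 2) +
        ((2 * r * θ r - 2 * ψ r) / H r - A * √(2 * (2 * ℓ + 2)) * x * √(1 + N) - 2 * N ^ 2)) := by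
      rw [hd, hroot, hQr, hPN, hpow]
      field_simp
    have hCσ : C * (1 - σ) = 4 * A + A ^ 2 / 2 + A * √(2 * (2 * ℓ + 2)) + 1 := by
      rw [hC]; field_simp
    -- The ψ from Cauchy–Schwarz and the one from differentiating the minorant combine to (2N + 2)ψ,
    -- with |ψ| ≤ A x H.
    have hmain : -((2 * |N| + 2) * A * x + A ^ 2 / 2 * x ^ 2) ≤
        (2 * r * θ r - 2 * ψ r) / H r - 2 * N ^ 2 := by
      have e1 : 2 * P r ^ 2 / H r = 2 * N ^ 2 * H r := by rw [hPN]; field_simp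
      rw [e1, hr2] at hCS
      have e2 : (2 * N + 2) * ψ r ≤ (2 * |N| + 2) * (A * x * H r) := by
        calc (2 * N + 2) * ψ r ≤ |(2 * N + 2) * ψ r| := le_abs_self _
          _ = |2 * N + 2| * |ψ r| := abs_mul _ _
          _ ≤ (2 * |N| + 2) * (A * x * H r) := by
            gcongr
            calc |2 * N + 2| ≤ |2 * N| + |2| := abs_add_le _ _
              _ = _ := by simp [abs_mul]
      rw [le_sub_iff_add_le, le_div_iff₀ hHr]
      nlinarith
    have : 0 ≤ r * d := by
      rw [hdr, hCσ]
      refine mul_nonneg (Real.exp_pos _).le ?_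
      linarith
    exact nonneg_of_mul_nonneg_right this hr0
  have hs := (hasDerivWithinAt_iff_tendsto_slope' self_notMem_Ioi).1 hprod
  have hev := hs.eventually_const_lt (show -ε < d by linarith)
  filter_upwards [hev, hQle, Ioo_mem_nhdsGT hr.2] with s hs1 hs2 hs3
  refine hs1.trans_le ?_
  have hHs := hHpos s ⟨hr.1.trans hs3.1.le, hs3.2.le⟩
  simp only [slope_def_field, Pi.mul_apply, Pi.div_apply, hQr]
  have : 0 < s - r := sub_pos.2 hs3.1
  gcongr


/-- Where H ≤ r^p, the function log max - log r^p has a minimum with value 0, so if the derivative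
exists it must be p/r, even at a contact point. -/
theorem half_mul_deriv_log_max (h : FrequencyData A ℓ H P E ψ θ Θ) {p : ℝ} {r : ℝ}
    (hr : r ∈ Ioo (0 : ℝ) 1)
    (hd : DifferentiableAt ℝ (fun r => Real.log (max (H r) (r ^ p))) r) :
    1 / 2 * r * deriv (fun r => Real.log (max (H r) (r ^ p))) r =
      if r ^ p < H r then P r / H r else p / 2 := by
  have hr0 := hr.1
  have hpr : 0 < r ^ p := Real.rpow_pos_of_pos hr0 _
  have hlog : HasDerivAt (fun s : ℝ => Real.log (s ^ p)) (p / r) r := by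
    have := (Real.hasDerivAt_rpow_const (x := r) (p := p) (Or.inl hr0.ne')).log hpr.ne'
    refine this.congr_deriv ?_
    rw [Real.rpow_sub_one hr0.ne']
    field_simp
  split_ifs with hlt
  · have hHr := hpr.trans hlt
    have : deriv (fun r => Real.log (max (H r) (r ^ p))) r = 2 * P r / r / H r := by
      refine HasDerivAt.deriv (((h.hasDerivAt_height r hr).log hHr.ne').congr_of_eventuallyEq ?_)
      filter_upwards [(Real.continuousAt_rpow_const r p (Or.inl hr0.ne')).eventually_lt
        (h.hasDerivAt_height r hr).continuousAt hlt] with s hs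
      rw [max_eq_left hs.le]
    rw [this]; field_simp
  · have hmin : IsLocalMin (fun s => Real.log (max (H s) (s ^ p)) - Real.log (s ^ p)) r := by
      filter_upwards [isOpen_Ioo.mem_nhds hr] with s hs
      rw [max_eq_right (not_lt.1 hlt), sub_self]
      exact sub_nonneg.2 (Real.log_le_log (Real.rpow_pos_of_pos hs.1 _) (le_max_right _ _))
    have := hmin.hasDerivAt_eq_zero (hd.hasDerivAt.sub hlog)
    rw [sub_eq_zero.1 this]; field_simp

/-- `2 + Φ`, where `Φ` is the truncated frequency, in terms of the numerator `P`. -/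
theorem truncated_le_truncated (h : FrequencyData A ℓ H P E ψ θ Θ) (hA : 0 ≤ A)
    {σ : ℝ} (hℓ : 2 ≤ ℓ) (hσ : σ ∈ Ioo (0 : ℝ) 1) {p C : ℝ} (hp : p = 2 * ℓ - 2 + 2 * σ)
    (hC : C = (4 * A + A ^ 2 / 2 + A * √(2 * (2 * ℓ + 2)) + 1) / (1 - σ)) {r s : ℝ}
    (hr : r ∈ Ioo (0 : ℝ) 1) (hs : s ∈ Ioo (0 : ℝ) 1) (hrs : r ≤ s) :
    Real.exp (C * r ^ (1 - σ)) * ((if r ^ p < H r then P r / H r else p / 2) + 2) ≤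
      Real.exp (C * s ^ (1 - σ)) * ((if s ^ p < H s then P s / H s else p / 2) + 2) := by
  have hσ1 : 0 < 1 - σ := sub_pos.2 hσ.2
  have hC0 : 0 ≤ C := by rw [hC]; positivity
  have hp0 : 0 < p := by rw [hp]; linarith [hσ.1]
  have hsub : Icc r s ⊆ Ioo (0 : ℝ) 1 := fun x hx => ⟨hr.1.trans_le hx.1, hx.2.trans_lt hs.2⟩
  have hcH : ContinuousOn H (Icc r s) := h.continuousOn_height.mono hsub
  have hcp : ContinuousOn (fun x : ℝ => x ^ p) (Icc r s) :=
    continuousOn_id.rpow_const fun x hx => Or.inl (hsub hx).1.ne'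
  have hmono := fun {b c : ℝ} => h.monotone_on_interval (b := b) (c := c) hA hℓ hσ
  rw [← hp] at hmono
  have hexp : ∀ {x y : ℝ}, 0 < x → x ≤ y →
      Real.exp (C * x ^ (1 - σ)) ≤ Real.exp (C * y ^ (1 - σ)) := fun hx hxy => by
    gcongr
  -- the logarithmic derivative of `H / r ^ p`
  have hq : ∀ x ∈ Icc r s, H x = x ^ p → HasDerivAt (fun y => Real.log (H y) - Real.log (y ^ p))
      (2 / x * (P x / H x - p / 2)) x := by
    intro x hx hxH
    have hx0 := (hsub hx).1
    have hpx : 0 < x ^ p := Real.rpow_pos_of_pos hx0 _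
    have h1 := (h.hasDerivAt_height x (hsub hx)).log (hxH ▸ hpx).ne'
    have h2 := (Real.hasDerivAt_rpow_const (x := x) (p := p) (Or.inl hx0.ne')).log hpx.ne'
    refine (h1.sub h2).congr_deriv ?_
    rw [Real.rpow_sub_one hx0.ne', hxH]
    field_simp
  by_cases hall : ∀ x ∈ Icc r s, x ^ p < H x
  · rw [if_pos (hall r (left_mem_Icc.2 hrs)), if_pos (hall s (right_mem_Icc.2 hrs))]
    exact hmono hr.1 hrs hs.2 (fun x hx => (hall x hx).le) hC
  · push Not at hall
    -- Compactness of the set where the truncation is active provides its first and last points.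
    -- Between them both sides carry the value p/2, and only the monotone exponential matters.
    set Z := {x ∈ Icc r s | H x ≤ x ^ p} with hZ
    have hZc : IsCompact Z := by
      refine isCompact_Icc.of_isClosed_subset ?_ fun x hx => hx.1
      exact isClosed_Icc.isClosed_le hcH hcp
    have hZn : Z.Nonempty := hall
    -- If r is not in Z, then at the first point of Z the quotient H/x^p comes down to 1 from above,
    -- so its logarithmic derivative is nonpositive, that is N ≤ p/2.
    have hleft : ∀ c ∈ Z, (∀ x ∈ Z, c ≤ x) →
        Real.exp (C * r ^ (1 - σ)) * ((if r ^ p < H r then P r / H r else p / 2) + 2) ≤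
        Real.exp (C * c ^ (1 - σ)) * (p / 2 + 2) := by
      intro c hc hcmin
      split_ifs with hlt
      · have hrc : r < c := lt_of_le_of_ne hc.1.1 (by rintro rfl; exact hc.2.not_gt hlt)
        have hbig : ∀ x ∈ Ico r c, x ^ p < H x := fun x hx => by
          by_contra hcon
          exact (hcmin x ⟨⟨hx.1, hx.2.le.trans hc.1.2⟩, not_lt.1 hcon⟩).not_gt hx.2
        have hHc : H c = c ^ p := by
          refine le_antisymm hc.2 ?_
          have : c ∈ closure (Ico r c) := by
            rw [closure_Ico hrc.ne]; exact right_mem_Icc.2 hrc.le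
          have hsub' : Icc r c ⊆ Icc r s := Icc_subset_Icc_right hc.1.2
          refine le_on_closure (fun x hx => (hbig x hx).le) ?_ ?_ this
          · rw [closure_Ico hrc.ne]; exact hcp.mono hsub'
          · rw [closure_Ico hrc.ne]; exact hcH.mono hsub'
        refine (hmono hr.1 hrc.le (hsub hc.1).2 (fun x hx => ?_) hC).trans ?_
        · rcases hx.2.eq_or_lt with rfl | hlt'
          · exact hHc.ge
          · exact (hbig x ⟨hx.1, hlt'⟩).le
        · have hN : P c / H c - p / 2 ≤ 0 := by
            have hdq := (hasDerivWithinAt_iff_tendsto_slope' (by simp)).1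
              ((hq c hc.1 hHc).hasDerivWithinAt (s := Iio c))
            have : 2 / c * (P c / H c - p / 2) ≤ 0 := by
              refine le_of_tendsto hdq ?_
              filter_upwards [Ioo_mem_nhdsLT hrc] with x hx
              rw [slope_def_field, hHc, sub_self, sub_zero]
              refine div_nonpos_of_nonneg_of_nonpos ?_ (by linarith [hx.2])
              exact sub_nonneg.2 (Real.log_le_log (Real.rpow_pos_of_pos (hr.1.trans hx.1) _)
                (hbig x ⟨hx.1.le, hx.2⟩).le)
            have hc0 := (hsub hc.1).1
            by_contra hcon
            push Not at hcon
            exact this.not_gt (by positivity)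
          exact mul_le_mul_of_nonneg_left (by linarith) (Real.exp_pos _).le
      · exact mul_le_mul_of_nonneg_right (hexp hr.1 hc.1.1) (by linarith)
    -- Symmetrically, after the last point of Z the quotient H/x^p rises from 1, which gives N ≥
    -- p/2.
    have hright : ∀ c ∈ Z, (∀ x ∈ Z, x ≤ c) →
        Real.exp (C * c ^ (1 - σ)) * (p / 2 + 2) ≤
        Real.exp (C * s ^ (1 - σ)) * ((if s ^ p < H s then P s / H s else p / 2) + 2) := by
      intro c hc hcmax
      split_ifs with hlt
      · have hcs : c < s := lt_of_le_of_ne hc.1.2 (by rintro rfl; exact hc.2.not_gt hlt)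
        have hbig : ∀ x ∈ Ioc c s, x ^ p < H x := fun x hx => by
          by_contra hcon
          exact (hcmax x ⟨⟨hc.1.1.trans hx.1.le, hx.2⟩, not_lt.1 hcon⟩).not_gt hx.1
        have hHc : H c = c ^ p := by
          refine le_antisymm hc.2 ?_
          have : c ∈ closure (Ioc c s) := by
            rw [closure_Ioc hcs.ne]; exact left_mem_Icc.2 hcs.le
          have hsub' : Icc c s ⊆ Icc r s := Icc_subset_Icc_left hc.1.1
          refine le_on_closure (fun x hx => (hbig x hx).le) ?_ ?_ this
          · rw [closure_Ioc hcs.ne]; exact hcp.mono hsub'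
          · rw [closure_Ioc hcs.ne]; exact hcH.mono hsub'
        refine le_trans ?_ (hmono (hsub hc.1).1 hcs.le hs.2 (fun x hx => ?_) hC)
        · have hN : 0 ≤ P c / H c - p / 2 := by
            have hdq := (hasDerivWithinAt_iff_tendsto_slope' self_notMem_Ioi).1
              ((hq c hc.1 hHc).hasDerivWithinAt (s := Ioi c))
            have : 0 ≤ 2 / c * (P c / H c - p / 2) := by
              refine ge_of_tendsto hdq ?_
              filter_upwards [Ioo_mem_nhdsGT hcs] with x hx
              rw [slope_def_field, hHc, sub_self, sub_zero]
              refine div_nonneg ?_ (by linarith [hx.1])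
              exact sub_nonneg.2 (Real.log_le_log
                (Real.rpow_pos_of_pos ((hsub hc.1).1.trans hx.1) _)
                (hbig x ⟨hx.1, hx.2.le⟩).le)
            have hc0 := (hsub hc.1).1
            exact nonneg_of_mul_nonneg_right this (by positivity)
          exact mul_le_mul_of_nonneg_left (by linarith) (Real.exp_pos _).le
        · rcases hx.1.eq_or_lt with rfl | hlt'
          · exact hHc.ge
          · exact (hbig x ⟨hlt', hx.2⟩).le
      · exact mul_le_mul_of_nonneg_right (hexp (hsub hc.1).1 hc.1.2) (by linarith)
    obtain ⟨c₁, hc₁, hmin⟩ := hZc.exists_isMinOn hZn continuousOn_id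
    obtain ⟨c₂, hc₂, hmax⟩ := hZc.exists_isMaxOn hZn continuousOn_id
    refine (hleft c₁ hc₁ fun x hx => hmin hx).trans (le_trans ?_ (hright c₂ hc₂ fun x hx => hmax hx))
    exact mul_le_mul_of_nonneg_right (hexp (hsub hc₁.1).1 (hmax hc₁)) (by linarith)

/-- Monotonicity of the truncated frequency. -/
theorem truncated_frequency (h : FrequencyData A ℓ H P E ψ θ Θ) (hA : 0 ≤ A)
    {σ : ℝ} (hℓ : 2 ≤ ℓ) (hσ : σ ∈ Ioo (0 : ℝ) 1) {p C : ℝ} (hp : p = 2 * ℓ - 2 + 2 * σ)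
    (hC : C = (4 * A + A ^ 2 / 2 + A * √(2 * (2 * ℓ + 2)) + 1) / (1 - σ)) {L Φ : ℝ → ℝ} {D : Set ℝ}
    (hL : L = fun r => Real.log (max (H r) (r ^ p)))
    (hΦ : Φ = fun r => 1 / 2 * r * Real.exp (C * r ^ (1 - σ)) * deriv L r +
      2 * (Real.exp (C * r ^ (1 - σ)) - 1))
    (hD : D = {r ∈ Ioo (0 : ℝ) 1 | DifferentiableAt ℝ L r}) :
    ContinuousOn L (Ioo 0 1) ∧ (Ioo (0 : ℝ) 1 \ D).Countable ∧ MonotoneOn Φ D ∧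
      ∃ l : ℝ, Tendsto Φ (𝓝[D] 0) (𝓝 l) := by
  have hpos : ∀ r ∈ Ioo (0 : ℝ) 1, 0 < r ^ p := fun r hr => Real.rpow_pos_of_pos hr.1 _
  have hp0 : 0 < p := by rw [hp]; linarith [hσ.1]
  -- The summand 2(e^{Cr^{1-σ}} - 1) in Φ is what makes Φ + 2 the exponential times the frequency
  -- plus 2.
  have hΦ' : ∀ r ∈ D, Φ r =
      Real.exp (C * r ^ (1 - σ)) * ((if r ^ p < H r then P r / H r else p / 2) + 2) - 2 := by
    intro r hr
    rw [hD] at hr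
    have := hr.2
    rw [hL] at this
    rw [← h.half_mul_deriv_log_max hr.1 this, hΦ, hL]
    ring
  have hDI : D ⊆ Ioo 0 1 := by rw [hD]; exact fun r hr => hr.1
  have hmono : MonotoneOn Φ D := by
    intro r hr s hs hrs
    rw [hΦ' r hr, hΦ' s hs]
    have := h.truncated_le_truncated hA hℓ hσ hp hC (hDI hr) (hDI hs) hrs
    linarith
  -- This lower bound makes the infimum of the nondecreasing Φ finite, and the infimum is the limit
  -- at 0.
  have hbdd : ∀ r ∈ D, -2 ≤ Φ r := by
    intro r hr
    rw [hΦ' r hr]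
    suffices 0 ≤ Real.exp (C * r ^ (1 - σ)) *
      ((if r ^ p < H r then P r / H r else p / 2) + 2) by linarith
    refine mul_nonneg (Real.exp_pos _).le ?_
    split_ifs with hlt
    · have h1 := h.height_add_nonneg (hDI hr)
      have h2 := (hpos r (hDI hr)).trans hlt
      have : -1 ≤ P r / H r := by rw [le_div_iff₀ h2]; linarith
      linarith
    · linarith
  refine ⟨?_, ?_, hmono, ?_⟩
  · rw [hL]
    exact continuousOn_log_max h.continuousOn_height
      (continuousOn_id.rpow_const fun x hx => Or.inl hx.1.ne') hpos
  · have := countable_not_differentiableAt_log_max (I := Ioo (0 : ℝ) 1) (H := H)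
      (B := fun r => r ^ p) (fun r hr => (h.hasDerivAt_height r hr).differentiableAt)
      (fun r hr => (Real.hasDerivAt_rpow_const (Or.inl hr.1.ne')).differentiableAt) hpos
    refine this.mono fun r hr => mem_sep hr.1 fun hd => hr.2 ?_
    rw [hD, hL]
    exact ⟨hr.1, hd⟩
  · rcases D.eq_empty_or_nonempty with hempty | hne
    · exact ⟨0, by simp [hempty]⟩
    refine ⟨sInf (Φ '' D), ?_⟩
    have hbb : BddBelow (Φ '' D) := ⟨-2, by rintro _ ⟨r, hr, rfl⟩; exact hbdd r hr⟩
    rw [tendsto_order]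
    constructor
    · intro c hc
      filter_upwards [self_mem_nhdsWithin] with r hr
      exact hc.trans_le (csInf_le hbb ⟨r, hr, rfl⟩)
    · intro c hc
      obtain ⟨_, ⟨s, hs, rfl⟩, hsc⟩ := exists_lt_of_csInf_lt (hne.image Φ) hc
      filter_upwards [self_mem_nhdsWithin,
        mem_nhdsWithin_of_mem_nhds (Iio_mem_nhds (hDI hs).1)] with r hr hrs
      exact (hmono hr hs (le_of_lt hrs)).trans_lt hsc

end FrequencyData
end ThinObstacle

/-! ### Parabolic dilations and the Gaussian measure. -/

noncomputable section

namespace ThinObstacle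

variable {n : ℕ}

/-- The parabolic dilation `(X, t) ↦ (r X, r² t)`. -/
def dil (r : ℝ) (p : Pt n) : Pt n := (r • p.1, r * p.2.1, r ^ 2 * p.2.2)

/-- The half-strip `{y > 0, -r² < t < 0}`. -/
def lowerStrip (n : ℕ) (r : ℝ) : Set (Pt n) := {p | 0 < p.2.1 ∧ -r ^ 2 < p.2.2 ∧ p.2.2 < 0}

/-- The Gaussian weight `𝒢 y^a`. -/
def gaussWeight (a : ℝ) (p : Pt n) : ℝ := gaussianKernel a p * p.2.1 ^ a

/-- The measure `𝒢 y^a dX dt` on the half-strip of height `r²`. -/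
def gaussMeasure (n : ℕ) (a r : ℝ) : Measure (Pt n) :=
  (volume.restrict (lowerStrip n r)).withDensity fun p => ENNReal.ofReal (gaussWeight a p)

theorem openStrip_eq_lowerStrip (n : ℕ) : openStrip n = lowerStrip n 1 := by
  simp [openStrip, lowerStrip]

theorem isOpen_lowerStrip (n : ℕ) (r : ℝ) : IsOpen (lowerStrip n r) := by
  have h1 : IsOpen {p : Pt n | 0 < p.2.1} := isOpen_lt (by fun_prop) (by fun_prop)
  have h2 : IsOpen {p : Pt n | -r ^ 2 < p.2.2} := isOpen_lt (by fun_prop) (by fun_prop)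
  have h3 : IsOpen {p : Pt n | p.2.2 < 0} := isOpen_lt (by fun_prop) (by fun_prop)
  exact h1.inter (h2.inter h3)

theorem isOpen_openStrip (n : ℕ) : IsOpen (openStrip n) := by
  rw [openStrip_eq_lowerStrip]; exact isOpen_lowerStrip n 1

theorem measurableSet_lowerStrip (n : ℕ) (r : ℝ) : MeasurableSet (lowerStrip n r) :=
  (isOpen_lowerStrip n r).measurableSet

theorem lowerStrip_subset {r s : ℝ} (hr : 0 ≤ r) (hrs : r ≤ s) :
    lowerStrip n r ⊆ lowerStrip n s := fun p hp =>
  ⟨hp.1, by have := hp.2.1; nlinarith, hp.2.2⟩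

theorem lowerStrip_subset_strip (n : ℕ) (r : ℝ) : lowerStrip n r ⊆ strip n r := fun _ hp =>
  ⟨hp.1, hp.2.1, hp.2.2.le⟩

theorem volume_eq_prod_prod (n : ℕ) : (volume : Measure (Pt n)) =
    (volume : Measure (EuclideanSpace ℝ (Fin n))).prod
      ((volume : Measure ℝ).prod (volume : Measure ℝ)) := rfl

/-- The slice t = 0 is null; without it the strip is open and the Gaussian is continuous on it. -/
theorem strip_ae_eq_lowerStrip (n : ℕ) (r : ℝ) :
    strip n r =ᵐ[(volume : Measure (Pt n))] lowerStrip n r := by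
  have h0 : (volume : Measure (Pt n)) {p : Pt n | p.2.2 = 0} = 0 := by
    have : {p : Pt n | p.2.2 = 0} = univ ×ˢ (univ ×ˢ {0}) := by
      ext p; simp
    rw [this, volume_eq_prod_prod, Measure.prod_prod, Measure.prod_prod]
    simp
  have h1 : ∀ᵐ p : Pt n, p.2.2 ≠ 0 := by
    rw [ae_iff]; simpa using h0
  filter_upwards [h1] with p hp
  apply propext
  constructor
  · rintro ⟨h1, h2, h3⟩; exact ⟨h1, h2, lt_of_le_of_ne h3 hp⟩
  · rintro ⟨h1, h2, h3⟩; exact ⟨h1, h2, h3.le⟩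

theorem restrict_strip (n : ℕ) (r : ℝ) : (volume : Measure (Pt n)).restrict (strip n r) =
    volume.restrict (lowerStrip n r) := Measure.restrict_congr_set (strip_ae_eq_lowerStrip n r)

theorem continuous_dil (r : ℝ) : Continuous (dil r : Pt n → Pt n) := by
  unfold dil; fun_prop

theorem dil_dil (r s : ℝ) (p : Pt n) : dil r (dil s p) = dil (r * s) p := by
  simp [dil, smul_smul, mul_assoc, mul_pow]

theorem dil_one (p : Pt n) : dil 1 p = p := by simp [dil]

/-- The dilation as a homeomorphism. -/
def dilHomeo (r : ℝ) (hr : r ≠ 0) : Pt n ≃ₜ Pt n where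
  toFun := dil r
  invFun := dil r⁻¹
  left_inv p := by rw [dil_dil, inv_mul_cancel₀ hr, dil_one]
  right_inv p := by rw [dil_dil, mul_inv_cancel₀ hr, dil_one]
  continuous_toFun := continuous_dil r
  continuous_invFun := continuous_dil r⁻¹

theorem measurableEmbedding_dil {r : ℝ} (hr : r ≠ 0) : MeasurableEmbedding (dil r : Pt n → Pt n) :=
  (dilHomeo r hr).measurableEmbedding

theorem dil_mem_lowerStrip_iff {r s : ℝ} (hr : 0 < r) {p : Pt n} :
    dil r p ∈ lowerStrip n (r * s) ↔ p ∈ lowerStrip n s := by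
  have h2 : 0 < r ^ 2 := by positivity
  simp only [lowerStrip, dil, mem_ofPred_eq, mul_pow, ← mul_neg]
  rw [mul_lt_mul_iff_right₀ h2, mul_pos_iff_of_pos_left hr]
  simp [mul_neg_iff, h2, h2.not_gt]

theorem spaceNorm_sq (p : Pt n) : spaceNorm p ^ 2 = ‖p.1‖ ^ 2 + p.2.1 ^ 2 :=
  Real.sq_sqrt (by positivity)

theorem spaceNorm_dil_sq (r : ℝ) (p : Pt n) : spaceNorm (dil r p) ^ 2 = r ^ 2 * spaceNorm p ^ 2 := by
  rw [spaceNorm_sq, spaceNorm_sq]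
  simp [dil, norm_smul, mul_pow]; ring

theorem parNorm_dil {r : ℝ} (hr : 0 ≤ r) (p : Pt n) : parNorm (dil r p) = r * parNorm p := by
  unfold parNorm
  rw [spaceNorm_dil_sq]
  simp only [dil, abs_mul, abs_pow, abs_of_nonneg hr]
  rw [← mul_add, Real.sqrt_mul (by positivity), Real.sqrt_sq hr]

/-- The Jacobian exponent is n + 1 for the spatial variables plus 2 for time. -/
theorem map_dil_volume {r : ℝ} (hr : 0 < r) :
    Measure.map (dil r : Pt n → Pt n) volume = ENNReal.ofReal ((r ^ (n + 3))⁻¹) • volume := by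
  have e : (dil r : Pt n → Pt n) = Prod.map (fun x => r • x)
    (Prod.map (fun y => r * y) (fun t => r ^ 2 * t)) := rfl
  have h2 : 0 < r ^ 2 := by positivity
  rw [e, volume_eq_prod_prod, ← Measure.map_prod_map _ _ (by fun_prop) (by fun_prop),
    ← Measure.map_prod_map _ _ (by fun_prop) (by fun_prop),
    Measure.map_addHaar_smul _ hr.ne', Real.map_volume_mul_left hr.ne',
    Real.map_volume_mul_left h2.ne', Measure.prod_smul_left, Measure.prod_smul_left,
    Measure.prod_smul_right, Measure.prod_smul_right, Measure.prod_smul_right, smul_smul, smul_smul,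
    ← ENNReal.ofReal_mul (by positivity), ← ENNReal.ofReal_mul (by positivity)]
  congr 2
  rw [finrank_euclideanSpace_fin, abs_of_pos (by positivity), abs_of_pos (by positivity),
    abs_of_pos (by positivity)]
  field_simp
  ring

theorem measurable_gaussianKernel (a : ℝ) : Measurable (gaussianKernel a : Pt n → ℝ) := by
  unfold gaussianKernel spaceNorm
  fun_prop

theorem measurable_gaussWeight (a : ℝ) : Measurable (gaussWeight a : Pt n → ℝ) :=
  (measurable_gaussianKernel a).mul (by fun_prop)

/-- The normalizing constant of the Gaussian. -/
def gaussConst (n : ℕ) (a : ℝ) : ℝ :=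
  (4 * Real.pi) ^ (-(n : ℝ) / 2) / (2 ^ a * Real.Gamma ((a + 1) / 2))

theorem gaussConst_pos (n : ℕ) {a : ℝ} (ha : -1 < a) : 0 < gaussConst n a := by
  have := Real.Gamma_pos_of_pos (show 0 < (a + 1) / 2 by linarith)
  unfold gaussConst
  positivity

theorem gaussianKernel_eq (a : ℝ) (p : Pt n) : gaussianKernel a p =
    gaussConst n a * |p.2.2| ^ (-((n : ℝ) + a + 1) / 2) *
      Real.exp (-(spaceNorm p ^ 2) / (4 * |p.2.2|)) := rfl

theorem gaussianKernel_nonneg {a : ℝ} (ha : -1 < a) (p : Pt n) : 0 ≤ gaussianKernel a p := by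
  rw [gaussianKernel_eq]
  have := gaussConst_pos n ha
  positivity

theorem gaussWeight_nonneg {a : ℝ} (ha : -1 < a) {p : Pt n} (hp : 0 < p.2.1) :
    0 ≤ gaussWeight a p :=
  mul_nonneg (gaussianKernel_nonneg ha p) (Real.rpow_nonneg hp.le _)

/-- The exponent |X|²/(4|t|) is invariant, the power of |t| scales by r^{-(n+a+1)} and y^a by r^a.
-/
theorem gaussWeight_dil {a r : ℝ} (hr : 0 < r) {p : Pt n} (hp : 0 < p.2.1) :
    gaussWeight a (dil r p) = (r ^ (n + 1))⁻¹ * gaussWeight a p := by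
  unfold gaussWeight
  rw [gaussianKernel_eq, gaussianKernel_eq, spaceNorm_dil_sq]
  simp only [dil, abs_mul, abs_pow, abs_of_pos hr]
  have h1 : -(r ^ 2 * spaceNorm p ^ 2) / (4 * (r ^ 2 * |p.2.2|)) =
      -(spaceNorm p ^ 2) / (4 * |p.2.2|) := by
    rw [show -(r ^ 2 * spaceNorm p ^ 2) = r ^ 2 * (-(spaceNorm p ^ 2)) by ring,
      show 4 * (r ^ 2 * |p.2.2|) = r ^ 2 * (4 * |p.2.2|) by ring,
      mul_div_mul_left _ _ (by positivity)]
  rw [h1, Real.mul_rpow (by positivity) (abs_nonneg _), Real.mul_rpow hr.le hp.le,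
    ← Real.rpow_natCast r 2, ← Real.rpow_mul hr.le]
  have h2 : (r ^ (n + 1))⁻¹ = r ^ (((2 : ℕ) : ℝ) * (-((n : ℝ) + a + 1) / 2)) * r ^ a := by
    rw [← Real.rpow_add hr, ← Real.rpow_natCast, ← Real.rpow_neg hr.le]
    congr 1; push_cast; ring
  rw [h2]; ring

/-- The Jacobian r^{n+3} and the factor r^{-(n+1)} of the weight leave r², which is the
normalisation in `height`. -/
theorem map_dil_gaussMeasure {a r s : ℝ} (hr : 0 < r) :
    Measure.map (dil r) (gaussMeasure n a s) =
      ENNReal.ofReal ((r ^ 2)⁻¹) • gaussMeasure n a (r * s) := by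
  have hemb := measurableEmbedding_dil (n := n) hr.ne'
  have hvol : (volume : Measure (Pt n)) =
      ENNReal.ofReal (r ^ (n + 3)) • Measure.map (dil r) volume := by
    rw [map_dil_volume hr, smul_smul, ← ENNReal.ofReal_mul (by positivity),
      mul_inv_cancel₀ (by positivity)]
    simp
  ext S hS
  have hpre : dil r ⁻¹' S ∩ lowerStrip n s = dil r ⁻¹' (S ∩ lowerStrip n (r * s)) := by
    ext p
    simp only [mem_inter_iff, mem_preimage, dil_mem_lowerStrip_iff hr]
  have hmS := hemb.measurable hS
  rw [Measure.map_apply hemb.measurable hS, Measure.smul_apply, gaussMeasure, gaussMeasure,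
    withDensity_apply _ hmS, withDensity_apply _ hS, Measure.restrict_restrict hmS,
    Measure.restrict_restrict hS, hpre]
  conv_rhs => rw [hvol]
  rw [Measure.restrict_smul, lintegral_smul_measure, hemb.restrict_map, hemb.lintegral_map,
    smul_smul, smul_eq_mul, ← ENNReal.ofReal_mul (by positivity),
    ← lintegral_const_mul' _ _ ENNReal.ofReal_ne_top]
  refine setLIntegral_congr_fun (hemb.measurable (hS.inter (measurableSet_lowerStrip n _)))
    fun p hp => ?_
  have hp' : p ∈ lowerStrip n s := (dil_mem_lowerStrip_iff hr).1 hp.2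
  rw [gaussWeight_dil hr hp'.1, ← ENNReal.ofReal_mul (by positivity)]
  congr 1
  field_simp
  ring

theorem integral_comp_dil {a r s : ℝ} (hr : 0 < r) (f : Pt n → ℝ) :
    ∫ p, f (dil r p) ∂gaussMeasure n a s = (r ^ 2)⁻¹ * ∫ p, f p ∂gaussMeasure n a (r * s) := by
  rw [← (measurableEmbedding_dil hr.ne').integral_map, map_dil_gaussMeasure hr,
    integral_smul_measure, ENNReal.toReal_ofReal (by positivity), smul_eq_mul]

theorem integrable_comp_dil {a r s : ℝ} (hr : 0 < r) {f : Pt n → ℝ} :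
    Integrable (fun p => f (dil r p)) (gaussMeasure n a s) ↔
      Integrable f (gaussMeasure n a (r * s)) := by
  have := (measurableEmbedding_dil (n := n) hr.ne').integrable_map_iff
    (μ := gaussMeasure n a s) (g := f)
  rw [map_dil_gaussMeasure hr, integrable_smul_measure (by simpa using by positivity)
    ENNReal.ofReal_ne_top] at this
  exact this.symm

theorem ae_comp_dil {a r s : ℝ} (hr : 0 < r) {q : Pt n → Prop}
    (h : ∀ᵐ p ∂gaussMeasure n a (r * s), q p) : ∀ᵐ p ∂gaussMeasure n a s, q (dil r p) := by
  rw [← (measurableEmbedding_dil (n := n) hr.ne').ae_map_iff, map_dil_gaussMeasure hr]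
  exact Measure.ae_smul_measure h _

theorem ae_gaussMeasure_of_ae {a r : ℝ} {q : Pt n → Prop}
    (h : ∀ᵐ p ∂(volume.restrict (lowerStrip n r)), q p) : ∀ᵐ p ∂gaussMeasure n a r, q p :=
  (withDensity_absolutelyContinuous _ _).ae_le h

theorem ae_mem_lowerStrip (a r : ℝ) : ∀ᵐ p ∂gaussMeasure n a r, p ∈ lowerStrip n r :=
  ae_gaussMeasure_of_ae (ae_restrict_mem (measurableSet_lowerStrip n r))

theorem gaussMeasure_restrict {a r s : ℝ} (hr : 0 ≤ r) (hrs : r ≤ s) :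
    (gaussMeasure n a s).restrict (lowerStrip n r) = gaussMeasure n a r := by
  rw [gaussMeasure, restrict_withDensity (measurableSet_lowerStrip n r),
    Measure.restrict_restrict (measurableSet_lowerStrip n r),
    inter_eq_left.2 (lowerStrip_subset hr hrs), gaussMeasure]

theorem gaussMeasure_mono {a r s : ℝ} (hr : 0 ≤ r) (hrs : r ≤ s) :
    gaussMeasure n a r ≤ gaussMeasure n a s := by
  rw [← gaussMeasure_restrict hr hrs]; exact Measure.restrict_le_self

theorem integral_gaussMeasure {a : ℝ} (ha : -1 < a) (r : ℝ) (f : Pt n → ℝ) :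
    ∫ p, f p ∂gaussMeasure n a r = ∫ p in lowerStrip n r, f p * gaussWeight a p := by
  rw [gaussMeasure, integral_withDensity_eq_integral_toReal_smul
    (measurable_gaussWeight a).ennreal_ofReal (by simp)]
  refine setIntegral_congr_fun (measurableSet_lowerStrip n r) fun p hp => ?_
  simp only [ENNReal.toReal_ofReal (gaussWeight_nonneg ha hp.1), smul_eq_mul, mul_comm]

theorem integrable_gaussMeasure_iff {a : ℝ} (ha : -1 < a) {r : ℝ} {f : Pt n → ℝ} :
    Integrable f (gaussMeasure n a r) ↔
      IntegrableOn (fun p => f p * gaussWeight a p) (lowerStrip n r) := by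
  rw [gaussMeasure, integrable_withDensity_iff (measurable_gaussWeight a).ennreal_ofReal (by simp)]
  refine integrableOn_congr_fun (fun p hp => ?_) (measurableSet_lowerStrip n r)
  rw [ENNReal.toReal_ofReal (gaussWeight_nonneg ha hp.1)]

/-- The dependence on r moves into the integrand over a fixed measure, so that H can be
differentiated under the integral. -/
theorem height_eq {a : ℝ} (ha : -1 < a) {U : Pt n → ℝ} {r : ℝ} (hr : 0 < r) :
    height a U r = ∫ p, U (dil r p) ^ 2 ∂gaussMeasure n a 1 := by
  rw [integral_comp_dil hr (fun p => U p ^ 2), mul_one, integral_gaussMeasure ha, height,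
    restrict_strip, one_div]
  simp only [gaussWeight, mul_assoc]

theorem integrableOn_Ioo_abs_rpow {γ : ℝ} (hγ : -1 < γ) :
    IntegrableOn (fun t : ℝ => |t| ^ γ) (Ioo (-1) 0) := by
  have h := (intervalIntegral.integrableOn_Ioo_rpow_iff (s := γ) one_pos).2 hγ
  have h2 := ((Measure.measurePreserving_neg (volume : Measure ℝ)).integrableOn_comp_preimage
    (MeasurableEquiv.neg ℝ).measurableEmbedding (s := Ioo 0 1)).2 h
  have e : Neg.neg ⁻¹' Ioo (0 : ℝ) 1 = Ioo (-1) 0 := by simp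
  rw [e] at h2
  refine h2.congr_fun (fun t ht => ?_) measurableSet_Ioo
  simp [abs_of_neg ht.2]

/-- If it were not integrable, its integral would be 0 by convention, against the known positive
value. -/
theorem integrable_rexp_neg_mul_sq_norm {b : ℝ} (hb : 0 < b) :
    Integrable (fun v : EuclideanSpace ℝ (Fin n) => Real.exp (-b * ‖v‖ ^ 2)) := by
  by_contra h
  have h1 := GaussianFourier.integral_rexp_neg_mul_sq_norm (V := EuclideanSpace ℝ (Fin n)) hb
  rw [integral_undef h] at h1
  have : 0 < (Real.pi / b) ^ ((Module.finrank ℝ (EuclideanSpace ℝ (Fin n)) : ℝ) / 2) := by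
    positivity
  linarith

theorem restrict_lowerStrip_one (n : ℕ) : (volume : Measure (Pt n)).restrict (lowerStrip n 1) =
    (volume : Measure (EuclideanSpace ℝ (Fin n))).prod
      (((volume : Measure ℝ).restrict (Ioi 0)).prod ((volume : Measure ℝ).restrict (Ioo (-1) 0))) := by
  rw [Measure.prod_restrict]
  conv_rhs => rw [← Measure.restrict_univ (μ := (volume : Measure (EuclideanSpace ℝ (Fin n))))]
  rw [Measure.prod_restrict, volume_eq_prod_prod]
  congr 1
  ext p
  simp [lowerStrip]

/-- By Tonelli: at fixed t the x-integral is a multiple of |t|^{n/2} and the y-integral of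
|t|^{(b+1)/2}; the hypothesis `he` makes the resulting power of |t| integrable at 0. -/
theorem integrableOn_gaussian {e b κ : ℝ} (hκ : 0 < κ) (hb : -1 < b)
    (he : -1 < e + n / 2 + (b + 1) / 2) :
    IntegrableOn (fun p : Pt n => |p.2.2| ^ e * p.2.1 ^ b * Real.exp (-κ * spaceNorm p ^ 2 / |p.2.2|))
      (lowerStrip n 1) := by
  rw [IntegrableOn, restrict_lowerStrip_one]
  have hmeas : Measurable (fun p : Pt n =>
      |p.2.2| ^ e * p.2.1 ^ b * Real.exp (-κ * spaceNorm p ^ 2 / |p.2.2|)) := by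
    unfold spaceNorm; fun_prop
  rw [integrable_prod_iff' hmeas.aestronglyMeasurable]
  have hae : ∀ᵐ q ∂(((volume : Measure ℝ).restrict (Ioi 0)).prod
      ((volume : Measure ℝ).restrict (Ioo (-1) 0))), 0 < q.1 ∧ q.2 < 0 := by
    rw [Measure.prod_restrict]
    filter_upwards [ae_restrict_mem (measurableSet_Ioi.prod measurableSet_Ioo)] with q hq
    exact ⟨hq.1, hq.2.2⟩
  have hsplit : ∀ (x : EuclideanSpace ℝ (Fin n)) (q : ℝ × ℝ),
      |q.2| ^ e * q.1 ^ b * Real.exp (-κ * spaceNorm ((x, q) : Pt n) ^ 2 / |q.2|) =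
      |q.2| ^ e * (q.1 ^ b * Real.exp (-(κ / |q.2|) * q.1 ^ 2)) *
        Real.exp (-(κ / |q.2|) * ‖x‖ ^ 2) := by
    intro x q
    rw [spaceNorm_sq, mul_assoc (|q.2| ^ e), mul_assoc (|q.2| ^ e), mul_assoc (q.1 ^ b),
      ← Real.exp_add]
    congr 3
    ring_nf
  simp only [hsplit]
  constructor
  · filter_upwards [hae] with q hq
    exact (integrable_rexp_neg_mul_sq_norm (div_pos hκ (abs_pos.2 hq.2.ne))).const_mul _
  have hint : ∀ q : ℝ × ℝ, 0 < q.1 ∧ q.2 < 0 →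
      ∫ x : EuclideanSpace ℝ (Fin n), ‖|q.2| ^ e * (q.1 ^ b * Real.exp (-(κ / |q.2|) * q.1 ^ 2)) *
        Real.exp (-(κ / |q.2|) * ‖x‖ ^ 2)‖ =
      (Real.pi / κ) ^ ((n : ℝ) / 2) * |q.2| ^ (e + n / 2) *
        (q.1 ^ b * Real.exp (-(κ / |q.2|) * q.1 ^ 2)) := by
    intro q hq
    have h2 : 0 < |q.2| := abs_pos.2 hq.2.ne
    have h1 := hq.1
    have : ∀ x : EuclideanSpace ℝ (Fin n),
      ‖|q.2| ^ e * (q.1 ^ b * Real.exp (-(κ / |q.2|) * q.1 ^ 2)) *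
        Real.exp (-(κ / |q.2|) * ‖x‖ ^ 2)‖ =
      |q.2| ^ e * (q.1 ^ b * Real.exp (-(κ / |q.2|) * q.1 ^ 2)) *
        Real.exp (-(κ / |q.2|) * ‖x‖ ^ 2) := fun x => Real.norm_of_nonneg (by positivity)
    simp only [this]
    rw [integral_const_mul, GaussianFourier.integral_rexp_neg_mul_sq_norm (by positivity),
      finrank_euclideanSpace_fin, Real.rpow_add h2, div_div_eq_mul_div,
      Real.div_rpow (by positivity) hκ.le, Real.mul_rpow (by positivity) h2.le,
      Real.div_rpow (by positivity) hκ.le]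
    ring
  have hae2 : (fun q : ℝ × ℝ => ∫ x : EuclideanSpace ℝ (Fin n),
      ‖|q.2| ^ e * (q.1 ^ b * Real.exp (-(κ / |q.2|) * q.1 ^ 2)) *
        Real.exp (-(κ / |q.2|) * ‖x‖ ^ 2)‖) =ᵐ[((volume : Measure ℝ).restrict (Ioi 0)).prod
      ((volume : Measure ℝ).restrict (Ioo (-1) 0))] fun q =>
      (Real.pi / κ) ^ ((n : ℝ) / 2) * |q.2| ^ (e + n / 2) *
        (q.1 ^ b * Real.exp (-(κ / |q.2|) * q.1 ^ 2)) := by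
    filter_upwards [hae] with q hq using hint q hq
  rw [integrable_congr hae2, integrable_prod_iff' (Measurable.aestronglyMeasurable (by fun_prop))]
  constructor
  · filter_upwards [ae_restrict_mem measurableSet_Ioo] with t ht
    exact (integrableOn_rpow_mul_exp_neg_mul_sq (div_pos hκ (abs_pos.2 ht.2.ne)) hb).const_mul _
  have hint2 : ∀ t ∈ Ioo (-1 : ℝ) 0, ∫ y in Ioi (0 : ℝ),
      ‖(Real.pi / κ) ^ ((n : ℝ) / 2) * |t| ^ (e + n / 2) *
        (y ^ b * Real.exp (-(κ / |t|) * y ^ 2))‖ =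
      ((Real.pi / κ) ^ ((n : ℝ) / 2) * (κ ^ (-(b + 1) / 2) * (1 / 2) * Real.Gamma ((b + 1) / 2))) *
        |t| ^ (e + n / 2 + (b + 1) / 2) := by
    intro t ht
    have h2 : 0 < |t| := abs_pos.2 ht.2.ne
    have : ∀ y ∈ Ioi (0 : ℝ), ‖(Real.pi / κ) ^ ((n : ℝ) / 2) * |t| ^ (e + n / 2) *
        (y ^ b * Real.exp (-(κ / |t|) * y ^ 2))‖ =
        (Real.pi / κ) ^ ((n : ℝ) / 2) * |t| ^ (e + n / 2) *
        (y ^ b * Real.exp (-(κ / |t|) * y ^ (2 : ℝ))) := fun y hy => by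
      have hy : 0 < y := hy
      rw [Real.norm_of_nonneg (by positivity), Real.rpow_two]
    rw [setIntegral_congr_fun measurableSet_Ioi this, integral_const_mul,
      integral_rpow_mul_exp_neg_mul_rpow two_pos hb (by positivity),
      Real.div_rpow hκ.le h2.le, Real.rpow_add h2 (e + n / 2),
      show -(b + 1) / 2 = -((b + 1) / 2) by ring, Real.rpow_neg h2.le, div_inv_eq_mul]
    ring
  refine Integrable.congr ?_ ((ae_restrict_mem measurableSet_Ioo).mono fun t ht =>
    (hint2 t ht).symm)
  exact (integrableOn_Ioo_abs_rpow he).const_mul _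

/-- Polynomial moments of the Gaussian measure, with a power weight in `y`. -/
theorem integrable_moment {a b : ℝ} (ha : -1 < a) (hab : -1 < a + b) (hb : -2 < b) (k : ℕ) :
    Integrable (fun p : Pt n => (1 + spaceNorm p ^ 2) ^ k * p.2.1 ^ b) (gaussMeasure n a 1) := by
  rw [integrable_gaussMeasure_iff ha]
  -- Half of the exponent |X|²/(4|t|) is kept, whence κ = 1/8. The other half absorbs e^{|X|²/8},
  -- which dominates the polynomial, because |t| ≤ 1. The total power of |t| is b/2, which explains
  -- b > -2.
  have hbase := integrableOn_gaussian (n := n) (e := -((n : ℝ) + a + 1) / 2) (b := a + b)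
    (κ := 1 / 8) (by norm_num) hab (by linarith)
  refine (hbase.const_mul (8 ^ k * k.factorial * Real.exp (1 / 8) * gaussConst n a)).mono'
    ?_ ?_
  · refine (Measurable.aestronglyMeasurable ?_)
    have := measurable_gaussWeight (n := n) a
    unfold spaceNorm
    fun_prop
  filter_upwards [ae_restrict_mem (measurableSet_lowerStrip n 1)] with p hp
  have hy := hp.1
  have ht : 0 < |p.2.2| := abs_pos.2 hp.2.2.ne
  have ht1 : |p.2.2| ≤ 1 := by
    rw [abs_of_neg hp.2.2]; have := hp.2.1; linarith
  have hG := gaussWeight_nonneg ha hy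
  have hc := gaussConst_pos n ha
  rw [Real.norm_of_nonneg (by positivity), gaussWeight, gaussianKernel_eq, Real.rpow_add hy]
  set S := spaceNorm p ^ 2 with hS
  have hS0 : 0 ≤ S := sq_nonneg _
  have h1 : (1 + S) ^ k ≤ 8 ^ k * k.factorial * Real.exp (1 / 8) * Real.exp (S / 8) := by
    have := Real.pow_div_factorial_le_exp ((1 + S) / 8) (by positivity) k
    rw [div_le_iff₀ (by positivity), div_pow, div_le_iff₀ (by positivity)] at this
    rw [mul_assoc, ← Real.exp_add]
    calc (1 + S) ^ k ≤ _ := this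
      _ = _ := by ring_nf
  have h2 : Real.exp (S / 8) * Real.exp (-S / (4 * |p.2.2|)) ≤
      Real.exp (-(1 / 8) * S / |p.2.2|) := by
    rw [← Real.exp_add]
    apply Real.exp_le_exp.2
    have : S / 8 ≤ S / 8 / |p.2.2| := le_div_self (by positivity) ht ht1
    have e1 : -S / (4 * |p.2.2|) = -(2 * (S / 8 / |p.2.2|)) := by
      field_simp
      ring
    have e2 : -(1 / 8) * S / |p.2.2| = -(S / 8 / |p.2.2|) := by ring
    rw [e1, e2]; linarith
  calc (1 + S) ^ k * p.2.1 ^ b * (gaussConst n a * |p.2.2| ^ (-((n : ℝ) + a + 1) / 2) *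
        Real.exp (-S / (4 * |p.2.2|)) * p.2.1 ^ a)
      ≤ (8 ^ k * k.factorial * Real.exp (1 / 8) * Real.exp (S / 8)) * p.2.1 ^ b *
        (gaussConst n a * |p.2.2| ^ (-((n : ℝ) + a + 1) / 2) *
        Real.exp (-S / (4 * |p.2.2|)) * p.2.1 ^ a) := by gcongr
    _ = 8 ^ k * k.factorial * Real.exp (1 / 8) * gaussConst n a *
        (|p.2.2| ^ (-((n : ℝ) + a + 1) / 2) * (p.2.1 ^ a * p.2.1 ^ b) *
        (Real.exp (S / 8) * Real.exp (-S / (4 * |p.2.2|)))) := by ring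
    _ ≤ _ := by gcongr

theorem integrable_polynomial_moment {a : ℝ} (ha : -1 < a) (k : ℕ) :
    Integrable (fun p : Pt n => (1 + spaceNorm p ^ 2) ^ k) (gaussMeasure n a 1) := by
  simpa using integrable_moment (n := n) (b := 0) ha (by linarith) (by norm_num) k

theorem isFiniteMeasure_gaussMeasure {a : ℝ} (ha : -1 < a) :
    IsFiniteMeasure (gaussMeasure n a 1) := by
  have := integrable_polynomial_moment (n := n) ha 0
  simpa [integrable_const_iff] using this

end ThinObstacle

end

/-! ### Quantitative bounds for solutions and Lipschitz continuity in x. -/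

noncomputable section

namespace ThinObstacle

variable {n : ℕ}

/-- Bounds and regularity shared by the solutions of the thin obstacle problem, with a weak time
derivative `g` and a single constant `K`. -/
structure Regular (a : ℝ) (U g : Pt n → ℝ) (K α : ℝ) : Prop where
  nonneg : 0 ≤ K
  exponent_pos : 0 < α
  continuousOn : ContinuousOn U (closedStrip n)
  differentiable_x : ∀ p ∈ strip n 1, ∀ i : Fin n, LineDifferentiableAt ℝ U p (dirX i)
  differentiable_y : ∀ p ∈ strip n 1, LineDifferentiableAt ℝ U p (dirY n)
  abs_dx_le : ∀ p ∈ strip n 1, ∀ i : Fin n, |lineDeriv ℝ U p (dirX i)| ≤ K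
  continuousOn_dx : ∀ i : Fin n, ContinuousOn (fun p => lineDeriv ℝ U p (dirX i)) (strip n 1)
  abs_dy_le : ∀ p ∈ strip n 1, |weightedDy a U p| ≤ K
  holder_dy : ∀ p ∈ strip n 1, ∀ q ∈ strip n 1,
    |weightedDy a U p - weightedDy a U q| ≤ K * parNorm (p - q) ^ α
  weakDeriv : IsWeakDeriv (dirT n) U g
  aestronglyMeasurable : AEStronglyMeasurable g (volume.restrict (openStrip n))
  ae_abs_dt_le : ∀ᵐ p ∂(volume.restrict (openStrip n)), |g p| ≤ K
  support_le : ∀ p ∈ strip n 1, U p ≠ 0 → ‖p‖ ≤ K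

instance isAddHaarMeasure_volume : (volume : Measure (ℝ × ℝ)).IsAddHaarMeasure :=
  inferInstanceAs ((volume : Measure ℝ).prod (volume : Measure ℝ)).IsAddHaarMeasure

instance isAddHaarMeasure_volume_pt : (volume : Measure (Pt n)).IsAddHaarMeasure :=
  inferInstanceAs ((volume : Measure (EuclideanSpace ℝ (Fin n))).prod
    (volume : Measure (ℝ × ℝ))).IsAddHaarMeasure

instance regular_volume_pt : (volume : Measure (Pt n)).Regular := inferInstance

instance isNegInvariant_volume_pt : (volume : Measure (Pt n)).IsNegInvariant := inferInstance

theorem continuous_parNorm : Continuous (parNorm : Pt n → ℝ) := by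
  unfold parNorm spaceNorm; fun_prop

theorem parNorm_zero : parNorm (0 : Pt n) = 0 := by simp [parNorm, spaceNorm]

theorem continuousOn_of_abs_sub_le_parNorm {f : Pt n → ℝ} {S : Set (Pt n)} {K α : ℝ} (hα : 0 < α)
    (h : ∀ p ∈ S, ∀ q ∈ S, |f p - f q| ≤ K * parNorm (p - q) ^ α) : ContinuousOn f S := by
  intro p hp
  rw [ContinuousWithinAt, tendsto_iff_norm_sub_tendsto_zero]
  have hc : Continuous fun q : Pt n => K * parNorm (q - p) ^ α := by
    have := (continuous_parNorm (n := n)).comp (continuous_id.sub (continuous_const (y := p)))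
    exact continuous_const.mul (this.rpow_const fun _ => Or.inr hα.le)
  have hlim : Tendsto (fun q : Pt n => K * parNorm (q - p) ^ α) (𝓝[S] p) (𝓝 0) := by
    have := hc.tendsto p
    rw [sub_self, parNorm_zero, Real.zero_rpow hα.ne', mul_zero] at this
    exact this.mono_left nhdsWithin_le_nhds
  refine squeeze_zero' (Eventually.of_forall fun _ => norm_nonneg _) ?_ hlim
  filter_upwards [self_mem_nhdsWithin] with q hq
  exact h q hq p hp

theorem openStrip_subset_strip (n : ℕ) : openStrip n ⊆ strip n 1 := by
  rw [openStrip_eq_lowerStrip]; exact lowerStrip_subset_strip n 1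

theorem strip_subset_closedStrip (n : ℕ) : strip n 1 ⊆ closedStrip n := fun p hp =>
  ⟨hp.1.le, by have := hp.2.1; simpa using this, hp.2.2⟩

theorem restrict_strip_one (n : ℕ) : (volume : Measure (Pt n)).restrict (strip n 1) =
    volume.restrict (openStrip n) := by rw [restrict_strip, openStrip_eq_lowerStrip]

theorem ae_abs_le_of_memLp_top {μ : Measure (Pt n)} {f : Pt n → ℝ} (hf : MemLp f ⊤ μ) :
    ∃ K, 0 ≤ K ∧ ∀ᵐ p ∂μ, |f p| ≤ K := by
  refine ⟨(eLpNormEssSup f μ).toReal, ENNReal.toReal_nonneg, ?_⟩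
  have hfin : eLpNormEssSup f μ ≠ ⊤ := by
    have := hf.2; rw [eLpNorm_exponent_top] at this; exact this.ne
  filter_upwards [ae_le_eLpNormEssSup (f := f) (μ := μ)] with p hp
  have := ENNReal.toReal_mono hfin hp
  simpa using this

theorem SolutionClass.exists_regular {a : ℝ} {F U : Pt n → ℝ} (h : SolutionClass n a F U) :
    ∃ g K α, Regular a U g K α := by
  obtain ⟨α, hα, -, hx, Ky, hy1, hy2⟩ := h.holder
  obtain ⟨g, hg, hgL⟩ := h.time_deriv
  choose Kx hx1 hx2 using hx
  obtain ⟨Kg, hKg0, hKg⟩ := ae_abs_le_of_memLp_top hgL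
  obtain ⟨R, hR⟩ := h.bounded_support.exists_norm_le
  set K := ∑ i, |Kx i| + |Ky| + Kg + |R| with hK
  have hs : 0 ≤ ∑ i, |Kx i| := Finset.sum_nonneg fun i _ => abs_nonneg _
  have hxi : ∀ i, |Kx i| ≤ ∑ i, |Kx i| := fun i =>
    Finset.single_le_sum (f := fun i => |Kx i|) (fun i _ => abs_nonneg _) (Finset.mem_univ i)
  have hyK : Ky ≤ K := by
    have := le_abs_self Ky; have := abs_nonneg R; linarith
  have hxK : ∀ i, Kx i ≤ K := fun i => by
    have := hxi i; have := le_abs_self (Kx i); have := abs_nonneg R; have := abs_nonneg Ky; linarith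
  rw [restrict_strip_one] at hgL hKg
  refine ⟨g, K, α, ⟨by positivity, hα, h.continuousOn, h.differentiable_x, h.differentiable_y,
    fun p hp i => (hx1 i p hp).trans (hxK i), fun i => continuousOn_of_abs_sub_le_parNorm hα (hx2 i),
    fun p hp => (hy1 p hp).trans hyK, fun p hp q hq => (hy2 p hp q hq).trans ?_, hg, hgL.1, ?_, ?_⟩⟩
  · exact mul_le_mul_of_nonneg_right hyK (Real.rpow_nonneg (Real.sqrt_nonneg _) _)
  · filter_upwards [hKg] with p hp
    refine hp.trans ?_
    have := abs_nonneg R; have := abs_nonneg Ky; linarith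
  · intro p hp hU
    have := hR p ⟨hp, hU⟩
    have := le_abs_self R; have := abs_nonneg Ky; linarith

theorem hasDerivAt_line {f : Pt n → ℝ} {p v : Pt n} {s : ℝ}
    (h : LineDifferentiableAt ℝ f (p + s • v) v) :
    HasDerivAt (fun τ : ℝ => f (p + τ • v)) (lineDeriv ℝ f (p + s • v) v) s := by
  have h1 : HasDerivAt (fun τ : ℝ => f (p + s • v + τ • v)) (lineDeriv ℝ f (p + s • v) v) (s - s) := by
    rw [sub_self]; exact h.hasLineDerivAt
  have h2 := HasDerivAt.comp (h := fun τ : ℝ => τ - s) s h1 ((hasDerivAt_id s).sub_const s)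
  rw [mul_one] at h2
  refine h2.congr_of_eventuallyEq (Eventually.of_forall fun τ => ?_)
  simp only [Function.comp]
  congr 1
  module

theorem add_smul_dirX (p : Pt n) (s : ℝ) (i : Fin n) :
    p + s • dirX i = (p.1 + s • EuclideanSpace.single i 1, p.2.1, p.2.2) := by
  simp [dirX, Prod.ext_iff]

theorem add_smul_dirY (p : Pt n) (s : ℝ) : p + s • dirY n = (p.1, p.2.1 + s, p.2.2) := by
  simp [dirY, Prod.ext_iff]

theorem add_smul_dirT (p : Pt n) (s : ℝ) : p + s • dirT n = (p.1, p.2.1, p.2.2 + s) := by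
  simp [dirT, Prod.ext_iff]

theorem add_smul_dirX_mem {p : Pt n} {r : ℝ} (hp : p ∈ strip n r) (s : ℝ) (i : Fin n) :
    p + s • dirX i ∈ strip n r := by
  rw [add_smul_dirX]; exact hp

theorem rpow_neg_le_add_inv {a y : ℝ} (ha : a ∈ Ioo (-1 : ℝ) 1) (hy : 0 < y) :
    y ^ (-a) ≤ y + y⁻¹ := by
  rcases le_total 1 y with h | h
  · have : y ^ (-a) ≤ y ^ (1 : ℝ) := Real.rpow_le_rpow_of_exponent_le h (by linarith [ha.1])
    rw [Real.rpow_one] at this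
    have := inv_pos.2 hy; linarith
  · have : y ^ (-a) ≤ y ^ (-1 : ℝ) := Real.rpow_le_rpow_of_exponent_ge hy h (by linarith [ha.2])
    rw [Real.rpow_neg_one] at this
    linarith

theorem lineDeriv_dirY_eq {a : ℝ} {U : Pt n → ℝ} {p : Pt n} (hp : 0 < p.2.1) :
    lineDeriv ℝ U p (dirY n) = p.2.1 ^ (-a) * weightedDy a U p := by
  rw [weightedDy, ← mul_assoc, ← Real.rpow_add hp]; simp

namespace Regular

variable {a : ℝ} {U g : Pt n → ℝ} {K α : ℝ}

theorem continuousOn_dy (h : Regular a U g K α) : ContinuousOn (weightedDy a U) (strip n 1) :=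
  continuousOn_of_abs_sub_le_parNorm h.exponent_pos h.holder_dy

theorem abs_sub_le_x_single (h : Regular a U g K α) {p : Pt n} (hp : p ∈ strip n 1) (i : Fin n)
    (c : ℝ) : |U (p + c • dirX i) - U p| ≤ K * |c| := by
  have hd : ∀ s : ℝ, HasDerivAt (fun τ : ℝ => U (p + τ • dirX i))
      (lineDeriv ℝ U (p + s • dirX i) (dirX i)) s := fun s =>
    hasDerivAt_line (h.differentiable_x _ (add_smul_dirX_mem hp s i) i)
  have := Convex.norm_image_sub_le_of_norm_hasDerivWithin_le (s := univ) (x := 0) (y := c)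
    (fun s _ => (hd s).hasDerivWithinAt)
    (fun s _ => h.abs_dx_le _ (add_smul_dirX_mem hp s i) i) convex_univ (mem_univ _) (mem_univ _)
  simpa using this

/-- Only the derivatives along the coordinate directions are given, so the increment is taken along
a path parallel to the axes. -/
theorem abs_sub_le_x_sum (h : Regular a U g K α) {p : Pt n} (hp : p ∈ strip n 1)
    (c : Fin n → ℝ) (S : Finset (Fin n)) :
    p + ∑ i ∈ S, c i • dirX i ∈ strip n 1 ∧
      |U (p + ∑ i ∈ S, c i • dirX i) - U p| ≤ K * ∑ i ∈ S, |c i| := by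
  classical
  induction S using Finset.induction_on with
  | empty => simpa using hp
  | insert j S hj ih =>
    rw [Finset.sum_insert hj, Finset.sum_insert hj, add_comm (c j • dirX j), ← add_assoc]
    refine ⟨add_smul_dirX_mem ih.1 _ _, ?_⟩
    have := h.abs_sub_le_x_single ih.1 j (c j)
    have h2 := abs_sub_le (U (p + ∑ i ∈ S, c i • dirX i + c j • dirX j))
      (U (p + ∑ i ∈ S, c i • dirX i)) (U p)
    linarith [ih.2]

theorem sum_smul_dirX (x : EuclideanSpace ℝ (Fin n)) :
    ∑ i, x i • (dirX i : Pt n) = (x, 0, 0) := by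
  have : ∀ i, x i • (dirX i : Pt n) = (EuclideanSpace.single i (x i), 0, 0) := fun i => by
    have : x i • EuclideanSpace.single i (1 : ℝ) = EuclideanSpace.single i (x i) := by
      ext j; simp
    simp [dirX, this]
  simp only [this]
  refine Prod.ext ?_ (Prod.ext ?_ ?_)
  · rw [Prod.fst_sum]
    ext j
    simp [Pi.single_apply]
  · simp [Prod.snd_sum]
  · simp [Prod.snd_sum]

theorem abs_sub_le_x (h : Regular a U g K α) {x z : EuclideanSpace ℝ (Fin n)} {q : ℝ × ℝ}
    (hp : ((x, q) : Pt n) ∈ strip n 1) : |U (z, q) - U (x, q)| ≤ K * n * ‖z - x‖ := by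
  have h1 := (h.abs_sub_le_x_sum hp (fun i => (z - x) i) Finset.univ).2
  rw [sum_smul_dirX, Prod.mk_add_mk, add_sub_cancel, show q + ((0 : ℝ), (0 : ℝ)) = q from add_zero q] at h1
  refine h1.trans ?_
  rw [mul_assoc]
  refine mul_le_mul_of_nonneg_left ?_ h.nonneg
  calc ∑ i, |(z - x) i| ≤ ∑ _i : Fin n, ‖z - x‖ :=
        Finset.sum_le_sum fun i _ => PiLp.norm_apply_le (z - x) i
    _ = n * ‖z - x‖ := by simp

/-- Moving p in x to a point of norm K + 1, where U vanishes by the support bound, controls U(p) by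
the Lipschitz constant in x. One x-variable is enough for this. -/
theorem exists_abs_le (h : Regular a U g K α) (hn : 1 ≤ n) :
    ∃ M, 0 ≤ M ∧ ∀ p ∈ strip n 1, |U p| ≤ M := by
  have hK := h.nonneg
  refine ⟨K * n * (2 * K + 1), by positivity, fun p hp => ?_⟩
  by_cases hU : U p = 0
  · rw [hU, abs_zero]; positivity
  set z : EuclideanSpace ℝ (Fin n) := EuclideanSpace.single ⟨0, hn⟩ (K + 1) with hz
  have hzn : ‖z‖ = K + 1 := by
    rw [hz, PiLp.norm_single, Real.norm_of_nonneg (by linarith)]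
  have hzU : U (z, p.2) = 0 := by
    by_contra hne
    have h1 := h.support_le (z, p.2) hp hne
    have h2 : ‖z‖ ≤ ‖((z, p.2) : Pt n)‖ := norm_fst_le ((z, p.2) : Pt n)
    linarith
  have h1 := h.abs_sub_le_x (x := p.1) (z := z) (q := p.2) hp
  rw [hzU, zero_sub, abs_neg] at h1
  refine h1.trans ?_
  have h3 : ‖p.1‖ ≤ K := (norm_fst_le p).trans (h.support_le p hp hU)
  have h4 := norm_sub_le z p.1
  gcongr
  linarith

end Regular
end ThinObstacle

end

/-! ### Lipschitz continuity in time from the weak time derivative. -/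

noncomputable section

namespace ThinObstacle

variable {n : ℕ}

namespace Regular

variable {a : ℝ} {U g : Pt n → ℝ} {K α : ℝ}

theorem continuousOn_openStrip (h : Regular a U g K α) : ContinuousOn U (openStrip n) :=
  h.continuousOn.mono ((openStrip_subset_strip n).trans (strip_subset_closedStrip n))

/-- The weak time derivative controls the oscillation of mollifications in time. -/
theorem exists_mollification (h : Regular a U g K α) (hn : 1 ≤ n) (ρ : ContDiffBump (0 : Pt n)) :
    ∃ V : Pt n → ℝ, (∀ x ε, Metric.closedBall x ρ.rOut ⊆ openStrip n →
      (∀ y ∈ Metric.ball x ρ.rOut, |U y - U x| ≤ ε) → |V x - U x| ≤ ε) ∧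
      ∀ p : Pt n, Metric.closedBall p ρ.rOut ⊆ openStrip n → ∃ d, |d| ≤ K ∧
        HasDerivAt (fun s : ℝ => V (p + s • dirT n)) d 0 := by
  obtain ⟨M, hM0, hM⟩ := h.exists_abs_le hn
  set f := (openStrip n).indicator U with hf
  have hfm : AEStronglyMeasurable f volume :=
    (aestronglyMeasurable_indicator_iff (isOpen_openStrip n).measurableSet).2
      (h.continuousOn_openStrip.aestronglyMeasurable (isOpen_openStrip n).measurableSet)
  have hfl : LocallyIntegrable f volume := by
    have : MemLp f ⊤ volume := memLp_top_of_bound hfm M <| Eventually.of_forall fun p => by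
      by_cases hp : p ∈ openStrip n
      · rw [hf, indicator_of_mem hp]; exact hM p (openStrip_subset_strip n hp)
      · rw [hf, indicator_of_notMem hp, norm_zero]; exact hM0
    exact this.locallyIntegrable le_top
  set r : Pt n → ℝ := ρ.normed volume with hr
  have hrc : HasCompactSupport r := ρ.hasCompactSupport_normed
  have hrd : ContDiff ℝ ∞ r := ρ.contDiff_normed
  have hconv : ∀ x, convolution r f (ContinuousLinearMap.lsmul ℝ ℝ) volume x =
      convolution f r (ContinuousLinearMap.lsmul ℝ ℝ) volume x := fun x => by
    rw [convolution_lsmul_swap, convolution_def]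
    simp [mul_comm]
  refine ⟨convolution f r (ContinuousLinearMap.lsmul ℝ ℝ) volume, ?_, ?_⟩
  · intro x ε hx hε
    rw [← hconv]
    have hxm : x ∈ openStrip n := hx (Metric.mem_closedBall_self ρ.rOut_pos.le)
    have := ρ.dist_normed_convolution_le (x₀ := x) (ε := ε) hfm (fun y hy => ?_)
    · rwa [hf, indicator_of_mem hxm, Real.dist_eq] at this
    · rw [hf, indicator_of_mem hxm, indicator_of_mem (hx (Metric.ball_subset_closedBall hy)),
        Real.dist_eq]
      exact hε y hy
  · intro p hp
    have hD := HasCompactSupport.hasFDerivAt_convolution_right (ContinuousLinearMap.lsmul ℝ ℝ)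
      hrc hfl (hrd.of_le (by simp)) p
    have hD' := hD.hasLineDerivAt (dirT n)
    rw [convolution_precompR_apply _ hfl (hrc.fderiv ℝ)
      (hrd.continuous_fderiv (by simp))] at hD'
    refine ⟨_, ?_, hD'⟩
    -- The reflected bump at p is an admissible test function because the ball lies in the open
    -- strip; it makes the time derivative of the mollification an average of g.
    set φ : Pt n → ℝ := fun ξ => r (p - ξ) with hφ
    have hφd : ContDiff ℝ ∞ φ := hrd.comp (contDiff_const.sub contDiff_id)
    have htest : IsTest φ := by
      have hsupp : tsupport φ ⊆ Metric.closedBall p ρ.rOut := by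
        refine closure_minimal (fun ξ hξ => ?_) Metric.isClosed_closedBall
        have h1 : p - ξ ∈ Function.support r := hξ
        rw [hr, ρ.support_normed_eq, mem_ball_zero_iff] at h1
        rw [Metric.mem_closedBall, dist_comm, dist_eq_norm]
        exact h1.le
      exact ⟨hφd, HasCompactSupport.intro (isCompact_closedBall p ρ.rOut) fun ξ hξ =>
        image_eq_zero_of_notMem_tsupport fun hx => hξ (hsupp hx), hsupp.trans hp⟩
    have hline : ∀ ξ, lineDeriv ℝ φ ξ (dirT n) = -(fderiv ℝ r (p - ξ) (dirT n)) := by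
      intro ξ
      have h1 : HasFDerivAt φ _ ξ := (hrd.differentiable (by simp) (p - ξ)).hasFDerivAt.comp ξ
        ((hasFDerivAt_const p ξ).sub (hasFDerivAt_id ξ))
      rw [(h1.hasLineDerivAt (dirT n)).lineDeriv]
      simp
    have hw := h.weakDeriv.2.2 φ htest
    simp only [hline] at hw
    have e : convolution f (fun x => fderiv ℝ r x (dirT n)) (ContinuousLinearMap.lsmul ℝ ℝ) volume p =
        ∫ ξ in openStrip n, g ξ * φ ξ := by
      rw [convolution_def, ← neg_neg (∫ ξ in openStrip n, g ξ * φ ξ), ← hw, ← integral_neg,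
        ← integral_indicator (isOpen_openStrip n).measurableSet]
      congr 1
      ext ξ
      by_cases hξ : ξ ∈ openStrip n
      · simp [hf, indicator_of_mem hξ]
      · simp [hf, indicator_of_notMem hξ]
    rw [e]
    have hφ0 : ∀ ξ, 0 ≤ φ ξ := fun ξ => ρ.nonneg_normed _
    have hφi : Integrable φ volume := hφd.continuous.integrable_of_hasCompactSupport htest.2.1
    have hφ1 : ∫ ξ, φ ξ = 1 := by
      rw [hφ, integral_sub_left_eq_self r volume p]
      exact ρ.integral_normed
    calc |∫ ξ in openStrip n, g ξ * φ ξ| ≤ ∫ ξ in openStrip n, K * φ ξ := by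
          rw [← Real.norm_eq_abs]
          refine norm_integral_le_of_norm_le ((hφi.const_mul K).integrableOn) ?_
          filter_upwards [h.ae_abs_dt_le] with ξ hξ
          rw [norm_mul, Real.norm_of_nonneg (hφ0 ξ)]
          exact mul_le_mul_of_nonneg_right hξ (hφ0 ξ)
      _ ≤ ∫ ξ, K * φ ξ := setIntegral_le_integral (hφi.const_mul K)
          (Eventually.of_forall fun ξ => mul_nonneg h.nonneg (hφ0 ξ))
      _ = K := by rw [integral_const_mul, hφ1, mul_one]

/-- A mollification is K-Lipschitz in t along the segment and, by continuity of U, within ε/2 of U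
at both ends; then ε tends to 0. -/
theorem abs_sub_le_t (h : Regular a U g K α) (hn : 1 ≤ n) {x : EuclideanSpace ℝ (Fin n)} {y t s : ℝ}
    (hy : 0 < y) (ht : t ∈ Ioo (-1 : ℝ) 0) (hs : s ∈ Ioo (-1 : ℝ) 0) :
    |U (x, y, s) - U (x, y, t)| ≤ K * |s - t| := by
  wlog hts : t ≤ s generalizing t s
  · rw [abs_sub_comm, abs_sub_comm s]; exact this hs ht (le_of_not_ge hts)
  rw [abs_of_nonneg (sub_nonneg.2 hts)]
  refine le_of_forall_pos_le_add fun ε hε => ?_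
  have hmem : ∀ τ ∈ Icc t s, ((x, y, τ) : Pt n) ∈ openStrip n := fun τ hτ =>
    ⟨hy, ht.1.trans_le hτ.1, hτ.2.trans_lt hs.2⟩
  have hcont : ∀ τ ∈ Icc t s, ContinuousAt U (x, y, τ) := fun τ hτ =>
    h.continuousOn_openStrip.continuousAt ((isOpen_openStrip n).mem_nhds (hmem τ hτ))
  obtain ⟨δ₁, hδ₁, h1⟩ := Metric.continuousAt_iff.1 (hcont t (left_mem_Icc.2 hts)) (ε / 2) (by positivity)
  obtain ⟨δ₂, hδ₂, h2⟩ := Metric.continuousAt_iff.1 (hcont s (right_mem_Icc.2 hts)) (ε / 2) (by positivity)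
  -- The radius is small enough for continuity at both ends and for the balls around the whole
  -- segment to stay in the open strip.
  have hd : 0 < min (min δ₁ δ₂) (min y (min (t + 1) (-s))) := by
    have := ht.1; have := hs.2
    simp only [lt_min_iff]; refine ⟨⟨hδ₁, hδ₂⟩, hy, by linarith, by linarith⟩
  set δ := min (min δ₁ δ₂) (min y (min (t + 1) (-s))) with hδ
  have hδa : δ ≤ δ₁ := (min_le_left _ _).trans (min_le_left _ _)
  have hδb : δ ≤ δ₂ := (min_le_left _ _).trans (min_le_right _ _)
  have hδc : δ ≤ y := (min_le_right _ _).trans (min_le_left _ _)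
  have hδd : δ ≤ t + 1 := (min_le_right _ _).trans ((min_le_right _ _).trans (min_le_left _ _))
  have hδe : δ ≤ -s := (min_le_right _ _).trans ((min_le_right _ _).trans (min_le_right _ _))
  let ρ : ContDiffBump (0 : Pt n) := ⟨δ / 4, δ / 2, by positivity, by linarith⟩
  have hball : ∀ τ ∈ Icc t s, Metric.closedBall ((x, y, τ) : Pt n) ρ.rOut ⊆ openStrip n := by
    intro τ hτ q hq
    have hq' : dist q (x, y, τ) ≤ δ / 2 := hq
    rw [dist_eq_norm] at hq'
    have e1 : ‖(q - ((x, y, τ) : Pt n)).2‖ ≤ δ / 2 := (norm_snd_le _).trans hq'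
    have e2 := abs_le.1 (((norm_fst_le _).trans e1 : ‖(q - ((x, y, τ) : Pt n)).2.1‖ ≤ δ / 2))
    have e3 := abs_le.1 (((norm_snd_le _).trans e1 : ‖(q - ((x, y, τ) : Pt n)).2.2‖ ≤ δ / 2))
    simp only [Prod.snd_sub, Prod.fst_sub] at e2 e3
    refine ⟨by linarith [e2.1], by linarith [e3.1, hτ.1], by linarith [e3.2, hτ.2]⟩
  obtain ⟨V, hV1, hV2⟩ := h.exists_mollification hn ρ
  have hVt : |V (x, y, t) - U (x, y, t)| ≤ ε / 2 :=
    hV1 _ _ (hball t (left_mem_Icc.2 hts)) fun q hq =>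
      (h1 (lt_of_lt_of_le hq (by change δ / 2 ≤ δ₁; linarith))).le
  have hVs : |V (x, y, s) - U (x, y, s)| ≤ ε / 2 :=
    hV1 _ _ (hball s (right_mem_Icc.2 hts)) fun q hq =>
      (h2 (lt_of_lt_of_le hq (by change δ / 2 ≤ δ₂; linarith))).le
  have hder : ∀ τ ∈ Icc t s, ∃ d, |d| ≤ K ∧ HasDerivAt (fun τ : ℝ => V (x, y, τ)) d τ := by
    intro τ hτ
    obtain ⟨d, hd, hd'⟩ := hV2 _ (hball τ hτ)
    refine ⟨d, hd, ?_⟩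
    simp only [add_smul_dirT] at hd'
    rw [← sub_self τ] at hd'
    have := HasDerivAt.comp (h := fun z : ℝ => z - τ) τ hd' ((hasDerivAt_id τ).sub_const τ)
    rw [mul_one] at this
    refine this.congr_of_eventuallyEq (Eventually.of_forall fun z => ?_)
    simp [Function.comp]
  choose! d hdK hdd using hder
  have hVV := Convex.norm_image_sub_le_of_norm_hasDerivWithin_le (s := Icc t s) (x := t) (y := s)
    (fun τ hτ => (hdd τ hτ).hasDerivWithinAt) hdK (convex_Icc t s)
    (left_mem_Icc.2 hts) (right_mem_Icc.2 hts)
  rw [Real.norm_eq_abs, Real.norm_of_nonneg (sub_nonneg.2 hts)] at hVV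
  rw [abs_le] at *
  constructor <;> linarith [hVV.1, hVV.2, hVt.1, hVt.2, hVs.1, hVs.2]

end Regular
end ThinObstacle

end

/-! ### The Euler field and differentiability almost everywhere. -/

noncomputable section

namespace ThinObstacle

variable {n : ℕ}

/-- The Euler field `X · ∇U + 2 t U_t` of parabolic dilations, with time derivative `g`. -/
def euler (U g : Pt n → ℝ) (p : Pt n) : ℝ :=
  ∑ i, p.1 i * lineDeriv ℝ U p (dirX i) + p.2.1 * lineDeriv ℝ U p (dirY n) + 2 * p.2.2 * g p

/-- The open strip truncated away from `y = 0` and `y = ∞`. -/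
def slab (n m : ℕ) : Set (Pt n) := {p | p ∈ openStrip n ∧ (m : ℝ)⁻¹ < p.2.1 ∧ p.2.1 < m}

theorem isOpen_slab (n m : ℕ) : IsOpen (slab n m) := by
  have h1 : IsOpen {p : Pt n | (m : ℝ)⁻¹ < p.2.1} := isOpen_lt (by fun_prop) (by fun_prop)
  have h2 : IsOpen {p : Pt n | p.2.1 < m} := isOpen_lt (by fun_prop) (by fun_prop)
  exact (isOpen_openStrip n).inter (h1.inter h2)

theorem exists_mem_slab {p : Pt n} (hp : p ∈ openStrip n) : ∃ m, p ∈ slab n m := by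
  obtain ⟨m, hm⟩ := exists_nat_gt (p.2.1 + p.2.1⁻¹)
  have h1 := hp.1
  have h2 := inv_pos.2 h1
  refine ⟨m, hp, ?_, by linarith⟩
  rw [inv_lt_comm₀ (by linarith) h1]
  linarith

theorem decompose_euler_vector (p : Pt n) : ((p.1, p.2.1, 2 * p.2.2) : Pt n) =
    ∑ i, p.1 i • dirX i + p.2.1 • dirY n + (2 * p.2.2) • dirT n := by
  rw [Regular.sum_smul_dirX]
  simp [dirY, dirT]

theorem hasDerivAt_dil (q : Pt n) (r : ℝ) :
    HasDerivAt (fun s => dil s q) (q.1, q.2.1, 2 * r * q.2.2) r := by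
  have h1 : HasDerivAt (fun s : ℝ => s • q.1) ((1 : ℝ) • q.1) r := (hasDerivAt_id r).smul_const q.1
  have h2 : HasDerivAt (fun s : ℝ => s * q.2.1) (1 * q.2.1) r := (hasDerivAt_id r).mul_const q.2.1
  have h3 : HasDerivAt (fun s : ℝ => s ^ 2 * q.2.2) (((2 : ℕ) : ℝ) * r ^ (2 - 1) * q.2.2) r :=
    (hasDerivAt_pow 2 r).mul_const q.2.2
  have := h1.prodMk (h2.prodMk h3)
  simpa [dil] using this

namespace Regular

variable {a : ℝ} {U g : Pt n → ℝ} {K α : ℝ}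

theorem hasDerivAt_y (h : Regular a U g K α) {x : EuclideanSpace ℝ (Fin n)} {y t : ℝ}
    (hp : ((x, y, t) : Pt n) ∈ strip n 1) :
    HasDerivAt (fun η : ℝ => U (x, η, t)) (y ^ (-a) * weightedDy a U (x, y, t)) y := by
  have h1 := h.differentiable_y (x, y, t) hp
  have h2 := hasDerivAt_line (f := U) (p := (x, 0, t)) (v := dirY n) (s := y)
    (by rw [add_smul_dirY]; simpa using h1)
  simp only [add_smul_dirY, zero_add] at h2
  rwa [lineDeriv_dirY_eq (p := (x, y, t)) hp.1] at h2

/-- The increments in x, y and t are taken one after another; on the slab y^{-a} ≤ y + 1/y ≤ 2m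
bounds the derivative in y. -/
theorem lipschitzOnWith_slab (h : Regular a U g K α) (ha : a ∈ Ioo (-1 : ℝ) 1) (hn : 1 ≤ n) (m : ℕ) :
    ∃ C, LipschitzOnWith C U (slab n m) := by
  have hK := h.nonneg
  refine ⟨Real.toNNReal (K * n + K * (2 * m) + K), LipschitzOnWith.of_dist_le_mul ?_⟩
  rintro ⟨x, y, t⟩ hp ⟨z, η, s⟩ hq
  rw [Real.coe_toNNReal _ (by positivity), Real.dist_eq, abs_sub_comm]
  have hm : ∀ w : ℝ, (m : ℝ)⁻¹ < w → w < m → 0 < w ∧ w⁻¹ ≤ m := by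
    intro w h1 h2
    have hm0 : (0 : ℝ) ≤ (m : ℝ)⁻¹ := by positivity
    have hw : 0 < w := hm0.trans_lt h1
    refine ⟨hw, ?_⟩
    rw [inv_le_comm₀ hw (hw.trans h2)]; exact h1.le
  have e1 : |U (z, y, t) - U (x, y, t)| ≤ K * n * ‖z - x‖ :=
    h.abs_sub_le_x (openStrip_subset_strip n hp.1)
  have e2 : |U (z, η, t) - U (z, y, t)| ≤ K * (2 * m) * |η - y| := by
    refine Convex.norm_image_sub_le_of_norm_hasDerivWithin_le (s := Ioo (m : ℝ)⁻¹ m)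
      (f := fun w => U (z, w, t)) (fun w hw => (h.hasDerivAt_y ?_).hasDerivWithinAt) ?_
      (convex_Ioo _ _) hp.2 hq.2
    · exact ⟨(hm w hw.1 hw.2).1, (openStrip_subset_strip n hp.1).2⟩
    · intro w hw
      obtain ⟨hw0, hwm⟩ := hm w hw.1 hw.2
      rw [norm_mul, Real.norm_of_nonneg (Real.rpow_nonneg hw0.le _), mul_comm K]
      have h1 := h.abs_dy_le (z, w, t) ⟨hw0, (openStrip_subset_strip n hp.1).2⟩
      have h2 := rpow_neg_le_add_inv ha hw0
      have h3 := hw.2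
      exact mul_le_mul (by linarith) h1 (abs_nonneg _) (by positivity)
  have e3 : |U (z, η, s) - U (z, η, t)| ≤ K * |s - t| :=
    h.abs_sub_le_t hn hq.1.1 hp.1.2 hq.1.2
  have d : dist ((x, y, t) : Pt n) (z, η, s) = ‖((z - x, η - y, s - t) : Pt n)‖ := by
    rw [dist_comm, dist_eq_norm]; rfl
  have d1 : ‖z - x‖ ≤ ‖((z - x, η - y, s - t) : Pt n)‖ := norm_fst_le ((z - x, η - y, s - t) : Pt n)
  have d0 : ‖((η - y, s - t) : ℝ × ℝ)‖ ≤ ‖((z - x, η - y, s - t) : Pt n)‖ :=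
    norm_snd_le ((z - x, η - y, s - t) : Pt n)
  have d2 : |η - y| ≤ ‖((z - x, η - y, s - t) : Pt n)‖ := (norm_fst_le (η - y, s - t)).trans d0
  have d3 : |s - t| ≤ ‖((z - x, η - y, s - t) : Pt n)‖ := (norm_snd_le (η - y, s - t)).trans d0
  rw [d]
  set D := ‖((z - x, η - y, s - t) : Pt n)‖
  have e1' : K * n * ‖z - x‖ ≤ K * n * D := by gcongr
  have e2' : K * (2 * m) * |η - y| ≤ K * (2 * m) * D := by gcongr
  have e3' : K * |s - t| ≤ K * D := by gcongr
  rw [abs_le] at *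
  constructor <;> linarith [e1.1, e1.2, e2.1, e2.2, e3.1, e3.2]

/-- A solution is differentiable almost everywhere, and its time derivative is the weak one. -/
theorem ae_differentiableAt (h : Regular a U g K α) (ha : a ∈ Ioo (-1 : ℝ) 1) (hn : 1 ≤ n) :
    ∀ᵐ p : Pt n, p ∈ openStrip n → DifferentiableAt ℝ U p ∧ lineDeriv ℝ U p (dirT n) = g p := by
  have key : ∀ m : ℕ, ∀ᵐ p : Pt n, p ∈ slab n m →
      DifferentiableAt ℝ U p ∧ lineDeriv ℝ U p (dirT n) = g p := by
    intro m
    obtain ⟨C, hC⟩ := h.lipschitzOnWith_slab ha hn m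
    -- Rademacher's theorem applies to a global Lipschitz extension. Integrating by parts against
    -- test functions in the slab identifies its t-derivative with g.
    obtain ⟨f, hf, hfU⟩ := hC.extend_real
    have hev : ∀ p ∈ slab n m, U =ᶠ[𝓝 p] f := fun p hp =>
      Filter.eventuallyEq_of_mem ((isOpen_slab n m).mem_nhds hp) hfU
    have hgl : LocallyIntegrableOn g (slab n m) := h.weakDeriv.2.1.mono_set fun p hp => hp.1
    have hfl : LocallyIntegrableOn (fun p => lineDeriv ℝ f p (dirT n)) (slab n m) := by
      have : MemLp (fun p => lineDeriv ℝ f p (dirT n)) ⊤ volume :=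
        memLp_top_of_bound (aestronglyMeasurable_lineDeriv hf.continuous volume) _
          (Eventually.of_forall fun p => norm_lineDeriv_le_of_lipschitz ℝ hf)
      exact (this.locallyIntegrable le_top).locallyIntegrableOn _
    have hzero := (isOpen_slab n m).ae_eq_zero_of_integral_contDiff_smul_eq_zero
      (hfl.sub hgl) fun φ hφ hφc hφs => by
        have hφO : tsupport φ ⊆ openStrip n := hφs.trans fun p hp => hp.1
        have h1 := h.weakDeriv.2.2 φ ⟨hφ, hφc, hφO⟩
        obtain ⟨D, hD⟩ := (hφ.of_le (by simp) : ContDiff ℝ 1 φ).lipschitzWith_of_hasCompactSupport hφc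
          one_ne_zero
        have h2 := hf.integral_lineDeriv_mul_eq (μ := volume) hD hφc (dirT n)
        have hneg : ∀ p, lineDeriv ℝ φ p (-dirT n) = -lineDeriv ℝ φ p (dirT n) := fun p => by
          rw [lineDeriv_neg]
        have hφ0 : ∀ p, p ∉ slab n m → φ p = 0 := fun p hp =>
          image_eq_zero_of_notMem_tsupport fun hx => hp (hφs hx)
        have hdφ0 : ∀ p, p ∉ slab n m → lineDeriv ℝ φ p (dirT n) = 0 := fun p hp => by
          have hz : φ =ᶠ[𝓝 p] fun _ => 0 :=
            notMem_tsupport_iff_eventuallyEq.1 fun hx => hp (hφs hx)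
          rw [hz.lineDeriv_eq]
          simp [lineDeriv]
        have i1 : Integrable (fun p => φ p * lineDeriv ℝ f p (dirT n)) := by
          have : LocallyIntegrable (fun p => lineDeriv ℝ f p (dirT n)) volume :=
            (memLp_top_of_bound (aestronglyMeasurable_lineDeriv hf.continuous volume) _
              (Eventually.of_forall fun p => norm_lineDeriv_le_of_lipschitz ℝ hf)).locallyIntegrable
                le_top
          exact this.integrable_smul_left_of_hasCompactSupport hφ.continuous hφc
        have i2 : Integrable (fun p => φ p * g p) := by
          have : IntegrableOn (fun p => φ p * g p) (tsupport φ) := by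
            have hgi := h.weakDeriv.2.1.integrableOn_compact_subset hφO hφc
            exact hgi.continuousOn_mul hφ.continuous.continuousOn hφc
          rw [← integrableOn_iff_integrable_of_support_subset (s := tsupport φ)]
          · exact this
          · intro p hp
            exact subset_tsupport φ (left_ne_zero_of_mul hp)
        have j1 : ∫ p in openStrip n, U p * lineDeriv ℝ φ p (dirT n) =
            ∫ p, lineDeriv ℝ φ p (dirT n) * f p := by
          rw [← integral_indicator (isOpen_openStrip n).measurableSet]
          congr 1
          ext p
          by_cases hp : p ∈ slab n m
          · rw [indicator_of_mem hp.1, hfU hp, mul_comm]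
          · rw [hdφ0 p hp, zero_mul, indicator_apply_eq_zero]
            intro _; rw [hdφ0 p hp, mul_zero]
        have j2 : ∫ p in openStrip n, g p * φ p = ∫ p, φ p * g p := by
          rw [← integral_indicator (isOpen_openStrip n).measurableSet]
          congr 1
          ext p
          by_cases hp : p ∈ openStrip n
          · rw [indicator_of_mem hp, mul_comm]
          · rw [indicator_of_notMem hp, hφ0 p fun hx => hp hx.1, zero_mul]
        simp only [smul_eq_mul, Pi.sub_apply, mul_sub]
        rw [integral_sub i1 i2]
        simp only [hneg, neg_mul, integral_neg] at h2
        rw [j1, j2] at h1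
        simp only [mul_comm (φ _)] at *
        linarith
    filter_upwards [hzero, hf.ae_differentiableAt] with p hp1 hp2 hp
    refine ⟨hp2.congr_of_eventuallyEq (hev p hp), ?_⟩
    rw [(hev p hp).lineDeriv_eq]
    exact sub_eq_zero.1 (hp1 hp)
  filter_upwards [ae_all_iff.2 key] with p hp hpO
  obtain ⟨m, hm⟩ := exists_mem_slab hpO
  exact hp m hm

/-- The chain rule along s ↦ `dil s q`, whose velocity at r is 1/r times the Euler vector at `dil r
q`. Dilations preserve null sets, so differentiability at almost every p suffices. -/
theorem ae_hasDerivAt_dil (h : Regular a U g K α) (ha : a ∈ Ioo (-1 : ℝ) 1) (hn : 1 ≤ n) {r : ℝ}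
    (hr : r ∈ Ioo (0 : ℝ) 1) : ∀ᵐ q ∂gaussMeasure n a 1,
      HasDerivAt (fun s => U (dil s q)) (euler U g (dil r q) / r) r := by
  have h1 : ∀ᵐ p ∂gaussMeasure n a (r * 1), DifferentiableAt ℝ U p ∧
      lineDeriv ℝ U p (dirT n) = g p := by
    apply ae_gaussMeasure_of_ae
    rw [ae_restrict_iff' (measurableSet_lowerStrip n _)]
    filter_upwards [h.ae_differentiableAt ha hn] with p hp hpr
    refine hp ?_
    rw [openStrip_eq_lowerStrip]
    exact lowerStrip_subset (by linarith [hr.1]) (by linarith [hr.2]) hpr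
  filter_upwards [ae_comp_dil hr.1 h1] with q ⟨hq1, hq2⟩
  have := hq1.hasFDerivAt.comp_hasDerivAt r (hasDerivAt_dil q r)
  refine this.congr_deriv ?_
  have hr0 := hr.1.ne'
  have hv : ((q.1, q.2.1, 2 * r * q.2.2) : Pt n) =
      r⁻¹ • (((dil r q).1, (dil r q).2.1, 2 * (dil r q).2.2) : Pt n) := by
    simp only [dil, Prod.smul_mk, smul_smul, inv_mul_cancel₀ hr0, one_smul, smul_eq_mul]
    refine Prod.ext rfl (Prod.ext ?_ ?_)
    · simp; field_simp
    · simp; field_simp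
  rw [hv, decompose_euler_vector, map_smul, map_add, map_add, map_sum, euler, ← hq2]
  simp only [map_smul, hq1.lineDeriv_eq_fderiv, smul_eq_mul]
  field_simp

end Regular
end ThinObstacle

end

/-! ### Polynomial growth and Lipschitz estimates along dilations. -/

noncomputable section

namespace ThinObstacle

variable {n : ℕ}

/-- The polynomial weight `1 + |X|²`. -/
def growth (p : Pt n) : ℝ := 1 + spaceNorm p ^ 2

theorem one_le_growth (p : Pt n) : 1 ≤ growth p := by
  unfold growth; linarith [sq_nonneg (spaceNorm p)]

theorem norm_fst_le_growth (p : Pt n) : ‖p.1‖ ≤ growth p := by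
  rw [growth, spaceNorm_sq]; nlinarith [sq_nonneg p.2.1, sq_nonneg (‖p.1‖ - 1)]

theorem rpow_le_growth {b : ℝ} (hb : 0 ≤ b) (hb2 : b ≤ 2) {p : Pt n} (hp : 0 < p.2.1) :
    p.2.1 ^ b ≤ growth p := by
  rw [growth, spaceNorm_sq]
  rcases le_total 1 p.2.1 with h | h
  · have := Real.rpow_le_rpow_of_exponent_le h hb2
    rw [Real.rpow_two] at this
    linarith [sq_nonneg ‖p.1‖]
  · have := Real.rpow_le_one hp.le h hb
    linarith [sq_nonneg ‖p.1‖, sq_nonneg p.2.1]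

theorem integrable_growth_pow {a : ℝ} (ha : -1 < a) (k : ℕ) :
    Integrable (fun p : Pt n => growth p ^ k) (gaussMeasure n a 1) :=
  integrable_polynomial_moment ha k

theorem dil_mem_openStrip {r : ℝ} (hr : r ∈ Ioo (0 : ℝ) 1) {q : Pt n} (hq : q ∈ lowerStrip n 1) :
    dil r q ∈ openStrip n := by
  rw [openStrip_eq_lowerStrip]
  have := (dil_mem_lowerStrip_iff hr.1 (p := q) (s := 1)).2 hq
  rw [mul_one] at this
  exact lowerStrip_subset hr.1.le hr.2.le this

theorem aestronglyMeasurable_gaussMeasure {a r : ℝ} {f : Pt n → ℝ}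
    (hf : AEStronglyMeasurable f (volume.restrict (lowerStrip n r))) :
    AEStronglyMeasurable f (gaussMeasure n a r) :=
  hf.mono_ac (withDensity_absolutelyContinuous _ _)

theorem aestronglyMeasurable_comp_dil {a r s : ℝ} (hr : 0 < r) {f : Pt n → ℝ}
    (hf : AEStronglyMeasurable f (gaussMeasure n a (r * s))) :
    AEStronglyMeasurable (fun q => f (dil r q)) (gaussMeasure n a s) := by
  have h : AEStronglyMeasurable f (Measure.map (dil r) (gaussMeasure n a s)) := by
    rw [map_dil_gaussMeasure hr]; exact hf.smul_measure _
  exact h.comp_measurable (measurableEmbedding_dil hr.ne').measurable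

/-- `f ∘ dil r` is measurable when `f` is measurable on the open strip. -/
theorem aestronglyMeasurable_dil_of_openStrip {a r : ℝ} (hr : r ∈ Ioo (0 : ℝ) 1) {f : Pt n → ℝ}
    (hf : AEStronglyMeasurable f (volume.restrict (openStrip n))) :
    AEStronglyMeasurable (fun q => f (dil r q)) (gaussMeasure n a 1) := by
  refine aestronglyMeasurable_comp_dil hr.1 (aestronglyMeasurable_gaussMeasure ?_)
  rw [mul_one]
  rw [openStrip_eq_lowerStrip] at hf
  exact hf.mono_measure (Measure.restrict_mono (lowerStrip_subset hr.1.le hr.2.le) le_rfl)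

theorem ae_dil_of_openStrip {a r : ℝ} (hr : r ∈ Ioo (0 : ℝ) 1) {P : Pt n → Prop}
    (hP : ∀ᵐ p ∂(volume.restrict (openStrip n)), P p) :
    ∀ᵐ q ∂gaussMeasure n a 1, P (dil r q) := by
  refine ae_comp_dil hr.1 (ae_gaussMeasure_of_ae ?_)
  rw [mul_one]
  rw [openStrip_eq_lowerStrip] at hP
  exact ae_mono (Measure.restrict_mono (lowerStrip_subset hr.1.le hr.2.le) le_rfl) hP

theorem growth_dil_le {r : ℝ} (hr : r ∈ Ioo (0 : ℝ) 1) (q : Pt n) : growth (dil r q) ≤ growth q := by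
  unfold growth
  rw [spaceNorm_dil_sq]
  have : r ^ 2 ≤ 1 := by have := hr.1; have := hr.2; nlinarith
  nlinarith [sq_nonneg (spaceNorm q)]

namespace Regular

variable {a : ℝ} {U g : Pt n → ℝ} {K α : ℝ}

/-- The bound |U_y| ≤ K y^{-a} makes K y^{1-a}/(1-a) ± U nondecreasing, and continuity carries this
down to y = 0. -/
theorem abs_sub_le_y (h : Regular a U g K α) (ha : a ∈ Ioo (-1 : ℝ) 1)
    {x : EuclideanSpace ℝ (Fin n)} {y η t : ℝ} (hη : 0 ≤ η) (hy : η ≤ y) (ht : t ∈ Ioc (-1 : ℝ) 0) :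
    |U (x, y, t) - U (x, η, t)| ≤ K / (1 - a) * (y ^ (1 - a) - η ^ (1 - a)) := by
  have ha1 : 0 < 1 - a := sub_pos.2 ha.2
  have hmem : ∀ w : ℝ, 0 < w → ((x, w, t) : Pt n) ∈ strip n 1 := fun w hw =>
    ⟨hw, by have := ht.1; simpa using this, ht.2⟩
  have hpow : ∀ w : ℝ, 0 < w → HasDerivAt (fun w : ℝ => K / (1 - a) * w ^ (1 - a)) (w ^ (-a) * K) w := by
    intro w hw
    have := (Real.hasDerivAt_rpow_const (x := w) (p := 1 - a) (Or.inl hw.ne')).const_mul (K / (1 - a))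
    refine this.congr_deriv ?_
    rw [show 1 - a - 1 = -a by ring]
    field_simp
  have hUc : ContinuousOn (fun w : ℝ => U (x, w, t)) (Icc 0 y) := by
    refine h.continuousOn.comp (by fun_prop) fun w hw => ?_
    exact ⟨hw.1, ht.1, ht.2⟩
  have hpc : ContinuousOn (fun w : ℝ => K / (1 - a) * w ^ (1 - a)) (Icc 0 y) :=
    continuousOn_const.mul (continuousOn_id.rpow_const fun w _ => Or.inr ha1.le)
  have hb : ∀ w : ℝ, 0 < w → |w ^ (-a) * weightedDy a U (x, w, t)| ≤ w ^ (-a) * K := by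
    intro w hw
    rw [abs_mul, abs_of_nonneg (Real.rpow_nonneg hw.le _)]
    exact mul_le_mul_of_nonneg_left (h.abs_dy_le _ (hmem w hw)) (Real.rpow_nonneg hw.le _)
  have hplus := monotoneOn_of_deriv_nonneg (convex_Icc 0 y) (hpc.add hUc)
    (fun w hw => by
      rw [interior_Icc] at hw
      exact ((hpow w hw.1).add (h.hasDerivAt_y (hmem w hw.1))).differentiableAt.differentiableWithinAt)
    (fun w hw => by
      rw [interior_Icc] at hw
      rw [((hpow w hw.1).add (h.hasDerivAt_y (hmem w hw.1))).deriv]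
      linarith [(abs_le.1 (hb w hw.1)).1])
  have hminus := monotoneOn_of_deriv_nonneg (convex_Icc 0 y) (hpc.sub hUc)
    (fun w hw => by
      rw [interior_Icc] at hw
      exact ((hpow w hw.1).sub (h.hasDerivAt_y (hmem w hw.1))).differentiableAt.differentiableWithinAt)
    (fun w hw => by
      rw [interior_Icc] at hw
      rw [((hpow w hw.1).sub (h.hasDerivAt_y (hmem w hw.1))).deriv]
      linarith [(abs_le.1 (hb w hw.1)).2])
  have h1 := hplus (a := η) (b := y) ⟨hη, hy⟩ ⟨hη.trans hy, le_rfl⟩ hy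
  have h2 := hminus (a := η) (b := y) ⟨hη, hy⟩ ⟨hη.trans hy, le_rfl⟩ hy
  simp only [Pi.add_apply, Pi.sub_apply] at h1 h2
  rw [abs_le, mul_sub]
  constructor <;> linarith

/-- The scale is changed in x, then in y, then in t. In y the derivative in w of U(·, wy, ·) is at
most K w^{-a} y^{1-a}; here r₀ bounds w^{-a}, and 0 < 1 - a < 2 gives y^{1-a} ≤ `growth`. The
estimate is the domination needed for differentiating integrals in the scale. -/
theorem abs_dil_sub_le (h : Regular a U g K α) (ha : a ∈ Ioo (-1 : ℝ) 1) (hn : 1 ≤ n) {r₀ r s : ℝ}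
    (hr₀ : 0 < r₀) (hr : r ∈ Ico r₀ 1) (hs : s ∈ Ico r₀ 1) {q : Pt n} (hq : q ∈ lowerStrip n 1) :
    |U (dil s q) - U (dil r q)| ≤ K * (n + 2 / r₀ + 2) * growth q * |s - r| := by
  obtain ⟨x, y, t⟩ := q
  have hK := h.nonneg
  have hs0 := hr₀.trans_le hs.1
  have hrr0 := hr₀.trans_le hr.1
  have hy : 0 < y := hq.1
  have ms := dil_mem_openStrip ⟨hs0, hs.2⟩ hq
  have mr := dil_mem_openStrip ⟨hrr0, hr.2⟩ hq
  have e1 : |U (s • x, s * y, s ^ 2 * t) - U (r • x, s * y, s ^ 2 * t)| ≤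
      K * n * ‖s • x - r • x‖ :=
    h.abs_sub_le_x (openStrip_subset_strip n ⟨ms.1, ms.2⟩)
  have e3 : |U (r • x, r * y, s ^ 2 * t) - U (r • x, r * y, r ^ 2 * t)| ≤
      K * |s ^ 2 * t - r ^ 2 * t| := h.abs_sub_le_t hn (mul_pos hrr0 hy) mr.2 ms.2
  have e2 : |U (r • x, s * y, s ^ 2 * t) - U (r • x, r * y, s ^ 2 * t)| ≤
      K * (2 / r₀ * y ^ (1 - a)) * |s - r| := by
    refine Convex.norm_image_sub_le_of_norm_hasDerivWithin_le (s := Ico r₀ 1)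
      (f := fun w => U (r • x, w * y, s ^ 2 * t))
      (f' := fun w => (w * y) ^ (-a) * weightedDy a U (r • x, w * y, s ^ 2 * t) * (1 * y))
      (fun w hw => ?_) (fun w hw => ?_) (convex_Ico _ _) hr hs
    · have hw0 : 0 < w * y := mul_pos (hr₀.trans_le hw.1) hy
      exact ((h.hasDerivAt_y (x := r • x) (t := s ^ 2 * t) (y := w * y)
        ⟨hw0, (openStrip_subset_strip n ms).2⟩).comp w
          ((hasDerivAt_id w).mul_const y)).hasDerivWithinAt
    · have hw1 := hr₀.trans_le hw.1
      have hw0 : 0 < w * y := mul_pos hw1 hy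
      have b1 := h.abs_dy_le (r • x, w * y, s ^ 2 * t) ⟨hw0, (openStrip_subset_strip n ms).2⟩
      have b2 := rpow_neg_le_add_inv ha hw1
      have b3 : w⁻¹ ≤ r₀⁻¹ := inv_anti₀ hr₀ hw.1
      have b4 : w ≤ r₀⁻¹ := hw.2.le.trans ((one_le_inv₀ hr₀).2 (hw.1.trans hw.2.le))
      have b5 : w ^ (-a) ≤ 2 / r₀ := by rw [div_eq_mul_inv]; linarith
      rw [Real.mul_rpow hw1.le hy.le, norm_mul, norm_mul, one_mul, Real.norm_of_nonneg hy.le,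
        Real.norm_of_nonneg (by positivity), Real.norm_eq_abs]
      have b6 : y ^ (1 - a) = y ^ (-a) * y := by
        rw [← Real.rpow_add_one hy.ne']; ring_nf
      rw [b6]
      calc w ^ (-a) * y ^ (-a) * |weightedDy a U (r • x, w * y, s ^ 2 * t)| * y
          ≤ 2 / r₀ * y ^ (-a) * K * y := by gcongr
        _ = _ := by ring
  have f1 : ‖s • x - r • x‖ ≤ growth (x, y, t) * |s - r| := by
    rw [← sub_smul, norm_smul, mul_comm, Real.norm_eq_abs]
    exact mul_le_mul_of_nonneg_right (norm_fst_le_growth (x, y, t)) (abs_nonneg _)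
  have f2 : y ^ (1 - a) ≤ growth (x, y, t) :=
    rpow_le_growth (p := (x, y, t)) (by linarith [ha.2]) (by linarith [ha.1]) hy
  have f3 : |s ^ 2 * t - r ^ 2 * t| ≤ 2 * growth (x, y, t) * |s - r| := by
    have ht : |t| ≤ 1 := by
      have h1 : (-1 ^ 2 : ℝ) < t := hq.2.1
      have h2 : t < 0 := hq.2.2
      rw [abs_le]; constructor <;> linarith
    rw [show s ^ 2 * t - r ^ 2 * t = (s + r) * t * (s - r) by ring, abs_mul, abs_mul,
      abs_of_pos (by linarith : 0 < s + r)]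
    have := one_le_growth ((x, y, t) : Pt n)
    refine mul_le_mul_of_nonneg_right ?_ (abs_nonneg _)
    calc (s + r) * |t| ≤ 2 * 1 := by
          refine mul_le_mul ?_ ht (abs_nonneg _) (by norm_num)
          linarith [hs.2, hr.2]
      _ ≤ _ := by linarith
  have g1 : K * n * ‖s • x - r • x‖ ≤ K * n * (growth (x, y, t) * |s - r|) := by gcongr
  have g2 : K * (2 / r₀ * y ^ (1 - a)) * |s - r| ≤ K * (2 / r₀ * growth (x, y, t)) * |s - r| := by
    gcongr
  have g3 : K * |s ^ 2 * t - r ^ 2 * t| ≤ K * (2 * growth (x, y, t) * |s - r|) := by gcongr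
  have tot : |U (dil s (x, y, t)) - U (dil r (x, y, t))| ≤ K * n * (growth (x, y, t) * |s - r|) +
      K * (2 / r₀ * growth (x, y, t)) * |s - r| + K * (2 * growth (x, y, t) * |s - r|) := by
    change |U (s • x, s * y, s ^ 2 * t) - U (r • x, r * y, r ^ 2 * t)| ≤ _
    rw [abs_le] at *
    constructor <;> linarith [e1.1, e1.2, e2.1, e2.2, e3.1, e3.2]
  refine tot.trans (le_of_eq ?_)
  ring

/-- The term y U_y equals y^{1-a} times the bounded flux, so the possible singularity of U_y at y =
0 disappears. -/
theorem abs_euler_le (h : Regular a U g K α) (ha : a ∈ Ioo (-1 : ℝ) 1) {p : Pt n}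
    (hp : p ∈ openStrip n) (hg : |g p| ≤ K) : |euler U g p| ≤ K * (n + 3) * growth p := by
  have hK := h.nonneg
  have hps := openStrip_subset_strip n hp
  have h1 : |∑ i, p.1 i * lineDeriv ℝ U p (dirX i)| ≤ n * (growth p * K) := by
    refine (Finset.abs_sum_le_sum_abs _ _).trans ?_
    calc ∑ i, |p.1 i * lineDeriv ℝ U p (dirX i)| ≤ ∑ _i : Fin n, growth p * K := by
          refine Finset.sum_le_sum fun i _ => ?_
          rw [abs_mul]
          exact mul_le_mul ((PiLp.norm_apply_le p.1 i).trans (norm_fst_le_growth p))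
            (h.abs_dx_le p hps i) (abs_nonneg _) (zero_le_one.trans (one_le_growth p))
      _ = _ := by simp
  have h2 : |p.2.1 * lineDeriv ℝ U p (dirY n)| ≤ growth p * K := by
    rw [lineDeriv_dirY_eq hp.1, ← mul_assoc, ← Real.rpow_one_add' (y := -a) hp.1.le (by have := ha.2; intro h0; linarith),
      abs_mul, abs_of_nonneg (Real.rpow_nonneg hp.1.le _)]
    exact mul_le_mul (rpow_le_growth (by linarith [ha.2]) (by linarith [ha.1]) hp.1)
      (h.abs_dy_le p hps) (abs_nonneg _) (zero_le_one.trans (one_le_growth p))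
  have h3 : |2 * p.2.2 * g p| ≤ 2 * (growth p * K) := by
    have ht : |p.2.2| ≤ 1 := abs_le.2 ⟨by linarith [hp.2.1], by linarith [hp.2.2]⟩
    rw [abs_mul, abs_mul, abs_two, mul_assoc]
    refine mul_le_mul_of_nonneg_left (mul_le_mul (ht.trans (one_le_growth p)) hg (abs_nonneg _)
      (zero_le_one.trans (one_le_growth p))) zero_le_two
  refine (abs_add_le _ _).trans ?_
  have := abs_add_le (∑ i, p.1 i * lineDeriv ℝ U p (dirX i)) (p.2.1 * lineDeriv ℝ U p (dirY n))
  nlinarith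

theorem continuousOn_dy' (h : Regular a U g K α) :
    ContinuousOn (fun p => lineDeriv ℝ U p (dirY n)) (openStrip n) := by
  have : ContinuousOn (fun p : Pt n => p.2.1 ^ (-a) * weightedDy a U p) (openStrip n) :=
    ContinuousOn.mul (ContinuousOn.rpow_const (by fun_prop) fun p hp => Or.inl hp.1.ne')
      (h.continuousOn_dy.mono (openStrip_subset_strip n))
  exact this.congr fun p hp => lineDeriv_dirY_eq hp.1

theorem continuousOn_dx' (h : Regular a U g K α) (i : Fin n) :
    ContinuousOn (fun p => lineDeriv ℝ U p (dirX i)) (openStrip n) :=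
  (h.continuousOn_dx i).mono (openStrip_subset_strip n)

theorem aestronglyMeasurable_euler (h : Regular a U g K α) :
    AEStronglyMeasurable (euler U g) (volume.restrict (openStrip n)) := by
  have hO := (isOpen_openStrip n).measurableSet
  have h1 : ContinuousOn (fun p : Pt n => ∑ i, p.1 i * lineDeriv ℝ U p (dirX i) +
      p.2.1 * lineDeriv ℝ U p (dirY n)) (openStrip n) := by
    refine ContinuousOn.add (continuousOn_finsetSum _ fun i _ => ?_) ?_
    · exact ContinuousOn.mul (by fun_prop) (h.continuousOn_dx' i)
    · exact ContinuousOn.mul (by fun_prop) h.continuousOn_dy'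
  exact (h1.aestronglyMeasurable hO).add
    ((Measurable.aestronglyMeasurable (by fun_prop)).mul h.aestronglyMeasurable)

end Regular
end ThinObstacle

end

/-! ### Enlarging the class of test functions in the equation. -/

noncomputable section

namespace ThinObstacle

variable {n : ℕ}

/-- Test functions that are only required to be differentiable in the spatial directions. -/
structure SpatialTest (φ : Pt n → ℝ) : Prop where
  continuous : Continuous φ
  hasCompactSupport : HasCompactSupport φ
  tsupport_subset : tsupport φ ⊆ openStrip n
  differentiable_x : ∀ p (i : Fin n), LineDifferentiableAt ℝ φ p (dirX i)
  differentiable_y : ∀ p, LineDifferentiableAt ℝ φ p (dirY n)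
  continuous_dx : ∀ i : Fin n, Continuous fun p => lineDeriv ℝ φ p (dirX i)
  continuous_dy : Continuous fun p => lineDeriv ℝ φ p (dirY n)

theorem lineDeriv_eq_zero_of_notMem_tsupport {φ : Pt n → ℝ} {p v : Pt n} (hp : p ∉ tsupport φ) :
    lineDeriv ℝ φ p v = 0 := by
  have hz : φ =ᶠ[𝓝 p] fun _ => 0 := notMem_tsupport_iff_eventuallyEq.1 hp
  rw [hz.lineDeriv_eq]
  simp [lineDeriv]

theorem hasCompactSupport_lineDeriv {φ : Pt n → ℝ} (hφ : HasCompactSupport φ) (v : Pt n) :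
    HasCompactSupport fun p => lineDeriv ℝ φ p v :=
  HasCompactSupport.intro hφ fun _ hp => lineDeriv_eq_zero_of_notMem_tsupport hp

theorem integrableOn_mul_of_subset {A D : Pt n → ℝ} {S : Set (Pt n)}
    (hA : LocallyIntegrableOn A (openStrip n)) (hD : Continuous D) (hS : IsCompact S)
    (hSO : S ⊆ openStrip n) (hDS : ∀ p, p ∉ S → D p = 0) :
    Integrable (fun p => A p * D p) (volume.restrict (openStrip n)) := by
  have h1 : IntegrableOn (fun p => A p * D p) S :=
    (hA.integrableOn_compact_subset hSO hS).mul_continuousOn hD.continuousOn hS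
  have h2 : Integrable (fun p => A p * D p) := by
    rw [← integrableOn_iff_integrable_of_support_subset (s := S)]
    · exact h1
    · intro p hp
      by_contra hpS
      exact right_ne_zero_of_mul hp (hDS p hpS)
  exact h2.integrableOn

theorem abs_integral_mul_le {A D : Pt n → ℝ} {S : Set (Pt n)} {ε : ℝ}
    (hA : LocallyIntegrableOn A (openStrip n)) (hS : IsCompact S)
    (hSO : S ⊆ openStrip n) (hDS : ∀ p, p ∉ S → D p = 0) (hDε : ∀ p, |D p| ≤ ε) :
    |∫ p in openStrip n, A p * D p| ≤ ε * ∫ p in S, |A p| := by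
  have e : ∫ p in openStrip n, A p * D p = ∫ p in S, A p * D p := by
    refine setIntegral_eq_of_subset_of_forall_sdiff_eq_zero (isOpen_openStrip n).measurableSet hSO
      fun p hp => ?_
    rw [hDS p hp.2, mul_zero]
  rw [e, ← integral_const_mul, ← Real.norm_eq_abs]
  refine norm_integral_le_of_norm_le
    ((hA.integrableOn_compact_subset hSO hS).abs.const_mul ε) (Eventually.of_forall fun p => ?_)
  rw [norm_mul, mul_comm]
  exact mul_le_mul_of_nonneg_right (hDε p) (norm_nonneg _)

/-- Differentiation under the integral in the single direction v; no regularity of φ in other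
directions beyond continuity enters. -/
theorem hasLineDerivAt_mollification (ρ : ContDiffBump (0 : Pt n)) {φ : Pt n → ℝ} {v : Pt n}
    (hφ : Continuous φ) (hφc : HasCompactSupport φ) (hd : ∀ p, LineDifferentiableAt ℝ φ p v)
    (hdc : Continuous fun p => lineDeriv ℝ φ p v) (p : Pt n) :
    HasLineDerivAt ℝ (convolution (ρ.normed volume) φ (ContinuousLinearMap.lsmul ℝ ℝ) volume)
      (convolution (ρ.normed volume) (fun p => lineDeriv ℝ φ p v)
        (ContinuousLinearMap.lsmul ℝ ℝ) volume p) p v := by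
  obtain ⟨C, hC⟩ := hdc.bounded_above_of_compact_support (hasCompactSupport_lineDeriv hφc v)
  have hρc : Continuous (ρ.normed volume) := ρ.continuous_normed
  have hρi : Integrable (ρ.normed volume) volume := ρ.integrable_normed
  have hline : ∀ (ξ : Pt n) (s : ℝ), HasDerivAt (fun s : ℝ => φ (p + s • v - ξ))
      (lineDeriv ℝ φ (p + s • v - ξ) v) s := fun ξ s => by
    have := hasDerivAt_line (f := φ) (p := p - ξ) (v := v) (s := s) (hd _)
    simpa only [sub_add_eq_add_sub] using this
  have := hasDerivAt_integral_of_dominated_loc_of_deriv_le (μ := (volume : Measure (Pt n)))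
    (F := fun (s : ℝ) ξ => ρ.normed volume ξ * φ (p + s • v - ξ))
    (F' := fun s ξ => ρ.normed volume ξ * lineDeriv ℝ φ (p + s • v - ξ) v) (x₀ := (0 : ℝ))
    (s := univ) (bound := fun ξ => ρ.normed volume ξ * C) univ_mem
    (Eventually.of_forall fun s => Continuous.aestronglyMeasurable (by fun_prop))
    ((by fun_prop : Continuous fun ξ => ρ.normed volume ξ * φ (p + (0 : ℝ) • v - ξ)).integrable_of_hasCompactSupport
      ρ.hasCompactSupport_normed.mul_right)
    (Continuous.aestronglyMeasurable (hρc.mul (hdc.comp (by fun_prop))))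
    (Eventually.of_forall fun ξ s _ => by
      rw [norm_mul, Real.norm_of_nonneg (ρ.nonneg_normed _)]
      exact mul_le_mul_of_nonneg_left (hC _) (ρ.nonneg_normed _))
    (hρi.mul_const C)
    (Eventually.of_forall fun ξ s _ => (hline ξ s).const_mul _)
  have h2 := this.2
  simp only [zero_smul, add_zero] at h2
  exact h2

/-- Mollification commutes with the spatial derivatives, which are uniformly continuous, so it
converges uniformly. The compact set S does not depend on ε, which allows limits against locally
integrable coefficients. -/
theorem SpatialTest.exists_approx {φ : Pt n → ℝ} (h : SpatialTest φ) :
    ∃ S : Set (Pt n), IsCompact S ∧ S ⊆ openStrip n ∧ tsupport φ ⊆ S ∧ ∀ ε > 0, ∃ ψ, IsTest ψ ∧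
      tsupport ψ ⊆ S ∧ (∀ p, |ψ p - φ p| ≤ ε) ∧
      (∀ p (i : Fin n), |lineDeriv ℝ ψ p (dirX i) - lineDeriv ℝ φ p (dirX i)| ≤ ε) ∧
      (∀ p, |lineDeriv ℝ ψ p (dirY n) - lineDeriv ℝ φ p (dirY n)| ≤ ε) := by
  have hc := h.hasCompactSupport
  obtain ⟨δ, hδ, hδO⟩ := hc.exists_cthickening_subset_open (isOpen_openStrip n) h.tsupport_subset
  refine ⟨Metric.cthickening δ (tsupport φ), hc.cthickening, hδO,
    Metric.self_subset_cthickening _, fun ε hε => ?_⟩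
  have huc : ∀ {f : Pt n → ℝ}, Continuous f → HasCompactSupport f →
      ∃ η > 0, ∀ p q, dist p q < η → dist (f p) (f q) ≤ ε := fun hf hfc => by
    obtain ⟨η, hη, hh⟩ := Metric.uniformContinuous_iff.1
      (hfc.uniformContinuous_of_continuous hf) ε hε
    exact ⟨η, hη, fun p q hpq => (hh hpq).le⟩
  obtain ⟨η₀, hη₀, h0⟩ := huc h.continuous hc
  obtain ⟨η₁, hη₁, h1⟩ := huc h.continuous_dy (hasCompactSupport_lineDeriv hc _)
  have hx := fun i => huc (h.continuous_dx i) (hasCompactSupport_lineDeriv hc (dirX i))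
  choose ηx hηx h2 using hx
  have hfin : ∃ η > 0, ∀ i, η ≤ ηx i := by
    have h1 : ∀ᶠ η in 𝓝[>] (0 : ℝ), ∀ i, η ≤ ηx i :=
      eventually_all.2 fun i => Filter.mem_of_superset (Ioo_mem_nhdsGT (hηx i)) fun η hη => hη.2.le
    obtain ⟨η, hη, hη0⟩ := (h1.and self_mem_nhdsWithin).exists
    exact ⟨η, hη0, hη⟩
  obtain ⟨η₂, hη₂, h3⟩ := hfin
  set r := min (min η₀ η₁) (min η₂ δ) with hr
  have hr0 : 0 < r := by simp only [hr, lt_min_iff]; exact ⟨⟨hη₀, hη₁⟩, hη₂, hδ⟩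
  have hra : r ≤ η₀ := (min_le_left _ _).trans (min_le_left _ _)
  have hrb : r ≤ η₁ := (min_le_left _ _).trans (min_le_right _ _)
  have hrc : r ≤ η₂ := (min_le_right _ _).trans (min_le_left _ _)
  have hrd : r ≤ δ := (min_le_right _ _).trans (min_le_right _ _)
  let ρ : ContDiffBump (0 : Pt n) := ⟨r / 2, r, by positivity, by linarith⟩
  have hclose : ∀ {f : Pt n → ℝ} {η : ℝ}, Continuous f → r ≤ η →
      (∀ p q, dist p q < η → dist (f p) (f q) ≤ ε) → ∀ p,
      |convolution (ρ.normed volume) f (ContinuousLinearMap.lsmul ℝ ℝ) volume p - f p| ≤ ε :=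
    fun hf hη hh p => ρ.dist_normed_convolution_le hf.aestronglyMeasurable fun q hq =>
      hh q p (lt_of_lt_of_le hq hη)
  set ψ := convolution (ρ.normed volume) φ (ContinuousLinearMap.lsmul ℝ ℝ) volume with hψ
  have hsupp : tsupport ψ ⊆ Metric.cthickening δ (tsupport φ) := by
    refine closure_minimal (fun p hp => ?_) Metric.isClosed_cthickening
    by_contra hcon
    refine hp ?_
    rw [hψ, convolution_def]
    refine integral_eq_zero_of_ae (Eventually.of_forall fun ξ => ?_)
    by_cases hξ : ξ ∈ Function.support (ρ.normed volume)
    · rw [ρ.support_normed_eq, mem_ball_zero_iff] at hξ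
      have : φ (p - ξ) = 0 := by
        by_contra hne
        refine hcon (Metric.mem_cthickening_of_dist_le p (p - ξ) δ _
          (subset_tsupport φ hne) ?_)
        rw [dist_eq_norm, sub_sub_cancel]
        exact hξ.le.trans hrd
      simp [this]
    · simp [Function.notMem_support.1 hξ]
  have hψd : ContDiff ℝ ∞ ψ := ρ.hasCompactSupport_normed.contDiff_convolution_left _
    ρ.contDiff_normed h.continuous.locallyIntegrable
  refine ⟨ψ, ⟨hψd, ?_, hsupp.trans hδO⟩, hsupp, hclose h.continuous hra h0, fun p i => ?_, fun p => ?_⟩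
  · exact HasCompactSupport.intro hc.cthickening fun p hp =>
      image_eq_zero_of_notMem_tsupport fun hx => hp (hsupp hx)
  · rw [(hasLineDerivAt_mollification ρ h.continuous hc (fun p => h.differentiable_x p i)
      (h.continuous_dx i) p).lineDeriv]
    exact hclose (h.continuous_dx i) (hrc.trans (h3 i)) (h2 i) p
  · rw [(hasLineDerivAt_mollification ρ h.continuous hc h.differentiable_y
      h.continuous_dy p).lineDeriv]
    exact hclose h.continuous_dy hrb h1 p

theorem IsTest.differentiable {φ : Pt n → ℝ} (h : IsTest φ) : Differentiable ℝ φ :=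
  h.1.differentiable (by simp)

theorem IsTest.continuous_lineDeriv {φ : Pt n → ℝ} (h : IsTest φ) (v : Pt n) :
    Continuous fun p => lineDeriv ℝ φ p v := by
  have : (fun p => lineDeriv ℝ φ p v) = fun p => fderiv ℝ φ p v := by
    ext p; exact (h.differentiable p).lineDeriv_eq_fderiv
  rw [this]
  exact (h.1.continuous_fderiv (by simp)).clm_apply continuous_const

/-- The support stays away from y = 0, where y^a could fail to be smooth. -/
theorem IsTest.rpow_mul {φ : Pt n → ℝ} (h : IsTest φ) (a : ℝ) :
    IsTest fun p => p.2.1 ^ a * φ p := by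
  have hs : tsupport (fun p : Pt n => p.2.1 ^ a * φ p) ⊆ tsupport φ :=
    closure_mono fun p hp => right_ne_zero_of_mul hp
  refine ⟨?_, h.2.1.mul_left, hs.trans h.2.2⟩
  rw [contDiff_iff_contDiffAt]
  intro p
  by_cases hp : p ∈ tsupport φ
  · have hy : 0 < p.2.1 := (h.2.2 hp).1
    have h1 : ContDiffAt ℝ ∞ (fun p : Pt n => p.2.1 ^ a) p :=
      ContDiffAt.rpow_const_of_ne (by fun_prop) hy.ne'
    exact h1.mul h.1.contDiffAt
  · have hz := notMem_tsupport_iff_eventuallyEq.1 fun hx => hp (hs hx)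
    exact contDiffAt_const.congr_of_eventuallyEq hz

section Equation

variable {a : ℝ} {F U g : Pt n → ℝ} {K α : ℝ}

theorem continuousOn_rpow_openStrip (a : ℝ) : ContinuousOn (fun p : Pt n => p.2.1 ^ a) (openStrip n) :=
  ContinuousOn.rpow_const (by fun_prop) fun _ hp => Or.inl hp.1.ne'

theorem locallyIntegrableOn_of_continuousOn {A : Pt n → ℝ} (hA : ContinuousOn A (openStrip n)) :
    LocallyIntegrableOn A (openStrip n) := hA.locallyIntegrableOn (isOpen_openStrip n).measurableSet

theorem Regular.locallyIntegrableOn_dx (h : Regular a U g K α) (i : Fin n) :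
    LocallyIntegrableOn (fun p => p.2.1 ^ a * lineDeriv ℝ U p (dirX i)) (openStrip n) :=
  locallyIntegrableOn_of_continuousOn ((continuousOn_rpow_openStrip a).mul (h.continuousOn_dx' i))

theorem Regular.locallyIntegrableOn_dy (h : Regular a U g K α) :
    LocallyIntegrableOn (weightedDy a U) (openStrip n) :=
  locallyIntegrableOn_of_continuousOn (h.continuousOn_dy.mono (openStrip_subset_strip n))

theorem locallyIntegrableOn_rpow_mul {f : Pt n → ℝ} (hf : LocallyIntegrableOn f (openStrip n)) :
    LocallyIntegrableOn (fun p => p.2.1 ^ a * f p) (openStrip n) :=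
  hf.continuousOn_mul (continuousOn_rpow_openStrip a) (isOpen_openStrip n).isLocallyClosed

theorem locallyIntegrableOn_of_memLp_top
    (hF : MemLp F ⊤ (volume.restrict (strip n 1))) : LocallyIntegrableOn F (openStrip n) := by
  rw [restrict_strip_one] at hF
  exact locallyIntegrableOn_of_locallyIntegrable_restrict (hF.locallyIntegrable le_top)

/-- The equation tested with smooth functions, with the time derivative moved back to `U`. -/
theorem Regular.equation_isTest (h : Regular a U g K α) (heq : SolvesEquation a F U)
    (hF : MemLp F ⊤ (volume.restrict (strip n 1))) {φ : Pt n → ℝ} (hφ : IsTest φ) :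
    (∑ i, ∫ p in openStrip n, p.2.1 ^ a * lineDeriv ℝ U p (dirX i) * lineDeriv ℝ φ p (dirX i)) +
      ∫ p in openStrip n, weightedDy a U p * lineDeriv ℝ φ p (dirY n) =
      ∫ p in openStrip n, p.2.1 ^ a * (F p - g p) * φ p := by
  have hz : ∀ v p, p ∉ tsupport φ → lineDeriv ℝ φ p v = 0 := fun v p hp =>
    lineDeriv_eq_zero_of_notMem_tsupport hp
  have hz0 : ∀ p, p ∉ tsupport φ → φ p = 0 := fun p hp => image_eq_zero_of_notMem_tsupport hp
  have hI : ∀ {A : Pt n → ℝ}, LocallyIntegrableOn A (openStrip n) → ∀ v,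
      Integrable (fun p => A p * lineDeriv ℝ φ p v) (volume.restrict (openStrip n)) :=
    fun hA v => integrableOn_mul_of_subset hA (hφ.continuous_lineDeriv v) hφ.2.1 hφ.2.2 (hz v)
  have hI0 : ∀ {A : Pt n → ℝ}, LocallyIntegrableOn A (openStrip n) →
      Integrable (fun p => A p * φ p) (volume.restrict (openStrip n)) :=
    fun hA => integrableOn_mul_of_subset hA hφ.1.continuous hφ.2.1 hφ.2.2 hz0
  have hFl := locallyIntegrableOn_rpow_mul (a := a) (locallyIntegrableOn_of_memLp_top hF)
  have hgl := locallyIntegrableOn_rpow_mul (a := a) h.weakDeriv.2.1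
  have hUl := locallyIntegrableOn_rpow_mul (a := a)
    (locallyIntegrableOn_of_continuousOn h.continuousOn_openStrip)
  -- The weight y^a is constant in t, so it can be absorbed into the test function for the weak time
  -- derivative.
  have h1 := h.weakDeriv.2.2 _ (hφ.rpow_mul a)
  have ht : ∀ p, lineDeriv ℝ (fun p : Pt n => p.2.1 ^ a * φ p) p (dirT n) =
      p.2.1 ^ a * lineDeriv ℝ φ p (dirT n) := fun p => by
    have := hasDerivAt_line (s := 0) (hφ.differentiable (p + (0 : ℝ) • dirT n)).lineDifferentiableAt
      (v := dirT n)
    rw [zero_smul, add_zero] at this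
    have h2 := this.const_mul (p.2.1 ^ a)
    rw [lineDeriv]
    refine HasDerivAt.deriv (h2.congr_of_eventuallyEq (Eventually.of_forall fun s => ?_))
    simp [add_smul_dirT]
  simp only [ht] at h1
  have h2 := heq φ hφ
  have e1 : ∀ p : Pt n, p.2.1 ^ a * ((∑ i, lineDeriv ℝ U p (dirX i) * lineDeriv ℝ φ p (dirX i))
          + lineDeriv ℝ U p (dirY n) * lineDeriv ℝ φ p (dirY n) - U p * lineDeriv ℝ φ p (dirT n)) =
      ∑ i, p.2.1 ^ a * lineDeriv ℝ U p (dirX i) * lineDeriv ℝ φ p (dirX i) +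
      weightedDy a U p * lineDeriv ℝ φ p (dirY n) - p.2.1 ^ a * U p * lineDeriv ℝ φ p (dirT n) :=
    fun p => by
      simp only [weightedDy, mul_sub, mul_add, Finset.mul_sum, mul_assoc]
  have e2 : ∀ p : Pt n, p.2.1 ^ a * (F p - g p) * φ p =
      p.2.1 ^ a * F p * φ p - p.2.1 ^ a * g p * φ p := fun p => by ring
  simp only [e1] at h2
  simp only [e2]
  have hs : Integrable (fun p => ∑ i, p.2.1 ^ a * lineDeriv ℝ U p (dirX i) *
      lineDeriv ℝ φ p (dirX i)) (volume.restrict (openStrip n)) :=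
    integrable_finsetSum _ fun i _ => hI (h.locallyIntegrableOn_dx i) _
  have hsy := hI h.locallyIntegrableOn_dy (dirY n)
  have h3 := integral_sub (hs.add hsy) (hI hUl (dirT n))
  simp only [Pi.add_apply] at h3
  rw [h3, integral_add hs hsy,
    integral_finsetSum _ fun i _ => hI (h.locallyIntegrableOn_dx i) _] at h2
  rw [integral_sub (hI0 hFl) (hI0 hgl)]
  have e3 : ∀ p : Pt n, U p * (p.2.1 ^ a * lineDeriv ℝ φ p (dirT n)) =
      p.2.1 ^ a * U p * lineDeriv ℝ φ p (dirT n) := fun p => by ring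
  have e4 : ∀ p : Pt n, g p * (p.2.1 ^ a * φ p) = p.2.1 ^ a * g p * φ p := fun p => by ring
  simp only [e3, e4] at h1
  linarith

/-- The equation tested with functions that are differentiable in the spatial directions only. -/
theorem Regular.equation_spatialTest (h : Regular a U g K α) (heq : SolvesEquation a F U)
    (hF : MemLp F ⊤ (volume.restrict (strip n 1))) {φ : Pt n → ℝ} (hφ : SpatialTest φ) :
    (∑ i, ∫ p in openStrip n, p.2.1 ^ a * lineDeriv ℝ U p (dirX i) * lineDeriv ℝ φ p (dirX i)) +
      ∫ p in openStrip n, weightedDy a U p * lineDeriv ℝ φ p (dirY n) =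
      ∫ p in openStrip n, p.2.1 ^ a * (F p - g p) * φ p := by
  obtain ⟨S, hS, hSO, hφS, happ⟩ := hφ.exists_approx
  have hBl : LocallyIntegrableOn (fun p => p.2.1 ^ a * (F p - g p)) (openStrip n) :=
    locallyIntegrableOn_rpow_mul ((locallyIntegrableOn_of_memLp_top hF).sub h.weakDeriv.2.1)
  -- The total mass of the coefficients on S: an ε-approximation of φ changes the identity by at
  -- most εT.
  set T := (∑ i, ∫ p in S, |p.2.1 ^ a * lineDeriv ℝ U p (dirX i)|) +
    (∫ p in S, |weightedDy a U p|) + ∫ p in S, |p.2.1 ^ a * (F p - g p)| with hT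
  have hstep : ∀ {A D E : Pt n → ℝ} {ε : ℝ}, LocallyIntegrableOn A (openStrip n) → Continuous D →
      Continuous E → (∀ p, p ∉ S → D p = 0) → (∀ p, p ∉ S → E p = 0) → (∀ p, |D p - E p| ≤ ε) →
      |(∫ p in openStrip n, A p * D p) - ∫ p in openStrip n, A p * E p| ≤ ε * ∫ p in S, |A p| := by
    intro A D E ε hA hD hE hDS hES hDE
    rw [← integral_sub (integrableOn_mul_of_subset hA hD hS hSO hDS)
      (integrableOn_mul_of_subset hA hE hS hSO hES)]
    simp only [← mul_sub]
    exact abs_integral_mul_le hA hS hSO (fun p hp => by rw [hDS p hp, hES p hp, sub_zero]) hDE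
  have key : ∀ ε > 0, |((∑ i, ∫ p in openStrip n,
      p.2.1 ^ a * lineDeriv ℝ U p (dirX i) * lineDeriv ℝ φ p (dirX i)) +
      ∫ p in openStrip n, weightedDy a U p * lineDeriv ℝ φ p (dirY n)) -
      ∫ p in openStrip n, p.2.1 ^ a * (F p - g p) * φ p| ≤ ε * T := by
    intro ε hε
    obtain ⟨ψ, hψ, hψS, h0, hx, hy⟩ := happ ε hε
    have hid := h.equation_isTest heq hF hψ
    have hd : ∀ {f : Pt n → ℝ}, tsupport f ⊆ S → ∀ v p, p ∉ S → lineDeriv ℝ f p v = 0 :=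
      fun hf v p hp => lineDeriv_eq_zero_of_notMem_tsupport fun hx => hp (hf hx)
    have hd0 : ∀ {f : Pt n → ℝ}, tsupport f ⊆ S → ∀ p, p ∉ S → f p = 0 :=
      fun hf p hp => image_eq_zero_of_notMem_tsupport fun hx => hp (hf hx)
    have k1 := fun i => hstep (h.locallyIntegrableOn_dx i) (hψ.continuous_lineDeriv (dirX i))
      (hφ.continuous_dx i) (hd hψS _) (hd hφS _) (fun p => hx p i)
    have k2 := hstep h.locallyIntegrableOn_dy (hψ.continuous_lineDeriv (dirY n))
      hφ.continuous_dy (hd hψS _) (hd hφS _) hy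
    have k3 := hstep hBl hψ.1.continuous hφ.continuous (hd0 hψS) (hd0 hφS) h0
    have k1' := (Finset.abs_sum_le_sum_abs _ Finset.univ).trans
      (Finset.sum_le_sum fun i _ => k1 i)
    rw [Finset.sum_sub_distrib, ← Finset.mul_sum] at k1'
    rw [hT, mul_add, mul_add]
    rw [abs_le] at *
    constructor <;> linarith [k1'.1, k1'.2, k2.1, k2.2, k3.1, k3.2]
  have hlim : Tendsto (fun ε : ℝ => ε * T) (𝓝[>] 0) (𝓝 0) := by
    have : Tendsto (fun ε : ℝ => ε * T) (𝓝 0) (𝓝 (0 * T)) := (continuous_mul_const T).tendsto 0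
    rw [zero_mul] at this
    exact this.mono_left nhdsWithin_le_nhds
  have h0 := ge_of_tendsto hlim (eventually_mem_nhdsWithin.mono fun ε hε => key ε hε)
  exact sub_eq_zero.1 (abs_nonpos_iff.1 h0)

end Equation
end ThinObstacle

end

/-! ### Cutoffs, and integrability of the weak formulation against the Gaussian. -/

noncomputable section

namespace ThinObstacle

variable {n : ℕ}

/-- A smooth cutoff of the half-line, vanishing on `s ≤ δ` and equal to `1` on `s ≥ 2 δ`. -/
def cut (δ s : ℝ) : ℝ := Real.smoothTransition (s / δ - 1)

theorem cut_nonneg (δ s : ℝ) : 0 ≤ cut δ s := Real.smoothTransition.nonneg _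

theorem cut_le_one (δ s : ℝ) : cut δ s ≤ 1 := Real.smoothTransition.le_one _

theorem contDiff_cut (δ : ℝ) : ContDiff ℝ ∞ (cut δ) :=
  Real.smoothTransition.contDiff.comp (by fun_prop)

theorem continuous_cut (δ : ℝ) : Continuous (cut δ) := (contDiff_cut δ).continuous

theorem cut_of_le {δ s : ℝ} (hδ : 0 < δ) (h : s ≤ δ) : cut δ s = 0 :=
  Real.smoothTransition.zero_of_nonpos (by rw [sub_nonpos, div_le_one hδ]; exact h)

theorem cut_of_ge {δ s : ℝ} (hδ : 0 < δ) (h : 2 * δ ≤ s) : cut δ s = 1 :=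
  Real.smoothTransition.one_of_one_le (by rw [le_sub_iff_add_le, le_div_iff₀ hδ]; linarith)

theorem tendsto_cut {s : ℝ} (hs : 0 < s) : Tendsto (fun δ => cut δ s) (𝓝[>] 0) (𝓝 1) := by
  refine tendsto_const_nhds.congr' ?_
  filter_upwards [Ioo_mem_nhdsGT (show (0 : ℝ) < s / 2 by positivity)] with δ hδ
  exact (cut_of_ge hδ.1 (by linarith [hδ.2])).symm

theorem continuous_deriv_cut (δ : ℝ) : Continuous (deriv (cut δ)) :=
  (contDiff_cut δ).continuous_deriv (by simp)

theorem deriv_cut_of_lt {δ s : ℝ} (hδ : 0 < δ) (h : s < δ) : deriv (cut δ) s = 0 := by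
  have : cut δ =ᶠ[𝓝 s] fun _ => 0 := by
    filter_upwards [Iio_mem_nhds h] with x hx using cut_of_le hδ (le_of_lt hx)
  rw [this.deriv_eq, deriv_const]

theorem deriv_cut_of_gt {δ s : ℝ} (hδ : 0 < δ) (h : 2 * δ < s) : deriv (cut δ) s = 0 := by
  have : cut δ =ᶠ[𝓝 s] fun _ => 1 := by
    filter_upwards [Ioi_mem_nhds h] with x hx using cut_of_ge hδ (le_of_lt hx)
  rw [this.deriv_eq, deriv_const]

/-- `cut δ` is a rescaling of `cut 1`, so one constant serves all δ. -/
theorem exists_abs_deriv_cut_le : ∃ C, 0 ≤ C ∧ ∀ δ > 0, ∀ s, |deriv (cut δ) s| ≤ C / δ := by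
  have hc : HasCompactSupport (deriv (cut 1)) :=
    HasCompactSupport.intro (isCompact_Icc (a := (1 : ℝ)) (b := 2)) fun s hs => by
      rcases lt_or_ge s 1 with h | h
      · exact deriv_cut_of_lt one_pos h
      · exact deriv_cut_of_gt one_pos (by
          rw [mul_one]; by_contra hcon; exact hs ⟨h, not_lt.1 hcon⟩)
  obtain ⟨C, hC⟩ := (continuous_deriv_cut 1).bounded_above_of_compact_support hc
  refine ⟨C, (norm_nonneg _).trans (hC 0), fun δ hδ s => ?_⟩
  have e : cut δ = fun s => cut 1 (s / δ) := by ext s; simp [cut]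
  have hd : HasDerivAt (cut δ) (deriv (cut 1) (s / δ) * (1 / δ)) s := by
    rw [e]
    exact HasDerivAt.comp (h₂ := cut 1) (h := fun s : ℝ => s / δ) s (((contDiff_cut 1).differentiable (by simp)) (s / δ)).hasDerivAt
      ((hasDerivAt_id s).div_const δ)
  rw [hd.deriv, abs_mul, abs_of_pos (by positivity : 0 < 1 / δ), mul_one_div]
  exact div_le_div_of_nonneg_right (hC _) hδ.le

/-- The spatial scalar product `∇_X U · ∇_X V`. -/
def spatialDot (U V : Pt n → ℝ) (p : Pt n) : ℝ :=
  ∑ i, lineDeriv ℝ U p (dirX i) * lineDeriv ℝ V p (dirX i) +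
    lineDeriv ℝ U p (dirY n) * lineDeriv ℝ V p (dirY n)

/-- The integrand of the weak formulation against the Gaussian measure. -/
def weakIntegrand (F U g V : Pt n → ℝ) (p : Pt n) : ℝ :=
  -2 * p.2.2 * spatialDot U V p - (euler U g p - 2 * p.2.2 * F p) * V p

/-- Bounded functions with bounded support on a half-strip and weighted bounds on their spatial
gradient. -/
structure Profile (a r : ℝ) (V : Pt n → ℝ) (M : ℝ) : Prop where
  nonneg : 0 ≤ M
  continuousOn : ContinuousOn V (lowerStrip n r)
  differentiable_x : ∀ p ∈ lowerStrip n r, ∀ i : Fin n, LineDifferentiableAt ℝ V p (dirX i)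
  differentiable_y : ∀ p ∈ lowerStrip n r, LineDifferentiableAt ℝ V p (dirY n)
  continuousOn_dx : ∀ i : Fin n, ContinuousOn (fun p => lineDeriv ℝ V p (dirX i)) (lowerStrip n r)
  continuousOn_dy : ContinuousOn (fun p => lineDeriv ℝ V p (dirY n)) (lowerStrip n r)
  abs_le : ∀ p ∈ lowerStrip n r, |V p| ≤ M
  abs_dx_le : ∀ p ∈ lowerStrip n r, ∀ i : Fin n, |lineDeriv ℝ V p (dirX i)| ≤ M
  abs_dy_le : ∀ p ∈ lowerStrip n r, |weightedDy a V p| ≤ M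
  support_le : ∀ p ∈ lowerStrip n r, V p ≠ 0 → ‖p‖ ≤ M

section Integrability

variable {a r M K α : ℝ} {F U g V W : Pt n → ℝ}

theorem abs_spatialDot_le {M N : ℝ} (hV : Profile a r V M) (hW : Profile a r W N) {p : Pt n}
    (hp : p ∈ lowerStrip n r) : |spatialDot V W p| ≤ n * (M * N) + M * N * p.2.1 ^ (-2 * a) := by
  refine (abs_add_le _ _).trans (add_le_add ?_ ?_)
  · refine (Finset.abs_sum_le_sum_abs _ _).trans ?_
    calc _ ≤ ∑ _i : Fin n, M * N := Finset.sum_le_sum fun i _ => by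
          rw [abs_mul]
          exact mul_le_mul (hV.abs_dx_le p hp i) (hW.abs_dx_le p hp i) (abs_nonneg _) hV.nonneg
      _ = _ := by simp
  · rw [lineDeriv_dirY_eq hp.1 (a := a), lineDeriv_dirY_eq hp.1 (a := a)]
    have e : p.2.1 ^ (-a) * weightedDy a V p * (p.2.1 ^ (-a) * weightedDy a W p) =
        weightedDy a V p * weightedDy a W p * p.2.1 ^ (-2 * a) := by
      rw [show -2 * a = -a + -a by ring, Real.rpow_add hp.1]; ring
    rw [e, abs_mul, abs_mul, abs_of_nonneg (Real.rpow_nonneg hp.1.le _)]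
    exact mul_le_mul_of_nonneg_right (mul_le_mul (hV.abs_dy_le p hp) (hW.abs_dy_le p hp)
      (abs_nonneg _) hV.nonneg) (Real.rpow_nonneg hp.1.le _)

theorem Profile.continuousOn_spatialDot {N : ℝ} (hV : Profile a r V M) (hW : Profile a r W N) :
    ContinuousOn (spatialDot V W) (lowerStrip n r) :=
  (continuousOn_finsetSum _ fun i _ => (hV.continuousOn_dx i).mul (hW.continuousOn_dx i)).add
    (hV.continuousOn_dy.mul hW.continuousOn_dy)

theorem aestronglyMeasurable_of_continuousOn {f : Pt n → ℝ} (hf : ContinuousOn f (lowerStrip n r)) :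
    AEStronglyMeasurable f (gaussMeasure n a r) :=
  aestronglyMeasurable_gaussMeasure (hf.aestronglyMeasurable (measurableSet_lowerStrip n r))

theorem abs_time_le_one (hr : r ∈ Ioo (0 : ℝ) 1) {p : Pt n} (hp : p ∈ lowerStrip n r) :
    |p.2.2| ≤ 1 := by
  have h1 := hp.2.1
  have h2 := hp.2.2
  have := hr.1; have := hr.2
  rw [abs_le]; constructor <;> nlinarith

/-- The y-derivatives contribute at most a multiple of y^{-2a}, which against the weight y^a leaves
y^{-a}, integrable at 0 because a < 1. -/
theorem Profile.integrable_spatialDot {N : ℝ} (ha : a ∈ Ioo (-1 : ℝ) 1) (hr : r ∈ Ioo (0 : ℝ) 1)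
    (hV : Profile a r V M) (hW : Profile a r W N) :
    Integrable (fun p => -2 * p.2.2 * spatialDot V W p) (gaussMeasure n a r) := by
  have hfin := isFiniteMeasure_gaussMeasure (n := n) ha.1
  have h1 : Integrable (fun p : Pt n => p.2.1 ^ (-2 * a)) (gaussMeasure n a 1) := by
    simpa using integrable_moment (n := n) (b := -2 * a) ha.1 (by linarith [ha.2])
      (by linarith [ha.2]) 0
  have hbd : Integrable (fun p : Pt n => 2 * (n * (M * N) + M * N * p.2.1 ^ (-2 * a)))
      (gaussMeasure n a r) :=
    (((integrable_const _).add (h1.const_mul _)).const_mul 2).mono_measure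
      (gaussMeasure_mono hr.1.le hr.2.le)
  refine hbd.mono' (aestronglyMeasurable_of_continuousOn ?_) ?_
  · exact ContinuousOn.mul (by fun_prop) (hV.continuousOn_spatialDot hW)
  · filter_upwards [ae_mem_lowerStrip a r] with p hp
    have ht := abs_time_le_one hr hp
    rw [norm_mul, norm_mul, Real.norm_eq_abs, Real.norm_eq_abs, Real.norm_eq_abs, abs_neg, abs_two]
    have := abs_spatialDot_le hV hW hp
    have h0 := abs_nonneg (spatialDot V W p)
    nlinarith

theorem openStrip_of_lowerStrip (hr : r ∈ Ioo (0 : ℝ) 1) : lowerStrip n r ⊆ openStrip n := by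
  rw [openStrip_eq_lowerStrip]; exact lowerStrip_subset hr.1.le hr.2.le

theorem Regular.profile (h : Regular a U g K α) (hn : 1 ≤ n) (hr : r ∈ Ioo (0 : ℝ) 1) :
    ∃ M, Profile a r U M := by
  obtain ⟨M, hM0, hM⟩ := h.exists_abs_le hn
  have hsub := openStrip_of_lowerStrip (n := n) hr
  have hsub' := hsub.trans (openStrip_subset_strip n)
  refine ⟨max M K, ⟨le_max_of_le_left hM0, h.continuousOn_openStrip.mono hsub,
    fun p hp => h.differentiable_x p (hsub' hp), fun p hp => h.differentiable_y p (hsub' hp),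
    fun i => (h.continuousOn_dx' i).mono hsub, h.continuousOn_dy'.mono hsub,
    fun p hp => (hM p (hsub' hp)).trans (le_max_left _ _),
    fun p hp i => (h.abs_dx_le p (hsub' hp) i).trans (le_max_right _ _),
    fun p hp => (h.abs_dy_le p (hsub' hp)).trans (le_max_right _ _),
    fun p hp hne => (h.support_le p (hsub' hp) hne).trans (le_max_right _ _)⟩⟩

theorem ae_restrict_lowerStrip (hr : r ∈ Ioo (0 : ℝ) 1) {P : Pt n → Prop}
    (hP : ∀ᵐ p ∂(volume.restrict (openStrip n)), P p) :
    ∀ᵐ p ∂gaussMeasure n a r, P p :=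
  ae_gaussMeasure_of_ae (ae_mono (Measure.restrict_mono (openStrip_of_lowerStrip hr) le_rfl) hP)

theorem aestronglyMeasurable_of_openStrip (hr : r ∈ Ioo (0 : ℝ) 1) {f : Pt n → ℝ}
    (hf : AEStronglyMeasurable f (volume.restrict (openStrip n))) :
    AEStronglyMeasurable f (gaussMeasure n a r) :=
  aestronglyMeasurable_gaussMeasure
    (hf.mono_measure (Measure.restrict_mono (openStrip_of_lowerStrip hr) le_rfl))

theorem Regular.integrable_euler_mul (h : Regular a U g K α) (ha : a ∈ Ioo (-1 : ℝ) 1)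
    (hr : r ∈ Ioo (0 : ℝ) 1) (hF : MemLp F ⊤ (volume.restrict (strip n 1)))
    (hV : Profile a r V M) :
    Integrable (fun p => (euler U g p - 2 * p.2.2 * F p) * V p) (gaussMeasure n a r) := by
  rw [restrict_strip_one] at hF
  obtain ⟨L, hL0, hL⟩ := ae_abs_le_of_memLp_top hF
  have hbd : Integrable (fun p : Pt n => (K * (n + 3) + 2 * L) * M * growth p)
      (gaussMeasure n a r) := by
    have := integrable_growth_pow (n := n) ha.1 1
    simp only [pow_one] at this
    exact (this.const_mul _).mono_measure (gaussMeasure_mono hr.1.le hr.2.le)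
  refine hbd.mono' ?_ ?_
  · refine AEStronglyMeasurable.mul (AEStronglyMeasurable.sub ?_ ?_)
      (aestronglyMeasurable_of_continuousOn hV.continuousOn)
    · exact aestronglyMeasurable_of_openStrip hr h.aestronglyMeasurable_euler
    · exact (Measurable.aestronglyMeasurable (by fun_prop)).mul
        (aestronglyMeasurable_of_openStrip hr hF.1)
  · filter_upwards [ae_mem_lowerStrip a r, ae_restrict_lowerStrip hr hL,
      ae_restrict_lowerStrip hr h.ae_abs_dt_le] with p hp hFp hgp
    have h1 := h.abs_euler_le ha (openStrip_of_lowerStrip hr hp) hgp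
    have h2 : |2 * p.2.2 * F p| ≤ 2 * L * growth p := by
      rw [abs_mul, abs_mul, abs_two]
      have ht := abs_time_le_one hr hp
      have := one_le_growth p
      have h0 := abs_nonneg (F p)
      calc 2 * |p.2.2| * |F p| ≤ 2 * 1 * L := by gcongr
        _ ≤ 2 * L * growth p := by nlinarith
    rw [norm_mul, Real.norm_eq_abs, Real.norm_eq_abs]
    have h3 := abs_sub (euler U g p) (2 * p.2.2 * F p)
    calc |euler U g p - 2 * p.2.2 * F p| * |V p| ≤
          (K * (n + 3) * growth p + 2 * L * growth p) * M :=
        mul_le_mul (by linarith) (hV.abs_le p hp) (abs_nonneg _) (by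
          have := h.nonneg; have := one_le_growth p; positivity)
      _ = _ := by ring

theorem Regular.integrable_weakIntegrand (h : Regular a U g K α) (ha : a ∈ Ioo (-1 : ℝ) 1)
    (hn : 1 ≤ n) (hr : r ∈ Ioo (0 : ℝ) 1) (hF : MemLp F ⊤ (volume.restrict (strip n 1)))
    (hV : Profile a r V M) : Integrable (weakIntegrand F U g V) (gaussMeasure n a r) := by
  obtain ⟨N, hN⟩ := h.profile hn hr
  exact (hN.integrable_spatialDot ha hr hV).sub (h.integrable_euler_mul ha hr hF hV)

end Integrability

end ThinObstacle

end

/-! ### Testing the equation with a cut-off Gaussian multiple of V. -/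

noncomputable section

namespace ThinObstacle

variable {n : ℕ} {a r M K α : ℝ} {F U g V : Pt n → ℝ}

theorem hasLineDerivAt_gaussianKernel_x (a : ℝ) (p : Pt n) (i : Fin n) :
    HasLineDerivAt ℝ (gaussianKernel a) (gaussianKernel a p * (-(p.1 i) / (2 * |p.2.2|))) p
      (dirX i) := by
  have h1 : HasDerivAt (fun s : ℝ => p.1 + s • EuclideanSpace.single i (1 : ℝ))
      (EuclideanSpace.single i 1) 0 := by
    simpa using ((hasDerivAt_id (0 : ℝ)).smul_const (EuclideanSpace.single i (1 : ℝ))).const_add p.1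
  have h2 := h1.norm_sq
  simp only [zero_smul, add_zero, EuclideanSpace.inner_single_right, one_mul] at h2
  have h3 := (((h2.add_const (p.2.1 ^ 2)).neg.div_const (4 * |p.2.2|)).exp.const_mul
    (gaussConst n a * |p.2.2| ^ (-((n : ℝ) + a + 1) / 2)))
  rw [HasLineDerivAt]
  refine (h3.congr_deriv ?_).congr_of_eventuallyEq (Eventually.of_forall fun s => ?_)
  · simp only [zero_smul, add_zero, gaussianKernel_eq, spaceNorm_sq, conj_trivial, Pi.neg_apply]
    ring
  · simp only [add_smul_dirX, gaussianKernel_eq, spaceNorm_sq, Pi.neg_apply]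

theorem hasLineDerivAt_gaussianKernel_y (a : ℝ) (p : Pt n) :
    HasLineDerivAt ℝ (gaussianKernel a) (gaussianKernel a p * (-p.2.1 / (2 * |p.2.2|))) p
      (dirY n) := by
  have h1 : HasDerivAt (fun s : ℝ => p.2.1 + s) 1 0 := (hasDerivAt_id (0 : ℝ)).const_add p.2.1
  have h2 := h1.pow 2
  have h3 := (((h2.const_add (‖p.1‖ ^ 2)).neg.div_const (4 * |p.2.2|)).exp.const_mul
    (gaussConst n a * |p.2.2| ^ (-((n : ℝ) + a + 1) / 2)))
  rw [HasLineDerivAt]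
  refine (h3.congr_deriv ?_).congr_of_eventuallyEq (Eventually.of_forall fun s => ?_)
  · simp only [add_zero, gaussianKernel_eq, spaceNorm_sq, Pi.neg_apply, Pi.pow_apply]
    push_cast
    ring
  · simp only [add_smul_dirY, gaussianKernel_eq, spaceNorm_sq, Pi.neg_apply, Pi.pow_apply]

theorem continuousOn_gaussianKernel (a r : ℝ) :
    ContinuousOn (gaussianKernel a : Pt n → ℝ) (lowerStrip n r) := by
  have h0 : ∀ p ∈ lowerStrip n r, |p.2.2| ≠ 0 := fun p hp => (abs_pos.2 hp.2.2.ne).ne'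
  unfold gaussianKernel spaceNorm
  refine ContinuousOn.mul (continuousOn_const.mul (ContinuousOn.rpow_const (by fun_prop)
    fun p hp => Or.inl (h0 p hp))) (ContinuousOn.rexp (ContinuousOn.div (by fun_prop) (by fun_prop)
    fun p hp => mul_ne_zero four_ne_zero (h0 p hp)))

theorem continuous_of_continuousOn_of_zero {f : Pt n → ℝ} {Ω Z : Set (Pt n)} (hΩ : IsOpen Ω)
    (hZ : IsClosed Z) (hZΩ : Z ⊆ Ω) (hf : ContinuousOn f Ω) (h0 : ∀ p, p ∉ Z → f p = 0) :
    Continuous f := by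
  rw [continuous_iff_continuousAt]
  intro p
  by_cases hp : p ∈ Z
  · exact hf.continuousAt (hΩ.mem_nhds (hZΩ hp))
  · exact continuousAt_const.congr (Filter.eventuallyEq_of_mem (hZ.isOpen_compl.mem_nhds hp)
      fun q hq => (h0 q hq).symm)

/-- The time cutoff, supported in `-r² + δ ≤ t ≤ -δ`. -/
def timeCut (r δ t : ℝ) : ℝ := cut δ (-t) * cut δ (t + r ^ 2)

theorem timeCut_nonneg (r δ t : ℝ) : 0 ≤ timeCut r δ t :=
  mul_nonneg (cut_nonneg _ _) (cut_nonneg _ _)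

theorem timeCut_le_one (r δ t : ℝ) : timeCut r δ t ≤ 1 :=
  mul_le_one₀ (cut_le_one _ _) (cut_nonneg _ _) (cut_le_one _ _)

theorem continuous_timeCut (r δ : ℝ) : Continuous (timeCut r δ) :=
  ((continuous_cut δ).comp continuous_neg).mul
    ((continuous_cut δ).comp (continuous_add_const (r ^ 2)))

theorem timeCut_eq_zero {δ t : ℝ} (hδ : 0 < δ) (h : t < -r ^ 2 + δ ∨ -δ < t) :
    timeCut r δ t = 0 := by
  rcases h with h | h
  · rw [timeCut, cut_of_le hδ (show t + r ^ 2 ≤ δ by linarith), mul_zero]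
  · rw [timeCut, cut_of_le hδ (show -t ≤ δ by linarith), zero_mul]

/-- The region where the cutoff product is supported. -/
def cutRegion (n : ℕ) (r δ ε : ℝ) : Set (Pt n) :=
  {p | ε ≤ p.2.1 ∧ -r ^ 2 + δ ≤ p.2.2 ∧ p.2.2 ≤ -δ}

theorem isClosed_cutRegion (n : ℕ) (r δ ε : ℝ) : IsClosed (cutRegion n r δ ε) := by
  have h1 : IsClosed {p : Pt n | ε ≤ p.2.1} := isClosed_le (by fun_prop) (by fun_prop)
  have h2 : IsClosed {p : Pt n | -r ^ 2 + δ ≤ p.2.2} := isClosed_le (by fun_prop) (by fun_prop)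
  have h3 : IsClosed {p : Pt n | p.2.2 ≤ -δ} := isClosed_le (by fun_prop) (by fun_prop)
  exact h1.inter (h2.inter h3)

theorem cutRegion_subset {δ ε : ℝ} (hδ : 0 < δ) (hε : 0 < ε) :
    cutRegion n r δ ε ⊆ lowerStrip n r := fun _ hp =>
  ⟨hε.trans_le hp.1, by linarith [hp.2.1], by linarith [hp.2.2]⟩

theorem cut_mul_eq_zero {δ ε : ℝ} (hδ : 0 < δ) (hε : 0 < ε) {p : Pt n}
    (hp : p ∉ cutRegion n r δ ε) : timeCut r δ p.2.2 * cut ε p.2.1 = 0 := by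
  by_cases hy : ε ≤ p.2.1
  · rw [timeCut_eq_zero hδ, zero_mul]
    by_contra hcon
    push Not at hcon
    exact hp ⟨hy, hcon.1, hcon.2⟩
  · rw [cut_of_le hε (not_le.1 hy).le, mul_zero]

/-- The function used to test the equation. -/
def cutTest (a r δ ε : ℝ) (V : Pt n → ℝ) (p : Pt n) : ℝ :=
  timeCut r δ p.2.2 * cut ε p.2.1 * (V p * (-p.2.2 * gaussianKernel a p))

theorem cutTest_eq_zero {δ ε : ℝ} (hδ : 0 < δ) (hε : 0 < ε) {p : Pt n}
    (hp : p ∉ cutRegion n r δ ε) : cutTest a r δ ε V p = 0 := by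
  rw [cutTest, cut_mul_eq_zero hδ hε hp, zero_mul]

/-- The gradient of the Gaussian is -X/(2|t|) times the Gaussian; the factor -t = |t| in `cutTest`
cancels the denominator and leaves the -V X/2 that builds the Euler field. -/
theorem cutTest_hasLineDerivAt_x (hV : Profile a r V M) {δ ε : ℝ} {p : Pt n}
    (hp : p ∈ lowerStrip n r) (i : Fin n) :
    HasLineDerivAt ℝ (cutTest a r δ ε V) (timeCut r δ p.2.2 * cut ε p.2.1 *
      (gaussianKernel a p * (-p.2.2 * lineDeriv ℝ V p (dirX i) - V p * p.1 i / 2))) p (dirX i) := by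
  have h1 := (hV.differentiable_x p hp i).hasLineDerivAt
  have h2 := hasLineDerivAt_gaussianKernel_x a p i
  rw [HasLineDerivAt] at *
  have h3 := (h1.mul (h2.const_mul (-p.2.2))).const_mul (timeCut r δ p.2.2 * cut ε p.2.1)
  refine (h3.congr_deriv ?_).congr_of_eventuallyEq (Eventually.of_forall fun s => ?_)
  · have := hp.2.2
    rw [abs_of_neg this]
    simp only [zero_smul, add_zero]
    have := this.ne
    field_simp
    ring
  · simp only [cutTest, Pi.mul_apply]
    rw [add_smul_dirX]

theorem cutTest_hasLineDerivAt_y (hV : Profile a r V M) {δ ε : ℝ} {p : Pt n}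
    (hp : p ∈ lowerStrip n r) :
    HasLineDerivAt ℝ (cutTest a r δ ε V) (timeCut r δ p.2.2 * cut ε p.2.1 *
      (gaussianKernel a p * (-p.2.2 * lineDeriv ℝ V p (dirY n) - V p * p.2.1 / 2)) +
      timeCut r δ p.2.2 * deriv (cut ε) p.2.1 * (V p * (-p.2.2 * gaussianKernel a p))) p
        (dirY n) := by
  have h1 := (hV.differentiable_y p hp).hasLineDerivAt
  have h2 := hasLineDerivAt_gaussianKernel_y a p
  have h0 : HasDerivAt (fun s : ℝ => cut ε (p.2.1 + s)) (deriv (cut ε) p.2.1) 0 := by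
    have hc := (((contDiff_cut ε).differentiable (by simp)) (p.2.1 + 0)).hasDerivAt
    have := HasDerivAt.comp (h := fun s : ℝ => p.2.1 + s) 0 hc
      ((hasDerivAt_id (0 : ℝ)).const_add p.2.1)
    rw [mul_one, add_zero] at this
    exact this
  rw [HasLineDerivAt] at *
  have h3 := (h0.const_mul (timeCut r δ p.2.2)).mul (h1.mul (h2.const_mul (-p.2.2)))
  refine (h3.congr_deriv ?_).congr_of_eventuallyEq (Eventually.of_forall fun s => ?_)
  · have := hp.2.2
    rw [abs_of_neg this]
    simp only [zero_smul, add_zero, Pi.mul_apply]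
    have := this.ne
    field_simp
    ring
  · simp only [cutTest, Pi.mul_apply]
    rw [add_smul_dirY]

theorem cutTest_tsupport {δ ε : ℝ} (hV : Profile a r V M) (hδ : 0 < δ) (hε : 0 < ε) :
    tsupport (cutTest a r δ ε V) ⊆ Metric.closedBall 0 M ∩ cutRegion n r δ ε := by
  refine closure_minimal (fun p hp => ?_)
    (Metric.isClosed_closedBall.inter (isClosed_cutRegion n r δ ε))
  have hpZ : p ∈ cutRegion n r δ ε := by
    by_contra hcon; exact hp (cutTest_eq_zero hδ hε hcon)
  refine ⟨?_, hpZ⟩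
  rw [mem_closedBall_zero_iff]
  refine hV.support_le p (cutRegion_subset hδ hε hpZ) fun h0 => hp ?_
  rw [cutTest, h0, zero_mul, mul_zero]

theorem isCompact_cutSupport (δ ε : ℝ) :
    IsCompact (Metric.closedBall (0 : Pt n) M ∩ cutRegion n r δ ε) :=
  (isCompact_closedBall 0 M).inter_right (isClosed_cutRegion n r δ ε)

theorem continuous_boundaryTerm {δ ε : ℝ} (hV : Profile a r V M) (hδ : 0 < δ) (hε : 0 < ε) :
    Continuous fun p : Pt n => timeCut r δ p.2.2 * deriv (cut ε) p.2.1 *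
      (V p * (-p.2.2 * gaussianKernel a p)) := by
  have hG := continuousOn_gaussianKernel (n := n) a r
  have hc1 := (continuous_timeCut r δ).comp (continuous_snd.comp (continuous_snd (X := EuclideanSpace ℝ (Fin n)) (Y := ℝ × ℝ)))
  have hc2 := (continuous_deriv_cut ε).comp (continuous_fst.comp (continuous_snd (X := EuclideanSpace ℝ (Fin n)) (Y := ℝ × ℝ)))
  refine continuous_of_continuousOn_of_zero (isOpen_lowerStrip n r) (isClosed_cutRegion n r δ ε)
    (cutRegion_subset hδ hε) ?_ fun p hp => ?_
  · exact (hc1.mul hc2).continuousOn.mul (hV.continuousOn.mul (ContinuousOn.mul (by fun_prop) hG))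
  · by_cases hy : ε ≤ p.2.1
    · rw [timeCut_eq_zero hδ, zero_mul, zero_mul]
      by_contra hcon
      push Not at hcon
      exact hp ⟨hy, hcon.1, hcon.2⟩
    · rw [deriv_cut_of_lt hε (not_le.1 hy), mul_zero, zero_mul]

/-- Everything vanishes off a closed region inside the open strip, so continuity on that strip is
continuity everywhere. V is controlled only in the spatial directions, hence the class
`SpatialTest`. -/
theorem spatialTest_cutTest {δ ε : ℝ} (hr : r ∈ Ioo (0 : ℝ) 1) (hV : Profile a r V M)
    (hδ : 0 < δ) (hε : 0 < ε) : SpatialTest (cutTest a r δ ε V) := by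
  have hZ := isClosed_cutRegion n r δ ε
  have hZΩ := cutRegion_subset (n := n) (r := r) hδ hε
  have hΩ := isOpen_lowerStrip n r
  have hsup := cutTest_tsupport (V := V) hV hδ hε
  have hG := continuousOn_gaussianKernel (n := n) a r
  have hcut : Continuous fun p : Pt n => timeCut r δ p.2.2 * cut ε p.2.1 :=
    ((continuous_timeCut r δ).comp (by fun_prop)).mul ((continuous_cut ε).comp (by fun_prop))
  have hz : ∀ v p, p ∉ cutRegion n r δ ε → lineDeriv ℝ (cutTest a r δ ε V) p v = 0 :=
    fun v p hp => lineDeriv_eq_zero_of_notMem_tsupport fun hx => hp (hsup hx).2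
  have hdz : ∀ v p, p ∉ cutRegion n r δ ε → LineDifferentiableAt ℝ (cutTest a r δ ε V) p v :=
    fun v p hp => by
      have h0 : cutTest a r δ ε V =ᶠ[𝓝 p] fun _ => 0 :=
        notMem_tsupport_iff_eventuallyEq.1 fun hx => hp (hsup hx).2
      exact ((differentiableAt_const (0 : ℝ)).congr_of_eventuallyEq h0).lineDifferentiableAt
  refine ⟨?_, ?_, ?_, fun p i => ?_, fun p => ?_, fun i => ?_, ?_⟩
  · refine continuous_of_continuousOn_of_zero hΩ hZ hZΩ ?_ fun p hp => cutTest_eq_zero hδ hε hp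
    exact hcut.continuousOn.mul (hV.continuousOn.mul (ContinuousOn.mul (by fun_prop) hG))
  · exact HasCompactSupport.intro (isCompact_cutSupport δ ε) fun p hp =>
      image_eq_zero_of_notMem_tsupport fun hx => hp (hsup hx)
  · exact fun p hp => openStrip_of_lowerStrip hr (hZΩ (hsup hp).2)
  · by_cases hp : p ∈ cutRegion n r δ ε
    · exact (cutTest_hasLineDerivAt_x hV (hZΩ hp) i).lineDifferentiableAt
    · exact hdz _ p hp
  · by_cases hp : p ∈ cutRegion n r δ ε
    · exact (cutTest_hasLineDerivAt_y hV (hZΩ hp)).lineDifferentiableAt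
    · exact hdz _ p hp
  · refine continuous_of_continuousOn_of_zero hΩ hZ hZΩ ?_ (hz (dirX i))
    have : ContinuousOn (fun p : Pt n => timeCut r δ p.2.2 * cut ε p.2.1 *
      (gaussianKernel a p * (-p.2.2 * lineDeriv ℝ V p (dirX i) - V p * p.1 i / 2)))
        (lowerStrip n r) := by
      refine hcut.continuousOn.mul (hG.mul (ContinuousOn.sub ?_ ?_))
      · exact ContinuousOn.mul (by fun_prop) (hV.continuousOn_dx i)
      · exact (hV.continuousOn.mul (by fun_prop)).div_const 2
    exact this.congr fun p hp => (cutTest_hasLineDerivAt_x hV hp i).lineDeriv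
  · refine continuous_of_continuousOn_of_zero hΩ hZ hZΩ ?_ (hz (dirY n))
    have : ContinuousOn (fun p : Pt n => timeCut r δ p.2.2 * cut ε p.2.1 *
      (gaussianKernel a p * (-p.2.2 * lineDeriv ℝ V p (dirY n) - V p * p.2.1 / 2)) +
      timeCut r δ p.2.2 * deriv (cut ε) p.2.1 * (V p * (-p.2.2 * gaussianKernel a p)))
        (lowerStrip n r) := by
      refine ContinuousOn.add (hcut.continuousOn.mul (hG.mul (ContinuousOn.sub ?_ ?_)))
        (continuous_boundaryTerm hV hδ hε).continuousOn
      · exact ContinuousOn.mul (by fun_prop) hV.continuousOn_dy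
      · exact (hV.continuousOn.mul (by fun_prop)).div_const 2
    exact this.congr fun p hp => (cutTest_hasLineDerivAt_y hV hp).lineDeriv

/-- The weak formulation with cutoffs: the bulk term equals a boundary layer term. -/
theorem Regular.cut_identity (h : Regular a U g K α) (ha : a ∈ Ioo (-1 : ℝ) 1) (hn : 1 ≤ n)
    (hr : r ∈ Ioo (0 : ℝ) 1) (heq : SolvesEquation a F U)
    (hF : MemLp F ⊤ (volume.restrict (strip n 1))) (hV : Profile a r V M) {δ ε : ℝ}
    (hδ : 0 < δ) (hε : 0 < ε) :
    ∫ p, timeCut r δ p.2.2 * cut ε p.2.1 * weakIntegrand F U g V p ∂gaussMeasure n a r =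
      -2 * ∫ p in lowerStrip n r, weightedDy a U p *
        (timeCut r δ p.2.2 * deriv (cut ε) p.2.1 * (V p * (-p.2.2 * gaussianKernel a p))) := by
  have hφ := spatialTest_cutTest hr hV hδ hε
  have hsup := cutTest_tsupport (V := V) hV hδ hε
  have hid := h.equation_spatialTest heq hF hφ
  have hsub := openStrip_of_lowerStrip (n := n) hr
  have hcpt := isCompact_cutSupport (n := n) (M := M) (r := r) δ ε
  have hSO : Metric.closedBall (0 : Pt n) M ∩ cutRegion n r δ ε ⊆ lowerStrip n r :=
    fun p hp => cutRegion_subset hδ hε hp.2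
  have hz : ∀ v p, p ∉ Metric.closedBall (0 : Pt n) M ∩ cutRegion n r δ ε →
      lineDeriv ℝ (cutTest a r δ ε V) p v = 0 :=
    fun v p hp => lineDeriv_eq_zero_of_notMem_tsupport fun hx => hp (hsup hx)
  have hz0 : ∀ p, p ∉ Metric.closedBall (0 : Pt n) M ∩ cutRegion n r δ ε →
      cutTest a r δ ε V p = 0 :=
    fun p hp => image_eq_zero_of_notMem_tsupport fun hx => hp (hsup hx)
  have hsw : ∀ {A D : Pt n → ℝ}, (∀ p, p ∉ Metric.closedBall (0 : Pt n) M ∩ cutRegion n r δ ε →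
      D p = 0) → ∫ p in openStrip n, A p * D p = ∫ p in lowerStrip n r, A p * D p := fun hD =>
    setIntegral_eq_of_subset_of_forall_sdiff_eq_zero (isOpen_openStrip n).measurableSet hsub
      fun p hp => by rw [hD p fun hx => hp.2 (hSO hx), mul_zero]
  have hI : ∀ {A D : Pt n → ℝ}, LocallyIntegrableOn A (openStrip n) → Continuous D →
      (∀ p, p ∉ Metric.closedBall (0 : Pt n) M ∩ cutRegion n r δ ε → D p = 0) →
      Integrable (fun p => A p * D p) (volume.restrict (lowerStrip n r)) := fun hA hD hD0 =>
    (integrableOn_mul_of_subset hA hD hcpt (hSO.trans hsub) hD0).mono_measure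
      (Measure.restrict_mono hsub le_rfl)
  have hBl : LocallyIntegrableOn (fun p => p.2.1 ^ a * (F p - g p)) (openStrip n) :=
    locallyIntegrableOn_rpow_mul ((locallyIntegrableOn_of_memLp_top hF).sub h.weakDeriv.2.1)
  have ix := fun i => hI (h.locallyIntegrableOn_dx i) (hφ.continuous_dx i) (hz _)
  have iy := hI h.locallyIntegrableOn_dy hφ.continuous_dy (hz _)
  have i0 := hI hBl hφ.continuous hz0
  simp only [hsw (hz _), hsw hz0] at hid
  rw [← integral_finsetSum _ fun i _ => ix i, ← integral_add (integrable_finsetSum _ fun i _ => ix i)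
    iy, ← sub_eq_zero] at hid
  have hsubI := integral_sub ((integrable_finsetSum Finset.univ fun i _ => ix i).add iy) i0
  simp only [Pi.add_apply] at hsubI
  rw [← hsubI] at hid
  have hJ : Integrable (fun p => timeCut r δ p.2.2 * cut ε p.2.1 * weakIntegrand F U g V p)
      (gaussMeasure n a r) := by
    refine (h.integrable_weakIntegrand ha hn hr hF hV).bdd_mul (c := 1) ?_ ?_
    · exact (((continuous_timeCut r δ).comp (by fun_prop)).mul
        ((continuous_cut ε).comp (by fun_prop))).aestronglyMeasurable
    · refine Eventually.of_forall fun p => ?_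
      rw [Real.norm_of_nonneg (mul_nonneg (timeCut_nonneg _ _ _) (cut_nonneg _ _))]
      exact mul_le_one₀ (timeCut_le_one _ _ _) (cut_nonneg _ _) (cut_le_one _ _)
  -- The gradient of the Gaussian gives -½ V X·∇U and the time derivative gives -t g V; together
  -- they are -½ V times the Euler field. The derivative of the y-cutoff is the only remainder.
  have hpt : ∀ p ∈ lowerStrip n r,
      ((∑ i, p.2.1 ^ a * lineDeriv ℝ U p (dirX i) * lineDeriv ℝ (cutTest a r δ ε V) p (dirX i)) +
        weightedDy a U p * lineDeriv ℝ (cutTest a r δ ε V) p (dirY n)) -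
        p.2.1 ^ a * (F p - g p) * cutTest a r δ ε V p =
      1 / 2 * ((timeCut r δ p.2.2 * cut ε p.2.1 * weakIntegrand F U g V p) * gaussWeight a p) +
      weightedDy a U p * (timeCut r δ p.2.2 * deriv (cut ε) p.2.1 *
        (V p * (-p.2.2 * gaussianKernel a p))) := by
    intro p hp
    rw [(cutTest_hasLineDerivAt_y hV hp).lineDeriv]
    simp only [fun i => (cutTest_hasLineDerivAt_x (δ := δ) (ε := ε) hV hp i).lineDeriv]
    have e1 : ∑ i, p.2.1 ^ a * lineDeriv ℝ U p (dirX i) * (timeCut r δ p.2.2 * cut ε p.2.1 *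
        (gaussianKernel a p * (-p.2.2 * lineDeriv ℝ V p (dirX i) - V p * p.1 i / 2))) =
        timeCut r δ p.2.2 * cut ε p.2.1 * gaussWeight a p *
        (-p.2.2 * ∑ i, lineDeriv ℝ U p (dirX i) * lineDeriv ℝ V p (dirX i) -
          V p / 2 * ∑ i, p.1 i * lineDeriv ℝ U p (dirX i)) := by
      rw [Finset.mul_sum, Finset.mul_sum, ← Finset.sum_sub_distrib, Finset.mul_sum]
      refine Finset.sum_congr rfl fun i _ => ?_
      rw [gaussWeight]; ring
    rw [e1, weakIntegrand, spatialDot, euler, weightedDy, cutTest, gaussWeight]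
    ring
  rw [setIntegral_congr_fun (measurableSet_lowerStrip n r) hpt] at hid
  have hJ' := (integrable_gaussMeasure_iff ha.1).1 hJ
  have hb : Integrable (fun p => weightedDy a U p * (timeCut r δ p.2.2 * deriv (cut ε) p.2.1 *
        (V p * (-p.2.2 * gaussianKernel a p)))) (volume.restrict (lowerStrip n r)) := by
    have e : ∀ p ∈ lowerStrip n r, weightedDy a U p * (timeCut r δ p.2.2 * deriv (cut ε) p.2.1 *
        (V p * (-p.2.2 * gaussianKernel a p))) = (((∑ i, p.2.1 ^ a * lineDeriv ℝ U p (dirX i) *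
          lineDeriv ℝ (cutTest a r δ ε V) p (dirX i)) +
        weightedDy a U p * lineDeriv ℝ (cutTest a r δ ε V) p (dirY n)) -
        p.2.1 ^ a * (F p - g p) * cutTest a r δ ε V p) -
      1 / 2 * ((timeCut r δ p.2.2 * cut ε p.2.1 * weakIntegrand F U g V p) * gaussWeight a p) :=
      fun p hp => by rw [hpt p hp]; ring
    refine IntegrableOn.congr_fun ?_ (fun p hp => (e p hp).symm) (measurableSet_lowerStrip n r)
    exact (((integrable_finsetSum _ fun i _ => ix i).add iy).sub i0).sub (hJ'.const_mul _)
  rw [integral_add (hJ'.const_mul _) hb, integral_const_mul] at hid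
  rw [integral_gaussMeasure ha.1]
  linarith

end ThinObstacle

end

/-! ### Removing the cutoffs: the boundary layer at y = 0. -/

noncomputable section

namespace ThinObstacle

variable {n : ℕ} {a r M K α : ℝ} {F U g V : Pt n → ℝ}

theorem gaussianKernel_le_of_time (ha : -1 < a) {δ : ℝ} (hδ : 0 < δ) {p : Pt n}
    (hp : p.2.2 ≤ -δ) :
    gaussianKernel a p ≤ gaussConst n a * δ ^ (-((n : ℝ) + a + 1) / 2) := by
  have ht : δ ≤ |p.2.2| := by rw [abs_of_neg (by linarith)]; linarith
  rw [gaussianKernel_eq]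
  have h1 : |p.2.2| ^ (-((n : ℝ) + a + 1) / 2) ≤ δ ^ (-((n : ℝ) + a + 1) / 2) :=
    Real.rpow_le_rpow_of_nonpos hδ ht (by have : (0 : ℝ) ≤ n := n.cast_nonneg; linarith)
  have h2 : Real.exp (-(spaceNorm p ^ 2) / (4 * |p.2.2|)) ≤ 1 :=
    Real.exp_le_one_iff.2 (div_nonpos_of_nonpos_of_nonneg (by
      have := sq_nonneg (spaceNorm p); linarith) (by positivity))
  have := gaussConst_pos n ha
  calc _ ≤ gaussConst n a * |p.2.2| ^ (-((n : ℝ) + a + 1) / 2) * 1 := by gcongr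
    _ ≤ _ := by rw [mul_one]; gcongr

/-- The layer `ε ≤ y ≤ 2 ε` of a bounded region. -/
def layer (n : ℕ) (M ε : ℝ) : Set (Pt n) :=
  Metric.closedBall 0 M ×ˢ (Icc ε (2 * ε) ×ˢ Icc (-M) M)

theorem volume_real_layer (n : ℕ) (M : ℝ) {ε : ℝ} (hε : 0 < ε) :
    (volume : Measure (Pt n)).real (layer n M ε) =
      (volume : Measure (EuclideanSpace ℝ (Fin n))).real (Metric.closedBall 0 M) *
        (ε * (volume : Measure ℝ).real (Icc (-M) M)) := by
  rw [layer, volume_eq_prod_prod, measureReal_prod_prod, measureReal_prod_prod, Real.volume_real_Icc_of_le (by linarith)]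
  ring

theorem measurableSet_layer (n : ℕ) (M ε : ℝ) : MeasurableSet (layer n M ε) :=
  Metric.isClosed_closedBall.measurableSet.prod (measurableSet_Icc.prod measurableSet_Icc)

theorem layer_volume_lt_top (n : ℕ) (M ε : ℝ) : (volume : Measure (Pt n)) (layer n M ε) < ⊤ :=
  ((isCompact_closedBall (0 : EuclideanSpace ℝ (Fin n)) M).prod
    (isCompact_Icc.prod isCompact_Icc)).measure_lt_top

theorem monotone_cut {δ : ℝ} (hδ : 0 < δ) : Monotone (cut δ) := fun s t hst =>
  Real.smoothTransition.monotone (by gcongr)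

/-- The boundary layer term of the cutoff identity is controlled by the flux near `y = 0`. -/
theorem exists_boundaryTerm_le (ha : -1 < a) (hr : r ∈ Ioo (0 : ℝ) 1) (hV : Profile a r V M)
    {c : ℝ} {β : ℝ → ℝ} (hβ : ∀ p ∈ lowerStrip n r, c * weightedDy a U p * V p ≤ β p.2.1)
    (hβ0 : ∀ y, 0 < y → 0 ≤ β y) (hmono : MonotoneOn β (Ioi 0)) {δ : ℝ} (hδ : 0 < δ) :
    ∃ B, ∀ ε > 0, c * ∫ p in lowerStrip n r, weightedDy a U p *
      (timeCut r δ p.2.2 * deriv (cut ε) p.2.1 * (V p * (-p.2.2 * gaussianKernel a p)))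
        ≤ B * β (2 * ε) := by
  obtain ⟨C, hC0, hC⟩ := exists_abs_deriv_cut_le
  set Q := gaussConst n a * δ ^ (-((n : ℝ) + a + 1) / 2) with hQ
  have hQ0 : 0 ≤ Q := mul_nonneg (gaussConst_pos n ha).le (Real.rpow_nonneg hδ.le _)
  refine ⟨C * Q * ((volume : Measure (EuclideanSpace ℝ (Fin n))).real (Metric.closedBall 0 M) *
    (volume : Measure ℝ).real (Icc (-M) M)), fun ε hε => ?_⟩
  have hβ2 := hβ0 (2 * ε) (by positivity)
  have hk : 0 ≤ β (2 * ε) * (C / ε * Q) := by positivity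
  have hpt : ∀ p ∈ lowerStrip n r, c * (weightedDy a U p * (timeCut r δ p.2.2 *
      deriv (cut ε) p.2.1 * (V p * (-p.2.2 * gaussianKernel a p)))) ≤
      (layer n M ε).indicator (fun _ => β (2 * ε) * (C / ε * Q)) p := by
    intro p hp
    by_cases hVp : V p = 0
    · rw [hVp]; simpa using Set.indicator_nonneg (fun _ _ => hk) p
    have hpM := hV.support_le p hp hVp
    by_cases hy : ε ≤ p.2.1 ∧ p.2.1 ≤ 2 * ε
    · have hmem : p ∈ layer n M ε := by
        refine ⟨?_, hy, ?_⟩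
        · rw [mem_closedBall_zero_iff]; exact (norm_fst_le p).trans hpM
        · have := ((norm_snd_le p.2).trans (norm_snd_le p)).trans hpM
          exact abs_le.1 this
      rw [indicator_of_mem hmem]
      by_cases ht : p.2.2 ≤ -δ
      -- The cutoff is nondecreasing, so a one-sided bound on the flux times V is enough.
      · have hd0 : 0 ≤ deriv (cut ε) p.2.1 := (monotone_cut hε).deriv_nonneg
        have hd1 : deriv (cut ε) p.2.1 ≤ C / ε := (le_abs_self _).trans (hC ε hε _)
        have hG0 := gaussianKernel_nonneg ha p
        have hG1 := gaussianKernel_le_of_time ha hδ ht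
        have ht1 := abs_time_le_one hr hp
        rw [abs_of_neg hp.2.2] at ht1
        have ht0 : 0 ≤ -p.2.2 := by linarith
        have hc0 := timeCut_nonneg r δ p.2.2
        have hc1 := timeCut_le_one r δ p.2.2
        have hβp : β p.2.1 ≤ β (2 * ε) := hmono hp.1 (by simp [hε]) hy.2
        have hβ1 := (hβ p hp).trans hβp
        have e : c * (weightedDy a U p * (timeCut r δ p.2.2 *
            deriv (cut ε) p.2.1 * (V p * (-p.2.2 * gaussianKernel a p)))) =
            (c * weightedDy a U p * V p) * (timeCut r δ p.2.2 *
              deriv (cut ε) p.2.1 * (-p.2.2 * gaussianKernel a p)) := by ring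
        rw [e]
        calc _ ≤ β (2 * ε) * (timeCut r δ p.2.2 *
              deriv (cut ε) p.2.1 * (-p.2.2 * gaussianKernel a p)) :=
              mul_le_mul_of_nonneg_right hβ1 (by positivity)
          _ ≤ β (2 * ε) * (1 * (C / ε) * (1 * Q)) := by gcongr
          _ = _ := by ring
      · rw [timeCut_eq_zero hδ (Or.inr (not_le.1 ht))]
        simpa using hk
    · have : deriv (cut ε) p.2.1 = 0 := by
        by_cases h1 : ε ≤ p.2.1
        · exact deriv_cut_of_gt hε (by by_contra h2; exact hy ⟨h1, not_lt.1 h2⟩)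
        · exact deriv_cut_of_lt hε (not_le.1 h1)
      rw [this]; simpa using Set.indicator_nonneg (fun _ _ => hk) p
  have hb : Integrable ((layer n M ε).indicator fun _ => β (2 * ε) * (C / ε * Q))
      (volume.restrict (lowerStrip n r)) :=
    ((integrable_indicator_iff (measurableSet_layer n M ε)).2
      (integrableOn_const (layer_volume_lt_top n M ε).ne)).mono_measure Measure.restrict_le_self
  have hbi : ∫ p in lowerStrip n r, (layer n M ε).indicator
      (fun _ => β (2 * ε) * (C / ε * Q)) p ≤ (volume : Measure (Pt n)).real (layer n M ε) *
        (β (2 * ε) * (C / ε * Q)) := by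
    refine (integral_mono_measure Measure.restrict_le_self (Eventually.of_forall
      (Set.indicator_nonneg fun _ _ => hk)) ((integrable_indicator_iff
        (measurableSet_layer n M ε)).2 (integrableOn_const (layer_volume_lt_top n M ε).ne))).trans ?_
    rw [integral_indicator_const _ (measurableSet_layer n M ε), smul_eq_mul]
  rw [← integral_const_mul]
  -- The layer has width ε, which cancels the 1/ε of the cutoff derivative; only β(2ε) remains.
  have hfin : (volume : Measure (Pt n)).real (layer n M ε) * (β (2 * ε) * (C / ε * Q)) =
      C * Q * ((volume : Measure (EuclideanSpace ℝ (Fin n))).real (Metric.closedBall 0 M) *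
        (volume : Measure ℝ).real (Icc (-M) M)) * β (2 * ε) := by
    rw [volume_real_layer n M hε]; field_simp
  rw [← hfin]
  refine le_trans ?_ hbi
  -- Without integrability the integral is 0 by convention, and the bound still holds since the
  -- majorant is nonnegative.
  by_cases hint : Integrable (fun p => c * (weightedDy a U p * (timeCut r δ p.2.2 *
      deriv (cut ε) p.2.1 * (V p * (-p.2.2 * gaussianKernel a p)))))
      (volume.restrict (lowerStrip n r))
  · exact setIntegral_mono_on hint hb (measurableSet_lowerStrip n r) hpt
  · rw [integral_undef hint]
    exact integral_nonneg (Set.indicator_nonneg fun _ _ => hk)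

theorem tendsto_integral_mul_cutoff {μ : Measure (Pt n)} {W : Pt n → ℝ} (hW : Integrable W μ)
    {χ : ℝ → Pt n → ℝ} (hm : ∀ ε, Continuous (χ ε)) (h0 : ∀ ε p, 0 ≤ χ ε p)
    (h1 : ∀ ε p, χ ε p ≤ 1) {f : Pt n → ℝ}
    (hlim : ∀ᵐ p ∂μ, Tendsto (fun ε => χ ε p) (𝓝[>] 0) (𝓝 (f p))) :
    Tendsto (fun ε => ∫ p, χ ε p * W p ∂μ) (𝓝[>] 0) (𝓝 (∫ p, f p * W p ∂μ)) := by
  refine tendsto_integral_filter_of_dominated_convergence (fun p => ‖W p‖)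
    (Eventually.of_forall fun ε => (hm ε).aestronglyMeasurable.mul hW.1)
    (Eventually.of_forall fun ε => Eventually.of_forall fun p => ?_) hW.norm ?_
  · rw [norm_mul, Real.norm_of_nonneg (h0 ε p)]
    exact mul_le_of_le_one_left (norm_nonneg _) (h1 ε p)
  · filter_upwards [hlim] with p hp using hp.mul_const _

/-- By `cut_identity`, c times the cut-off integral is -2c times the boundary layer term, hence at
least -2Bβ(2ε), which tends to 0. The y-cutoff is removed first, since B depends on the time cutoff
δ; δ tends to 0 afterwards by dominated convergence. -/
theorem Regular.weak_inequality (h : Regular a U g K α) (ha : a ∈ Ioo (-1 : ℝ) 1) (hn : 1 ≤ n)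
    (hr : r ∈ Ioo (0 : ℝ) 1) (heq : SolvesEquation a F U)
    (hF : MemLp F ⊤ (volume.restrict (strip n 1))) (hV : Profile a r V M)
    {c : ℝ} {β : ℝ → ℝ} (hβ : ∀ p ∈ lowerStrip n r, c * weightedDy a U p * V p ≤ β p.2.1)
    (hβ0 : ∀ y, 0 < y → 0 ≤ β y) (hmono : MonotoneOn β (Ioi 0))
    (hlim : Tendsto β (𝓝[>] 0) (𝓝 0)) :
    0 ≤ c * ∫ p, weakIntegrand F U g V p ∂gaussMeasure n a r := by
  have hW := h.integrable_weakIntegrand ha hn hr hF hV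
  have hct : ∀ δ, Continuous fun p : Pt n => timeCut r δ p.2.2 := fun δ =>
    (continuous_timeCut r δ).comp (by fun_prop)
  have hcy : ∀ ε, Continuous fun p : Pt n => cut ε p.2.1 := fun ε =>
    (continuous_cut ε).comp (by fun_prop)
  have key : ∀ δ > 0, 0 ≤ c * ∫ p, timeCut r δ p.2.2 * weakIntegrand F U g V p
      ∂gaussMeasure n a r := by
    intro δ hδ
    obtain ⟨B, hB⟩ := exists_boundaryTerm_le (U := U) ha.1 hr hV hβ hβ0 hmono hδ
    have t1 : Tendsto (fun ε => ∫ p, timeCut r δ p.2.2 * cut ε p.2.1 * weakIntegrand F U g V p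
        ∂gaussMeasure n a r) (𝓝[>] 0) (𝓝 (∫ p, timeCut r δ p.2.2 * weakIntegrand F U g V p
          ∂gaussMeasure n a r)) := by
      refine tendsto_integral_mul_cutoff hW (fun ε => (hct δ).mul (hcy ε))
        (fun ε p => mul_nonneg (timeCut_nonneg _ _ _) (cut_nonneg _ _))
        (fun ε p => mul_le_one₀ (timeCut_le_one _ _ _) (cut_nonneg _ _) (cut_le_one _ _)) ?_
      filter_upwards [ae_mem_lowerStrip a r] with p hp
      simpa using (tendsto_cut hp.1).const_mul (timeCut r δ p.2.2)
    have t2 : Tendsto (fun ε : ℝ => -2 * (B * β (2 * ε))) (𝓝[>] 0) (𝓝 0) := by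
      have : Tendsto (fun ε : ℝ => 2 * ε) (𝓝[>] 0) (𝓝[>] 0) := by
        refine tendsto_nhdsWithin_iff.2 ⟨?_, ?_⟩
        · have : Tendsto (fun ε : ℝ => 2 * ε) (𝓝 0) (𝓝 (2 * 0)) := tendsto_id.const_mul 2
          rw [mul_zero] at this; exact this.mono_left nhdsWithin_le_nhds
        · filter_upwards [self_mem_nhdsWithin] with ε hε
          have : (0 : ℝ) < ε := hε
          simp [this]
      simpa using ((hlim.comp this).const_mul B).const_mul (-2)
    refine le_of_tendsto_of_tendsto t2 (t1.const_mul c) ?_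
    filter_upwards [self_mem_nhdsWithin] with ε hε
    rw [h.cut_identity ha hn hr heq hF hV hδ hε]
    have := hB ε hε
    linarith
  have t3 : Tendsto (fun δ => ∫ p, timeCut r δ p.2.2 * weakIntegrand F U g V p
      ∂gaussMeasure n a r) (𝓝[>] 0) (𝓝 (∫ p, 1 * weakIntegrand F U g V p ∂gaussMeasure n a r)) := by
    refine tendsto_integral_mul_cutoff hW hct (fun ε p => timeCut_nonneg _ _ _)
      (fun ε p => timeCut_le_one _ _ _) ?_
    filter_upwards [ae_mem_lowerStrip a r] with p hp
    simpa [timeCut] using (tendsto_cut (show 0 < -p.2.2 by linarith [hp.2.2])).mul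
      (tendsto_cut (show 0 < p.2.2 + r ^ 2 by linarith [hp.2.1]))
  simp only [one_mul] at t3
  refine ge_of_tendsto (t3.const_mul c) ?_
  filter_upwards [self_mem_nhdsWithin] with δ hδ using key δ hδ

end ThinObstacle

end

/-! ### Rescaled solutions as test functions, and the Signorini condition. -/

noncomputable section

namespace ThinObstacle

variable {n : ℕ} {a r M K α : ℝ} {F U g V : Pt n → ℝ}

theorem dil_add_smul_dirX (lam : ℝ) (p : Pt n) (s : ℝ) (i : Fin n) :
    dil lam (p + s • dirX i) = dil lam p + (lam * s) • dirX i := by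
  rw [add_smul_dirX, add_smul_dirX]
  simp [dil, smul_add, smul_smul]

theorem dil_add_smul_dirY (lam : ℝ) (p : Pt n) (s : ℝ) :
    dil lam (p + s • dirY n) = dil lam p + (lam * s) • dirY n := by
  rw [add_smul_dirY, add_smul_dirY]
  simp [dil, mul_add]

theorem hasLineDerivAt_comp_dil {lam : ℝ} {p v : Pt n}
    (hv : ∀ s : ℝ, dil lam (p + s • v) = dil lam p + (lam * s) • v)
    (h : LineDifferentiableAt ℝ U (dil lam p) v) :
    HasLineDerivAt ℝ (fun p => U (dil lam p)) (lam * lineDeriv ℝ U (dil lam p) v) p v := by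
  have h1 : HasDerivAt (fun s : ℝ => U (dil lam p + s • v)) (lineDeriv ℝ U (dil lam p) v)
      (lam * 0) := by rw [mul_zero]; exact h.hasLineDerivAt
  have h2 := HasDerivAt.comp (h := fun s : ℝ => lam * s) 0 h1 ((hasDerivAt_id (0 : ℝ)).const_mul lam)
  rw [mul_one, mul_comm] at h2
  exact h2.congr_of_eventuallyEq (Eventually.of_forall fun s => by
    simp only [Function.comp]; rw [hv])

theorem dil_mem_openStrip_of_mul_lt {lam : ℝ} (hl : 0 < lam) (hr : r ∈ Ioo (0 : ℝ) 1)
    (hlr : lam * r < 1) {p : Pt n} (hp : p ∈ lowerStrip n r) : dil lam p ∈ openStrip n := by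
  rw [openStrip_eq_lowerStrip]
  exact lowerStrip_subset (mul_pos hl hr.1).le hlr.le ((dil_mem_lowerStrip_iff hl).2 hp)

theorem norm_le_norm_dil {lam : ℝ} (hl : 0 < lam) (p : Pt n) :
    ‖p‖ ≤ (lam⁻¹ + (lam⁻¹) ^ 2) * ‖dil lam p‖ := by
  have hl' := inv_pos.2 hl
  have e : p = dil lam⁻¹ (dil lam p) := by rw [dil_dil, inv_mul_cancel₀ hl.ne', dil_one]
  have key : ∀ q : Pt n, ‖dil lam⁻¹ q‖ ≤ (lam⁻¹ + (lam⁻¹) ^ 2) * ‖q‖ := by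
    intro q
    have h1 := norm_fst_le q
    have h2 := (norm_fst_le q.2).trans (norm_snd_le q)
    have h3 := (norm_snd_le q.2).trans (norm_snd_le q)
    have h0 := norm_nonneg q
    refine norm_prod_le_iff.2 ⟨?_, norm_prod_le_iff.2 ⟨?_, ?_⟩⟩
    · simp only [dil]
      rw [norm_smul, Real.norm_of_nonneg hl'.le]
      nlinarith [mul_nonneg (sq_nonneg lam⁻¹) h0, mul_le_mul_of_nonneg_left h1 hl'.le]
    · simp only [dil]
      rw [norm_mul, Real.norm_of_nonneg hl'.le]
      nlinarith [mul_nonneg (sq_nonneg lam⁻¹) h0, mul_le_mul_of_nonneg_left h2 hl'.le]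
    · simp only [dil]
      rw [norm_mul, Real.norm_of_nonneg (sq_nonneg lam⁻¹)]
      nlinarith [mul_nonneg hl'.le h0, mul_le_mul_of_nonneg_left h3 (sq_nonneg lam⁻¹)]
  conv_lhs => rw [e]
  exact key _

namespace Regular

theorem hasLineDerivAt_dil_x (h : Regular a U g K α) {lam : ℝ} {p : Pt n}
    (hp : dil lam p ∈ strip n 1) (i : Fin n) :
    HasLineDerivAt ℝ (fun p => U (dil lam p)) (lam * lineDeriv ℝ U (dil lam p) (dirX i)) p
      (dirX i) :=
  hasLineDerivAt_comp_dil (fun s => dil_add_smul_dirX lam p s i) (h.differentiable_x _ hp i)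

theorem hasLineDerivAt_dil_y (h : Regular a U g K α) {lam : ℝ} {p : Pt n}
    (hp : dil lam p ∈ strip n 1) :
    HasLineDerivAt ℝ (fun p => U (dil lam p)) (lam * lineDeriv ℝ U (dil lam p) (dirY n)) p
      (dirY n) :=
  hasLineDerivAt_comp_dil (fun s => dil_add_smul_dirY lam p s) (h.differentiable_y _ hp)

theorem profile_dil (h : Regular a U g K α) (hn : 1 ≤ n) {lam : ℝ} (hl : 0 < lam)
    (hr : r ∈ Ioo (0 : ℝ) 1) (hlr : lam * r < 1) : ∃ M, Profile a r (fun p => U (dil lam p)) M := by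
  obtain ⟨M, hM0, hM⟩ := h.exists_abs_le hn
  have hK := h.nonneg
  have ho : MapsTo (dil lam) (lowerStrip n r) (openStrip n) := fun p hp =>
    dil_mem_openStrip_of_mul_lt hl hr hlr hp
  have hs : ∀ p ∈ lowerStrip n r, dil lam p ∈ strip n 1 := fun p hp =>
    openStrip_subset_strip n (ho hp)
  have hc := (continuous_dil (n := n) lam).continuousOn (s := lowerStrip n r)
  have hl' := inv_pos.2 hl
  have hla := Real.rpow_nonneg hl.le (1 - a)
  have n1 : 0 ≤ lam * K := by positivity
  have n2 : 0 ≤ lam ^ (1 - a) * K := by positivity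
  have n3 : 0 ≤ (lam⁻¹ + (lam⁻¹) ^ 2) * K := by positivity
  refine ⟨M + lam * K + lam ^ (1 - a) * K + (lam⁻¹ + (lam⁻¹) ^ 2) * K, ⟨by positivity,
    h.continuousOn_openStrip.comp hc ho,
    fun p hp i => (h.hasLineDerivAt_dil_x (hs p hp) i).lineDifferentiableAt,
    fun p hp => (h.hasLineDerivAt_dil_y (hs p hp)).lineDifferentiableAt,
    fun i => ?_, ?_, fun p hp => (hM _ (hs p hp)).trans (by linarith), fun p hp i => ?_,
    fun p hp => ?_, fun p hp hne => ?_⟩⟩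
  · exact (continuousOn_const.mul ((h.continuousOn_dx' i).comp hc ho)).congr fun p hp =>
      (h.hasLineDerivAt_dil_x (hs p hp) i).lineDeriv
  · exact (continuousOn_const.mul (h.continuousOn_dy'.comp hc ho)).congr fun p hp =>
      (h.hasLineDerivAt_dil_y (hs p hp)).lineDeriv
  · rw [(h.hasLineDerivAt_dil_x (hs p hp) i).lineDeriv, abs_mul, abs_of_pos hl]
    have := mul_le_mul_of_nonneg_left (h.abs_dx_le _ (hs p hp) i) hl.le
    linarith
  · have e : weightedDy a (fun p => U (dil lam p)) p = lam ^ (1 - a) * weightedDy a U (dil lam p) := by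
      rw [weightedDy, (h.hasLineDerivAt_dil_y (hs p hp)).lineDeriv, weightedDy]
      simp only [dil]
      rw [Real.mul_rpow hl.le hp.1.le, ← mul_assoc (lam ^ (1 - a)), ← mul_assoc (lam ^ (1 - a)),
        ← Real.rpow_add hl]
      simp; ring
    rw [e, abs_mul, abs_of_nonneg hla]
    have := mul_le_mul_of_nonneg_left (h.abs_dy_le _ (hs p hp)) hla
    linarith
  · have h1 := norm_le_norm_dil hl p
    have h2 := mul_le_mul_of_nonneg_left (h.support_le _ (hs p hp) hne)
      (by positivity : 0 ≤ lam⁻¹ + (lam⁻¹) ^ 2)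
    linarith

theorem spatialDot_dil (h : Regular a U g K α) {lam : ℝ} {p : Pt n} (hp : dil lam p ∈ strip n 1) :
    spatialDot (fun p => U (dil lam p)) (fun p => U (dil lam p)) p =
      lam ^ 2 * spatialDot U U (dil lam p) := by
  simp only [spatialDot, (h.hasLineDerivAt_dil_y hp).lineDeriv,
    fun i => (h.hasLineDerivAt_dil_x hp i).lineDeriv, mul_add, Finset.mul_sum]
  congr 1
  · exact Finset.sum_congr rfl fun i _ => by ring
  · ring

/-- The parabolic distance between heights y and η < y over the same (x,t) is at most y, so the
Hölder bound passes to the limit η → 0 and gives a uniform rate. -/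
theorem abs_weightedDy_sub_le (h : Regular a U g K α) {x : EuclideanSpace ℝ (Fin n)} {y t d : ℝ}
    (hp : ((x, y, t) : Pt n) ∈ strip n 1) (hd : HasWeightedNormalDeriv a U x t d) :
    |weightedDy a U (x, y, t) - d| ≤ K * y ^ α ∧ |d| ≤ K := by
  have hmem : ∀ η : ℝ, 0 < η → ((x, η, t) : Pt n) ∈ strip n 1 := fun η hη => ⟨hη, hp.2⟩
  have hy : 0 < y := hp.1
  constructor
  · refine le_of_tendsto (hd.const_sub _).abs ?_
    filter_upwards [Ioo_mem_nhdsGT hy] with η hη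
    refine (h.holder_dy _ hp _ (hmem η hη.1)).trans ?_
    have : parNorm (((x, y, t) : Pt n) - (x, η, t)) ≤ y := by
      rw [parNorm, spaceNorm]
      simp only [Prod.fst_sub, Prod.snd_sub, sub_self, norm_zero, abs_zero, add_zero]
      rw [Real.sqrt_sq (Real.sqrt_nonneg _)]
      refine Real.sqrt_le_iff.2 ⟨hy.le, ?_⟩
      nlinarith [hη.1, hη.2]
    exact mul_le_mul_of_nonneg_left
      (Real.rpow_le_rpow (Real.sqrt_nonneg _) this h.exponent_pos.le) h.nonneg
  · refine le_of_tendsto hd.abs ?_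
    filter_upwards [self_mem_nhdsWithin] with η hη
    exact h.abs_dy_le _ (hmem η hη)

/-- The flux of `U` at `p` against the value of `U` at `q`, near the thin space. -/
theorem flux_mul_le (h : Regular a U g K α) (ha : a ∈ Ioo (-1 : ℝ) 1) {N : ℝ}
    (hN : ∀ p ∈ strip n 1, |U p| ≤ N) {c d : ℝ} (hc : |c| ≤ 1) {p q : Pt n} (hp : p ∈ strip n 1)
    (hq : q ∈ strip n 1) (hd : HasWeightedNormalDeriv a U p.1 p.2.2 d)
    (hsign : c * d * U (q.1, 0, q.2.2) ≤ 0) :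
    c * weightedDy a U p * U q ≤ K * N * p.2.1 ^ α + K * (K / (1 - a)) * q.2.1 ^ (1 - a) := by
  obtain ⟨h1, h2⟩ := h.abs_weightedDy_sub_le (x := p.1) (y := p.2.1) (t := p.2.2) hp hd
  have h3 := h.abs_sub_le_y ha (x := q.1) (le_refl 0) hq.1.le (t := q.2.2)
    ⟨by have := hq.2.1; simpa using this, hq.2.2⟩
  rw [Real.zero_rpow (by linarith [ha.2]), sub_zero] at h3
  have h4 := hN q hq
  -- Both factors are replaced by their traces on y = 0. The product of the traces has a sign, and
  -- the two errors vanish with the heights at the rates y^α and y^{1-a}.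
  have e : c * weightedDy a U p * U q = c * ((weightedDy a U p - d) * U q) +
      c * (d * (U q - U (q.1, 0, q.2.2))) + c * d * U (q.1, 0, q.2.2) := by ring
  have hK := h.nonneg
  have b1 : c * ((weightedDy a U p - d) * U q) ≤ K * p.2.1 ^ α * N := by
    refine (le_abs_self _).trans ?_
    rw [abs_mul, abs_mul]
    exact (mul_le_of_le_one_left (by positivity) hc).trans
      (mul_le_mul h1 h4 (abs_nonneg _) ((abs_nonneg _).trans h1))
  have b2 : c * (d * (U q - U (q.1, 0, q.2.2))) ≤ K * (K / (1 - a) * q.2.1 ^ (1 - a)) := by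
    refine (le_abs_self _).trans ?_
    rw [abs_mul, abs_mul]
    exact (mul_le_of_le_one_left (by positivity) hc).trans (mul_le_mul h2 h3 (abs_nonneg _) hK)
  rw [e]; linarith

/-- The boundary contribution is governed by the flux trace at (x,t) times the trace of U at the
rescaled point; `hsign` makes it favourable, and `flux_mul_le` supplies a modulus β tending to 0.
The number c selects the direction of the inequality. -/
theorem weak_inequality_dil (h : Regular a U g K α) (hS : SolutionClass n a F U)
    (ha : a ∈ Ioo (-1 : ℝ) 1) (hn : 1 ≤ n) (hr : r ∈ Ioo (0 : ℝ) 1) {lam : ℝ} (hl : 0 < lam)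
    (hlr : lam * r < 1) {c : ℝ} (hc : |c| ≤ 1)
    (hsign : ∀ p ∈ lowerStrip n r, ∀ d, HasWeightedNormalDeriv a U p.1 p.2.2 d →
      min (U (p.1, 0, p.2.2)) (-d) = 0 → c * d * U (lam • p.1, 0, lam ^ 2 * p.2.2) ≤ 0) :
    0 ≤ c * ∫ p, weakIntegrand F U g (fun p => U (dil lam p)) p ∂gaussMeasure n a r := by
  obtain ⟨N, hN0, hN⟩ := h.exists_abs_le hn
  obtain ⟨M, hV⟩ := h.profile_dil (lam := lam) hn hl hr hlr
  have ha1 : 0 < 1 - a := sub_pos.2 ha.2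
  have hK := h.nonneg
  have hα := h.exponent_pos
  refine h.weak_inequality (β := fun y => K * N * y ^ α + K * (K / (1 - a)) * (lam * y) ^ (1 - a))
    ha hn hr hS.equation hS.rhs_bounded hV (fun p hp => ?_) (fun y hy => by positivity)
    (fun y hy z hz hyz => ?_) ?_
  · have hp1 := openStrip_subset_strip n (openStrip_of_lowerStrip hr hp)
    obtain ⟨d, hd, hmin⟩ := hS.signorini p.1 p.2.2 (by simpa using hp1.2.1) hp1.2.2
    exact h.flux_mul_le ha hN hc hp1
      (openStrip_subset_strip n (dil_mem_openStrip_of_mul_lt hl hr hlr hp)) hd (hsign p hp d hd hmin)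
  · have hy0 : (0 : ℝ) < y := hy
    have : (0 : ℝ) ≤ lam * y := by positivity
    dsimp only
    gcongr
  · have hcont : ContinuousAt (fun y : ℝ => K * N * y ^ α + K * (K / (1 - a)) * (lam * y) ^ (1 - a)) 0 := by
      refine ContinuousAt.add (continuousAt_const.mul ?_) (continuousAt_const.mul ?_)
      · exact Real.continuousAt_rpow_const _ _ (Or.inr hα.le)
      · exact ContinuousAt.rpow_const (by fun_prop) (Or.inr ha1.le)
    have := hcont.tendsto
    simp only [mul_zero, Real.zero_rpow hα.ne', Real.zero_rpow ha1.ne', add_zero] at this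
    exact this.mono_left nhdsWithin_le_nhds

end Regular

end ThinObstacle

end

/-! ### Energy, pairing and the variational inequality. -/

noncomputable section

namespace ThinObstacle

variable {n : ℕ} {a r s M K α : ℝ} {F U g V : Pt n → ℝ}

/-- The Euler field of `U` without the forcing term. -/
def drift (F U g : Pt n → ℝ) (p : Pt n) : ℝ := euler U g p - 2 * p.2.2 * F p

/-- The scaled Dirichlet energy. -/
def energy (a : ℝ) (U : Pt n → ℝ) (r : ℝ) : ℝ :=
  ∫ q, -(dil r q).2.2 * spatialDot U U (dil r q) ∂gaussMeasure n a 1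

/-- The drift at scale `r` paired with `U` at scale `s`. -/
def pairing (a : ℝ) (F U g : Pt n → ℝ) (r s : ℝ) : ℝ :=
  ∫ q, drift F U g (dil r q) * U (dil s q) ∂gaussMeasure n a 1

theorem integral_dil_one (hr : 0 < r) (f : Pt n → ℝ) :
    ∫ q, f (dil r q) ∂gaussMeasure n a 1 = (r ^ 2)⁻¹ * ∫ p, f p ∂gaussMeasure n a r := by
  rw [integral_comp_dil hr f, mul_one]

namespace Regular

theorem integrable_drift_mul (h : Regular a U g K α) (ha : a ∈ Ioo (-1 : ℝ) 1)
    (hr : r ∈ Ioo (0 : ℝ) 1) (hF : MemLp F ⊤ (volume.restrict (strip n 1)))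
    (hV : Profile a r V M) : Integrable (fun p => drift F U g p * V p) (gaussMeasure n a r) :=
  h.integrable_euler_mul ha hr hF hV

/-- Without rescaling, flux trace times trace of U is 0 by complementarity, so c = 1 and c = -1 are
both allowed and the weak inequality becomes an equality. -/
theorem two_mul_energy (h : Regular a U g K α) (hS : SolutionClass n a F U)
    (ha : a ∈ Ioo (-1 : ℝ) 1) (hn : 1 ≤ n) (hr : r ∈ Ioo (0 : ℝ) 1) :
    2 * energy a U r = pairing a F U g r r := by
  obtain ⟨M, hM⟩ := h.profile hn hr
  have hz : ∫ p, weakIntegrand F U g U p ∂gaussMeasure n a r = 0 := by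
    have key : ∀ c : ℝ, |c| ≤ 1 → 0 ≤ c * ∫ p, weakIntegrand F U g U p ∂gaussMeasure n a r := by
      intro c hc
      have := h.weak_inequality_dil hS ha hn hr one_pos (by linarith [hr.2]) hc
        fun p hp d _ hmin => by
          have : d * U (p.1, 0, p.2.2) = 0 := by
            rcases min_choice (U (p.1, 0, p.2.2)) (-d) with e | e <;> rw [hmin] at e
            · rw [← e, mul_zero]
            · rw [show d = 0 by linarith, zero_mul]
          rw [one_smul, one_pow, one_mul, mul_assoc, this, mul_zero]
      simpa only [dil_one] using this
    have h1 := key 1 (by simp)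
    have h2 := key (-1) (by simp)
    linarith
  have hsub := integral_sub (hM.integrable_spatialDot ha hr hM)
    (h.integrable_drift_mul ha hr hS.rhs_bounded hM)
  have hz' : ∫ p, (-2 * p.2.2 * spatialDot U U p - drift F U g p * U p) ∂gaussMeasure n a r = 0 := hz
  rw [hz'] at hsub
  rw [energy, pairing, integral_dil_one hr.1 fun p => -p.2.2 * spatialDot U U p,
    integral_dil_one hr.1 fun p => drift F U g p * U p, mul_left_comm, ← integral_const_mul]
  congr 1
  have e : ∀ p : Pt n, 2 * (-p.2.2 * spatialDot U U p) = -2 * p.2.2 * spatialDot U U p :=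
    fun p => by ring
  simp only [e]
  linarith

/-- The test function is U rescaled by s/r. The flux at p is nonpositive and U at the rescaled point
is nonnegative, so the boundary term can be dropped. Then 2∇U·∇V ≤ |∇U|² + |∇V|², and scaling turns
the gradient term of V into the energy at scale s. -/
theorem pairing_le (h : Regular a U g K α) (hS : SolutionClass n a F U)
    (ha : a ∈ Ioo (-1 : ℝ) 1) (hn : 1 ≤ n) (hr : r ∈ Ioo (0 : ℝ) 1) (hs : s ∈ Ioo (0 : ℝ) 1) :
    pairing a F U g r s ≤ energy a U s + energy a U r := by
  have hl : 0 < s / r := div_pos hs.1 hr.1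
  have hlr : s / r * r = s := div_mul_cancel₀ s hr.1.ne'
  obtain ⟨M, hM⟩ := h.profile hn hr
  obtain ⟨N, hN⟩ := h.profile_dil (lam := s / r) hn hl hr (hlr.trans_lt hs.2)
  set V : Pt n → ℝ := fun p => U (dil (s / r) p) with hV
  have hw := h.weak_inequality_dil (lam := s / r) (c := 1) hS ha hn hr hl (hlr.trans_lt hs.2) (by simp)
    fun p hp d _ hmin => by
      have hd : d ≤ 0 := by have := min_le_right (U (p.1, 0, p.2.2)) (-d); linarith
      have hp' := openStrip_subset_strip n
        (dil_mem_openStrip_of_mul_lt hl hr (hlr.trans_lt hs.2) hp)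
      obtain ⟨d', -, hd'⟩ := hS.signorini ((s / r) • p.1) ((s / r) ^ 2 * p.2.2)
        (by
          have : -(1 : ℝ) ^ 2 < (s / r) ^ 2 * p.2.2 := hp'.2.1
          rwa [one_pow] at this) hp'.2.2
      have hu := min_le_left (U ((s / r) • p.1, 0, (s / r) ^ 2 * p.2.2)) (-d')
      rw [hd'] at hu
      rw [one_mul]
      exact mul_nonpos_of_nonpos_of_nonneg hd hu
  rw [one_mul] at hw
  have hsub : ∫ p, weakIntegrand F U g V p ∂gaussMeasure n a r = _ :=
    integral_sub (hM.integrable_spatialDot ha hr hN)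
      (h.integrable_drift_mul ha hr hS.rhs_bounded hN)
  have hUU := hM.integrable_spatialDot ha hr hM
  have hVV := hN.integrable_spatialDot ha hr hN
  have hle : ∫ p, -2 * p.2.2 * spatialDot U V p ∂gaussMeasure n a r ≤
      ∫ p, (1 / 2 * (-2 * p.2.2 * spatialDot U U p) + 1 / 2 * (-2 * p.2.2 * spatialDot V V p))
        ∂gaussMeasure n a r := by
    refine integral_mono_ae (hM.integrable_spatialDot ha hr hN)
      ((hUU.const_mul _).add (hVV.const_mul _)) ?_
    filter_upwards [ae_mem_lowerStrip a r] with p hp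
    have hdot : 2 * spatialDot U V p ≤ spatialDot U U p + spatialDot V V p := by
      simp only [spatialDot]
      have : 2 * ∑ i, lineDeriv ℝ U p (dirX i) * lineDeriv ℝ V p (dirX i) ≤
          ∑ i, lineDeriv ℝ U p (dirX i) * lineDeriv ℝ U p (dirX i) +
          ∑ i, lineDeriv ℝ V p (dirX i) * lineDeriv ℝ V p (dirX i) := by
        rw [Finset.mul_sum, ← Finset.sum_add_distrib]
        refine Finset.sum_le_sum fun i _ => ?_
        nlinarith [sq_nonneg (lineDeriv ℝ U p (dirX i) - lineDeriv ℝ V p (dirX i))]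
      nlinarith [sq_nonneg (lineDeriv ℝ U p (dirY n) - lineDeriv ℝ V p (dirY n))]
    have ht : 0 ≤ -p.2.2 := by linarith [hp.2.2]
    nlinarith [mul_le_mul_of_nonneg_left hdot ht]
  rw [integral_add (hUU.const_mul _) (hVV.const_mul _), integral_const_mul,
    integral_const_mul] at hle
  have e1 : ∫ p, -2 * p.2.2 * spatialDot U U p ∂gaussMeasure n a r = 2 * (r ^ 2 * energy a U r) := by
    have := integral_dil_one (a := a) hr.1 fun p : Pt n => -2 * p.2.2 * spatialDot U U p
    rw [energy, ← integral_const_mul, ← integral_const_mul]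
    have hr2 : (r ^ 2) ≠ 0 := pow_ne_zero 2 hr.1.ne'
    rw [inv_mul_eq_div, eq_div_iff hr2, ← integral_mul_const] at this
    rw [← this]
    exact integral_congr_ae (Eventually.of_forall fun p => by ring)
  have hdil : ∀ q : Pt n, dil (s / r) (dil r q) = dil s q := fun q => by rw [dil_dil, hlr]
  -- The two gradients of V produce (s/r)², which converts the time r²t into s²t.
  have e2 : ∫ p, -2 * p.2.2 * spatialDot V V p ∂gaussMeasure n a r = 2 * (r ^ 2 * energy a U s) := by
    have := integral_dil_one (a := a) hr.1 fun p : Pt n => -2 * p.2.2 * spatialDot V V p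
    rw [energy, ← integral_const_mul, ← integral_const_mul]
    have hr2 : (r ^ 2) ≠ 0 := pow_ne_zero 2 hr.1.ne'
    rw [inv_mul_eq_div, eq_div_iff hr2, ← integral_mul_const] at this
    rw [← this]
    refine integral_congr_ae ?_
    filter_upwards [ae_mem_lowerStrip a 1] with q hq
    have hmem : dil (s / r) (dil r q) ∈ strip n 1 := by
      rw [hdil]; exact openStrip_subset_strip n (dil_mem_openStrip hs hq)
    rw [hV, h.spatialDot_dil hmem, hdil]
    have hr0 := hr.1.ne'
    simp only [dil]
    field_simp
  have e3 : ∫ p, drift F U g p * V p ∂gaussMeasure n a r = r ^ 2 * pairing a F U g r s := by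
    have := integral_dil_one (a := a) hr.1 fun p : Pt n => drift F U g p * V p
    simp only [hV, hdil] at this
    rw [pairing, this, mul_inv_cancel_left₀ (pow_ne_zero 2 hr.1.ne')]
  have e4 : ∫ p, (euler U g p - 2 * p.2.2 * F p) * V p ∂gaussMeasure n a r =
      r ^ 2 * pairing a F U g r s := e3
  rw [hsub, e4] at hw
  rw [e1, e2] at hle
  have hr2 : 0 < r ^ 2 := pow_pos hr.1 2
  nlinarith

end Regular

end ThinObstacle

end

/-! ### Differentiation in the scale, and continuity of the energy. -/

noncomputable section

namespace ThinObstacle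

variable {n : ℕ} {a r s M K α : ℝ} {F U g V : Pt n → ℝ}

theorem integrable_of_abs_le_growth (ha : -1 < a) {w : Pt n → ℝ} {D : ℝ} {k : ℕ}
    (hw : AEStronglyMeasurable w (gaussMeasure n a 1))
    (hD : ∀ᵐ q ∂gaussMeasure n a 1, |w q| ≤ D * growth q ^ k) :
    Integrable w (gaussMeasure n a 1) :=
  ((integrable_growth_pow ha k).const_mul D).mono' hw (by simpa only [Real.norm_eq_abs] using hD)

/-- Dominated differentiation: the Lipschitz constant in the scale grows polynomially in X, which
the Gaussian integrates. The range starts at r/2 since the constant degenerates at scale 0. -/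
theorem hasDerivAt_integral_of_lipschitz_growth (ha : -1 < a) (hr : r ∈ Ioo (0 : ℝ) 1)
    {f : ℝ → Pt n → ℝ} {f' : Pt n → ℝ} {B : ℝ} {k : ℕ}
    (hm : ∀ s ∈ Ioo (0 : ℝ) 1, AEStronglyMeasurable (f s) (gaussMeasure n a 1))
    (hi : Integrable (f r) (gaussMeasure n a 1))
    (hm' : AEStronglyMeasurable f' (gaussMeasure n a 1))
    (hl : ∀ᵐ q ∂gaussMeasure n a 1, ∀ s ∈ Ico (r / 2) 1, ∀ s' ∈ Ico (r / 2) 1,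
      |f s q - f s' q| ≤ B * growth q ^ k * |s - s'|)
    (hd : ∀ᵐ q ∂gaussMeasure n a 1, HasDerivAt (fun s => f s q) (f' q) r) :
    HasDerivAt (fun s => ∫ q, f s q ∂gaussMeasure n a 1) (∫ q, f' q ∂gaussMeasure n a 1) r := by
  have hs : Ioo (r / 2) 1 ∈ 𝓝 r := Ioo_mem_nhds (by linarith [hr.1]) hr.2
  refine (hasDerivAt_integral_of_dominated_loc_of_lip (bound := fun q => B * growth q ^ k) hs
    ?_ hi hm' ?_ ((integrable_growth_pow ha k).const_mul B) hd).2
  · filter_upwards [Ioo_mem_nhds hr.1 hr.2] with s hs using hm s hs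
  · filter_upwards [hl] with q hq
    refine LipschitzOnWith.of_dist_le_mul fun s hs s' hs' => ?_
    rw [Real.dist_eq, Real.dist_eq, Real.coe_nnabs]
    refine (hq s ⟨hs.1.le, hs.2⟩ s' ⟨hs'.1.le, hs'.2⟩).trans ?_
    exact mul_le_mul_of_nonneg_right (le_abs_self _) (abs_nonneg _)

namespace Regular

theorem exists_abs_drift_le (h : Regular a U g K α) (ha : a ∈ Ioo (-1 : ℝ) 1)
    (hF : MemLp F ⊤ (volume.restrict (strip n 1))) :
    ∃ D, 0 ≤ D ∧ ∀ᵐ p ∂(volume.restrict (openStrip n)), |drift F U g p| ≤ D * growth p := by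
  rw [restrict_strip_one] at hF
  obtain ⟨L, hL0, hL⟩ := ae_abs_le_of_memLp_top hF
  have hK := h.nonneg
  refine ⟨K * (n + 3) + 2 * L, by positivity, ?_⟩
  filter_upwards [ae_restrict_mem (isOpen_openStrip n).measurableSet, hL, h.ae_abs_dt_le]
    with p hp hFp hgp
  have h1 := h.abs_euler_le ha hp hgp
  have h2 : |2 * p.2.2 * F p| ≤ 2 * L * growth p := by
    rw [abs_mul, abs_mul, abs_two]
    have ht : |p.2.2| ≤ 1 := abs_le.2 ⟨by linarith [hp.2.1], by linarith [hp.2.2]⟩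
    have := one_le_growth p
    have h0 := abs_nonneg (F p)
    calc 2 * |p.2.2| * |F p| ≤ 2 * 1 * L := by gcongr
      _ ≤ 2 * L * growth p := by nlinarith
  have h3 := abs_sub (euler U g p) (2 * p.2.2 * F p)
  rw [drift]
  linarith

theorem aestronglyMeasurable_drift (h : Regular a U g K α)
    (hF : MemLp F ⊤ (volume.restrict (strip n 1))) :
    AEStronglyMeasurable (drift F U g) (volume.restrict (openStrip n)) := by
  rw [restrict_strip_one] at hF
  exact h.aestronglyMeasurable_euler.sub
    ((Measurable.aestronglyMeasurable (by fun_prop)).mul hF.1)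

theorem aestronglyMeasurable_dil (h : Regular a U g K α) (hr : r ∈ Ioo (0 : ℝ) 1) :
    AEStronglyMeasurable (fun q => U (dil r q)) (gaussMeasure n a 1) :=
  aestronglyMeasurable_dil_of_openStrip hr
    (h.continuousOn_openStrip.aestronglyMeasurable (isOpen_openStrip n).measurableSet)

theorem aestronglyMeasurable_euler_dil_div (h : Regular a U g K α) (hr : r ∈ Ioo (0 : ℝ) 1) :
    AEStronglyMeasurable (fun q => euler U g (dil r q) / r) (gaussMeasure n a 1) := by
  simpa only [div_eq_mul_inv] using
    (aestronglyMeasurable_dil_of_openStrip hr h.aestronglyMeasurable_euler).mul_const r⁻¹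

theorem ae_abs_dil_le {N : ℝ} (hN : ∀ p ∈ strip n 1, |U p| ≤ N) (hr : r ∈ Ioo (0 : ℝ) 1) :
    ∀ᵐ q ∂gaussMeasure n a 1, |U (dil r q)| ≤ N := by
  filter_upwards [ae_mem_lowerStrip a 1] with q hq
  exact hN _ (openStrip_subset_strip n (dil_mem_openStrip hr hq))

theorem ae_abs_le_growth_dil {w : Pt n → ℝ} {D : ℝ} (hD0 : 0 ≤ D)
    (hD : ∀ᵐ p ∂(volume.restrict (openStrip n)), |w p| ≤ D * growth p) (hr : r ∈ Ioo (0 : ℝ) 1) :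
    ∀ᵐ q ∂gaussMeasure n a 1, |w (dil r q)| ≤ D * growth q := by
  filter_upwards [ae_dil_of_openStrip hr hD] with q hq
  exact hq.trans (mul_le_mul_of_nonneg_left (growth_dil_le hr q) hD0)

theorem ae_abs_euler_le (h : Regular a U g K α) (ha : a ∈ Ioo (-1 : ℝ) 1) :
    ∀ᵐ p ∂(volume.restrict (openStrip n)), |euler U g p| ≤ K * (n + 3) * growth p := by
  filter_upwards [ae_restrict_mem (isOpen_openStrip n).measurableSet, h.ae_abs_dt_le] with p hp hg
  exact h.abs_euler_le ha hp hg

theorem hasDerivAt_integral_mul_dil (h : Regular a U g K α) (ha : a ∈ Ioo (-1 : ℝ) 1)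
    (hn : 1 ≤ n) (hr : r ∈ Ioo (0 : ℝ) 1) {w : Pt n → ℝ} {D : ℝ}
    (hw : AEStronglyMeasurable w (gaussMeasure n a 1))
    (hD : ∀ᵐ q ∂gaussMeasure n a 1, |w q| ≤ D * growth q) :
    HasDerivAt (fun s => ∫ q, w q * U (dil s q) ∂gaussMeasure n a 1)
      (∫ q, w q * (euler U g (dil r q) / r) ∂gaussMeasure n a 1) r := by
  obtain ⟨N, hN0, hN⟩ := h.exists_abs_le hn
  have hK := h.nonneg
  refine hasDerivAt_integral_of_lipschitz_growth (B := D * (K * (n + 2 / (r / 2) + 2))) (k := 2)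
    ha.1 hr (fun s hs => hw.mul (h.aestronglyMeasurable_dil hs)) ?_ ?_ ?_ ?_
  · refine integrable_of_abs_le_growth (k := 1) (D := D * N) ha.1
      (hw.mul (h.aestronglyMeasurable_dil hr)) ?_
    filter_upwards [hD, ae_abs_dil_le hN hr] with q h1 h2
    rw [abs_mul, pow_one]
    calc _ ≤ D * growth q * N := mul_le_mul h1 h2 (abs_nonneg _) ((abs_nonneg _).trans h1)
      _ = _ := by ring
  · exact hw.mul (h.aestronglyMeasurable_euler_dil_div hr)
  · filter_upwards [hD, ae_mem_lowerStrip a 1] with q h1 hq s hs s' hs'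
    have h2 := h.abs_dil_sub_le ha hn (half_pos hr.1) hs' hs hq
    rw [← mul_sub, abs_mul]
    calc _ ≤ D * growth q * (K * (n + 2 / (r / 2) + 2) * growth q * |s - s'|) :=
          mul_le_mul h1 h2 (abs_nonneg _) ((abs_nonneg _).trans h1)
      _ = _ := by ring
  · filter_upwards [h.ae_hasDerivAt_dil ha hn hr] with q hq using hq.const_mul _

theorem hasDerivAt_integral_sq_dil (h : Regular a U g K α) (ha : a ∈ Ioo (-1 : ℝ) 1)
    (hn : 1 ≤ n) (hr : r ∈ Ioo (0 : ℝ) 1) :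
    HasDerivAt (fun s => ∫ q, U (dil s q) ^ 2 ∂gaussMeasure n a 1)
      (2 * (∫ q, euler U g (dil r q) * U (dil r q) ∂gaussMeasure n a 1) / r) r := by
  obtain ⟨N, hN0, hN⟩ := h.exists_abs_le hn
  have hK := h.nonneg
  have hm : ∀ s ∈ Ioo (0 : ℝ) 1,
      AEStronglyMeasurable (fun q => U (dil s q) ^ 2) (gaussMeasure n a 1) :=
    fun s hs => (h.aestronglyMeasurable_dil hs).pow 2
  have hi : Integrable (fun q => U (dil r q) ^ 2) (gaussMeasure n a 1) := by
    refine integrable_of_abs_le_growth (k := 0) (D := N ^ 2) ha.1 (hm r hr) ?_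
    filter_upwards [ae_abs_dil_le hN hr] with q h2
    rw [abs_pow, pow_zero, mul_one]
    exact pow_le_pow_left₀ (abs_nonneg _) h2 2
  have hm' : AEStronglyMeasurable (fun q => 2 * U (dil r q) * (euler U g (dil r q) / r))
      (gaussMeasure n a 1) :=
    ((h.aestronglyMeasurable_dil hr).const_mul 2).mul (h.aestronglyMeasurable_euler_dil_div hr)
  have hl : ∀ᵐ q ∂gaussMeasure n a 1, ∀ s ∈ Ico (r / 2) 1, ∀ s' ∈ Ico (r / 2) 1,
      |U (dil s q) ^ 2 - U (dil s' q) ^ 2| ≤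
        2 * N * (K * (n + 2 / (r / 2) + 2)) * growth q ^ 1 * |s - s'| := by
    filter_upwards [ae_mem_lowerStrip a 1] with q hq s hs s' hs'
    have h2 := h.abs_dil_sub_le ha hn (half_pos hr.1) hs' hs hq
    have hb : ∀ τ ∈ Ico (r / 2) 1, |U (dil τ q)| ≤ N := fun τ hτ =>
      hN _ (openStrip_subset_strip n (dil_mem_openStrip ⟨(half_pos hr.1).trans_le hτ.1, hτ.2⟩ hq))
    have h3 : |U (dil s q) + U (dil s' q)| ≤ N + N :=
      (abs_add_le _ _).trans (add_le_add (hb s hs) (hb s' hs'))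
    rw [sq_sub_sq, abs_mul, pow_one]
    calc _ ≤ (N + N) * (K * (n + 2 / (r / 2) + 2) * growth q * |s - s'|) :=
          mul_le_mul h3 h2 (abs_nonneg _) (by linarith)
      _ = _ := by ring
  have hdq : ∀ᵐ q ∂gaussMeasure n a 1, HasDerivAt (fun s => U (dil s q) ^ 2)
      (2 * U (dil r q) * (euler U g (dil r q) / r)) r := by
    filter_upwards [h.ae_hasDerivAt_dil ha hn hr] with q hq
    have := hq.pow 2
    simp only [Nat.cast_ofNat, Nat.add_one_sub_one, pow_one] at this
    exact this
  refine (hasDerivAt_integral_of_lipschitz_growth ha.1 hr hm hi hm' hl hdq).congr_deriv ?_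
  rw [mul_div_assoc, ← integral_div, ← integral_const_mul]
  exact integral_congr_ae (Eventually.of_forall fun q => by ring)

theorem hasDerivAt_pairing (h : Regular a U g K α) (ha : a ∈ Ioo (-1 : ℝ) 1)
    (hF : MemLp F ⊤ (volume.restrict (strip n 1))) (hn : 1 ≤ n) (hr : r ∈ Ioo (0 : ℝ) 1) :
    HasDerivAt (pairing a F U g r)
      (∫ q, drift F U g (dil r q) * (euler U g (dil r q) / r) ∂gaussMeasure n a 1) r := by
  obtain ⟨D, hD0, hD⟩ := h.exists_abs_drift_le ha hF
  exact h.hasDerivAt_integral_mul_dil ha hn hr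
    (aestronglyMeasurable_dil_of_openStrip hr (h.aestronglyMeasurable_drift hF))
    (ae_abs_le_growth_dil hD0 hD hr)

theorem integrable_drift_mul_dil (h : Regular a U g K α) (ha : a ∈ Ioo (-1 : ℝ) 1)
    (hF : MemLp F ⊤ (volume.restrict (strip n 1))) (hn : 1 ≤ n) (hr : r ∈ Ioo (0 : ℝ) 1)
    (hs : s ∈ Ioo (0 : ℝ) 1) :
    Integrable (fun q => drift F U g (dil r q) * U (dil s q)) (gaussMeasure n a 1) := by
  obtain ⟨D, hD0, hD⟩ := h.exists_abs_drift_le ha hF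
  obtain ⟨N, hN0, hN⟩ := h.exists_abs_le hn
  refine integrable_of_abs_le_growth (k := 1) (D := D * N) ha.1
    ((aestronglyMeasurable_dil_of_openStrip hr (h.aestronglyMeasurable_drift hF)).mul
      (h.aestronglyMeasurable_dil hs)) ?_
  filter_upwards [ae_abs_le_growth_dil hD0 hD hr, ae_abs_dil_le hN hs] with q h1 h2
  rw [abs_mul, pow_one]
  calc _ ≤ D * growth q * N := mul_le_mul h1 h2 (abs_nonneg _) ((abs_nonneg _).trans h1)
    _ = _ := by ring

/-- Subtract 2E(r) = Θ(r,r) from `pairing_le`. This is the substitute for a derivative of the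
energy. -/
theorem energy_sub_ge (h : Regular a U g K α) (hS : SolutionClass n a F U)
    (ha : a ∈ Ioo (-1 : ℝ) 1) (hn : 1 ≤ n) (hr : r ∈ Ioo (0 : ℝ) 1) (hs : s ∈ Ioo (0 : ℝ) 1) :
    pairing a F U g r s - pairing a F U g r r ≤ energy a U s - energy a U r := by
  have h1 := h.two_mul_energy hS ha hn hr
  have h2 := h.pairing_le hS ha hn hr hs
  linarith

/-- The constant is uniform in both scales, since `continuousOn_energy` uses the pairing based at
the moving scale as well. -/
theorem exists_abs_pairing_sub_le (h : Regular a U g K α) (ha : a ∈ Ioo (-1 : ℝ) 1)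
    (hF : MemLp F ⊤ (volume.restrict (strip n 1))) (hn : 1 ≤ n) {r₀ : ℝ} (hr₀ : 0 < r₀) :
    ∃ B, ∀ r ∈ Ico r₀ 1, ∀ s ∈ Ico r₀ 1,
      |pairing a F U g r s - pairing a F U g r r| ≤ B * |s - r| := by
  obtain ⟨D, hD0, hD⟩ := h.exists_abs_drift_le ha hF
  have hK := h.nonneg
  refine ⟨∫ q, D * (K * (n + 2 / r₀ + 2)) * growth q ^ 2 ∂gaussMeasure n a 1,
    fun r hr s hs => ?_⟩
  have hr' : r ∈ Ioo (0 : ℝ) 1 := ⟨hr₀.trans_le hr.1, hr.2⟩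
  have hs' : s ∈ Ioo (0 : ℝ) 1 := ⟨hr₀.trans_le hs.1, hs.2⟩
  rw [pairing, pairing, ← integral_sub (h.integrable_drift_mul_dil ha hF hn hr' hs')
    (h.integrable_drift_mul_dil ha hF hn hr' hr'), ← integral_mul_const, ← Real.norm_eq_abs]
  refine norm_integral_le_of_norm_le
    (((integrable_growth_pow ha.1 2).const_mul _).mul_const _) ?_
  filter_upwards [ae_abs_le_growth_dil hD0 hD hr', ae_mem_lowerStrip a 1] with q h1 hq
  have h2 := h.abs_dil_sub_le ha hn hr₀ hr hs hq
  rw [← mul_sub, norm_mul, Real.norm_eq_abs, Real.norm_eq_abs]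
  calc _ ≤ D * growth q * (K * (n + 2 / r₀ + 2) * growth q * |s - r|) :=
        mul_le_mul h1 h2 (abs_nonneg _) ((abs_nonneg _).trans h1)
    _ = _ := by ring

/-- `energy_sub_ge` based at r bounds E(s) - E(r) from below, and based at s bounds it from above;
both bounds are O(|s - r|). -/
theorem continuousOn_energy (h : Regular a U g K α) (hS : SolutionClass n a F U)
    (ha : a ∈ Ioo (-1 : ℝ) 1) (hn : 1 ≤ n) : ContinuousOn (energy a U) (Ioo 0 1) := by
  intro r hr
  refine ContinuousAt.continuousWithinAt ?_
  obtain ⟨B, hB⟩ := h.exists_abs_pairing_sub_le ha hS.rhs_bounded hn (half_pos hr.1)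
  rw [ContinuousAt, tendsto_iff_norm_sub_tendsto_zero]
  have hlim : Tendsto (fun s => B * |s - r|) (𝓝 r) (𝓝 0) := by
    have : Continuous fun s => B * |s - r| := by fun_prop
    simpa using this.tendsto r
  refine squeeze_zero' (Eventually.of_forall fun _ => norm_nonneg _) ?_ hlim
  filter_upwards [Ioo_mem_nhds (by linarith [hr.1] : r / 2 < r) hr.2] with s hs
  have hs' : s ∈ Ioo (0 : ℝ) 1 := ⟨(half_pos hr.1).trans hs.1, hs.2⟩
  have hrI : r ∈ Ico (r / 2) 1 := ⟨by linarith [hr.1], hr.2⟩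
  have hsI : s ∈ Ico (r / 2) 1 := ⟨hs.1.le, hs.2⟩
  have h1 := h.energy_sub_ge hS ha hn hr hs'
  have h2 := h.energy_sub_ge hS ha hn hs' hr
  have b1 := hB r hrI s hsI
  have b2 := hB s hsI r hrI
  rw [abs_sub_comm r s] at b2
  rw [Real.norm_eq_abs, abs_le]
  have := neg_abs_le (pairing a F U g r s - pairing a F U g r r)
  have := neg_abs_le (pairing a F U g s r - pairing a F U g s s)
  constructor <;> linarith

end Regular

end ThinObstacle

end

/-! ### The forcing term and the Cauchy–Schwarz estimates. -/

noncomputable section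

namespace ThinObstacle

variable {n : ℕ} {a r s M K α c ℓ : ℝ} {F U g V : Pt n → ℝ}

/-- Cauchy–Schwarz is applied to the majorant k of f, so that constants depend on the growth bound
of the force and not on the force. -/
theorem abs_integral_mul_le_sqrt {X : Type*} [MeasurableSpace X] {μ : Measure X} {f k v : X → ℝ}
    (hfk : ∀ᵐ x ∂μ, |f x| ≤ k x) (hkm : AEStronglyMeasurable k μ) (hvm : AEStronglyMeasurable v μ)
    (hk : Integrable (fun x => k x ^ 2) μ) (hv : Integrable (fun x => v x ^ 2) μ) :
    |∫ x, f x * v x ∂μ| ≤ √((∫ x, k x ^ 2 ∂μ) * ∫ x, v x ^ 2 ∂μ) := by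
  have hk2 : MemLp k 2 μ := (memLp_two_iff_integrable_sq hkm).2 hk
  have hv2 : MemLp v 2 μ := (memLp_two_iff_integrable_sq hvm).2 hv
  have hmul : Integrable (fun x => k x * |v x|) μ := hk2.integrable_mul hv2.abs
  have h1 : |∫ x, f x * v x ∂μ| ≤ ∫ x, k x * |v x| ∂μ := by
    rw [← Real.norm_eq_abs]
    refine norm_integral_le_of_norm_le hmul ?_
    filter_upwards [hfk] with x hx
    rw [norm_mul, Real.norm_eq_abs, Real.norm_eq_abs]
    exact mul_le_mul_of_nonneg_right hx (abs_nonneg _)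
  have h2 := integral_mul_le_Lp_mul_Lq_of_nonneg (μ := μ) (f := k) (g := fun x => |v x|)
    Real.HolderConjugate.two_two (by filter_upwards [hfk] with x hx using (abs_nonneg _).trans hx)
    (Eventually.of_forall fun x => abs_nonneg _) (by simpa using hk2)
    (by rw [ENNReal.ofReal_ofNat]; exact hv2.abs)
  simp only [Real.rpow_two, sq_abs] at h2
  rw [← Real.sqrt_eq_rpow, ← Real.sqrt_eq_rpow,
    ← Real.sqrt_mul (integral_nonneg fun x => sq_nonneg _)] at h2
  exact h1.trans h2

/-- The forcing term `2 t F`. -/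
def force (F : Pt n → ℝ) (p : Pt n) : ℝ := 2 * p.2.2 * F p

/-- The pointwise bound of the forcing term under the growth condition `|F| ≤ c |(X, t)|^(ℓ - 2)`. -/
def forceBound (c ℓ : ℝ) (p : Pt n) : ℝ := 2 * |p.2.2| * |c| * parNorm p ^ (ℓ - 2)

/-- The square of the Gaussian `L²` norm of the bound of the forcing term. -/
def forceConst (n : ℕ) (a c ℓ : ℝ) : ℝ := ∫ q, forceBound c ℓ q ^ 2 ∂gaussMeasure n a 1

theorem forceConst_nonneg (n : ℕ) (a c ℓ : ℝ) : 0 ≤ forceConst n a c ℓ :=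
  integral_nonneg fun _ => sq_nonneg _

theorem forceBound_dil (hr : 0 < r) (q : Pt n) :
    forceBound c ℓ (dil r q) = r ^ ℓ * forceBound c ℓ q := by
  have h : r ^ ℓ = r ^ (2 : ℕ) * r ^ (ℓ - 2) := by
    rw [← Real.rpow_natCast, ← Real.rpow_add hr]; norm_num
  have h0 : 0 ≤ parNorm q := Real.sqrt_nonneg _
  rw [forceBound, forceBound, parNorm_dil hr.le, Real.mul_rpow hr.le h0, h]
  simp only [dil]
  rw [abs_mul, abs_of_nonneg (sq_nonneg r)]
  ring

theorem measurable_forceBound (c ℓ : ℝ) : Measurable (forceBound c ℓ : Pt n → ℝ) := by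
  have := (continuous_parNorm (n := n)).measurable
  unfold forceBound
  fun_prop

/-- For |t| ≤ 1 the parabolic norm is at most `growth`; rounding ℓ - 2 up to an integer reduces to
polynomial moments. -/
theorem integrable_forceBound_sq (ha : -1 < a) (hℓ : 2 ≤ ℓ) :
    Integrable (fun q : Pt n => forceBound c ℓ q ^ 2) (gaussMeasure n a 1) := by
  refine integrable_of_abs_le_growth (D := (2 * |c|) ^ 2) (k := 2 * ⌈ℓ - 2⌉₊) ha
    ((measurable_forceBound c ℓ).pow_const 2).aestronglyMeasurable ?_
  filter_upwards [ae_mem_lowerStrip a 1] with q hq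
  have ht : |q.2.2| ≤ 1 := abs_le.2 ⟨by have := hq.2.1; linarith, by linarith [hq.2.2]⟩
  have hg := one_le_growth q
  have hp0 : 0 ≤ parNorm q := Real.sqrt_nonneg _
  have hpar : parNorm q ≤ growth q := by
    refine Real.sqrt_le_iff.2 ⟨by linarith, ?_⟩
    have : spaceNorm q ^ 2 + |q.2.2| ≤ growth q := by rw [growth]; linarith
    nlinarith
  have h1 : parNorm q ^ (ℓ - 2) ≤ growth q ^ ⌈ℓ - 2⌉₊ := by
    calc _ ≤ growth q ^ (ℓ - 2) := Real.rpow_le_rpow hp0 hpar (by linarith)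
      _ ≤ growth q ^ ((⌈ℓ - 2⌉₊ : ℕ) : ℝ) := Real.rpow_le_rpow_of_exponent_le hg (Nat.le_ceil _)
      _ = _ := Real.rpow_natCast _ _
  have h0 : 0 ≤ parNorm q ^ (ℓ - 2) := Real.rpow_nonneg hp0 _
  rw [abs_of_nonneg (sq_nonneg _), mul_comm 2 ⌈ℓ - 2⌉₊, pow_mul, ← mul_pow]
  refine pow_le_pow_left₀ (by unfold forceBound; positivity) ?_ 2
  calc forceBound c ℓ q ≤ 2 * 1 * |c| * growth q ^ ⌈ℓ - 2⌉₊ := by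
        unfold forceBound; gcongr
    _ = _ := by ring

/-- The homogeneity of the squared force gives 2ℓ in the exponent and the scaling of the measure
gives 2. -/
theorem integral_forceBound_sq (hr : 0 < r) :
    ∫ p, forceBound c ℓ p ^ 2 ∂gaussMeasure n a r = r ^ (2 * ℓ + 2) * forceConst n a c ℓ := by
  have h := integral_dil_one (n := n) (a := a) hr fun p => forceBound c ℓ p ^ 2
  rw [inv_mul_eq_div, eq_div_iff (pow_ne_zero 2 hr.ne')] at h
  rw [← h, forceConst]
  simp only [forceBound_dil hr, mul_pow]
  rw [integral_const_mul]
  have : r ^ (2 * ℓ + 2) = (r ^ ℓ) ^ 2 * r ^ 2 := by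
    rw [Real.rpow_add hr, mul_comm 2 ℓ, Real.rpow_mul hr.le, Real.rpow_two, Real.rpow_two]
  rw [this]; ring

theorem integral_sub_gaussMeasure {f : Pt n → ℝ} (hr : 0 ≤ r) (hrs : r ≤ s)
    (hf : Integrable f (gaussMeasure n a s)) :
    ∫ p, f p ∂gaussMeasure n a s - ∫ p, f p ∂gaussMeasure n a r =
      ∫ p in (lowerStrip n r)ᶜ, f p ∂gaussMeasure n a s := by
  rw [← integral_add_compl (measurableSet_lowerStrip n r) hf, gaussMeasure_restrict hr hrs]
  ring

/-- The forcing term paired with `U`. -/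
def forcing (a : ℝ) (F U : Pt n → ℝ) (r : ℝ) : ℝ :=
  ∫ q, force F (dil r q) * U (dil r q) ∂gaussMeasure n a 1

theorem sq_mul_integral_dil (hr : 0 < r) (f : Pt n → ℝ) :
    r ^ 2 * ∫ q, f (dil r q) ∂gaussMeasure n a 1 = ∫ p, f p ∂gaussMeasure n a r := by
  rw [integral_dil_one hr, mul_inv_cancel_left₀ (pow_ne_zero 2 hr.ne')]

theorem ae_abs_force_le
    (hF : ∀ᵐ p ∂(volume.restrict (strip n 1)), |F p| ≤ c * parNorm p ^ (ℓ - 2)) :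
    ∀ᵐ p ∂(volume.restrict (openStrip n)), |force F p| ≤ forceBound c ℓ p := by
  rw [restrict_strip_one] at hF
  filter_upwards [hF] with p hp
  have h0 : 0 ≤ parNorm p ^ (ℓ - 2) := Real.rpow_nonneg (Real.sqrt_nonneg _) _
  rw [force, forceBound, abs_mul, abs_mul, abs_two, mul_assoc (2 * |p.2.2|)]
  refine mul_le_mul_of_nonneg_left (hp.trans ?_) (by positivity)
  exact mul_le_mul_of_nonneg_right (le_abs_self c) h0

theorem aestronglyMeasurable_force (hF : MemLp F ⊤ (volume.restrict (strip n 1))) :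
    AEStronglyMeasurable (force F) (volume.restrict (openStrip n)) := by
  rw [restrict_strip_one] at hF
  exact (Measurable.aestronglyMeasurable (by fun_prop)).mul hF.1

namespace Regular

theorem integrable_sq (h : Regular a U g K α) (ha : -1 < a) (hn : 1 ≤ n)
    (hr : r ∈ Ioo (0 : ℝ) 1) : Integrable (fun p => U p ^ 2) (gaussMeasure n a r) := by
  have hfin := isFiniteMeasure_gaussMeasure (n := n) ha
  obtain ⟨N, hN0, hN⟩ := h.exists_abs_le hn
  have hb : Integrable (fun _ : Pt n => N ^ 2) (gaussMeasure n a r) :=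
    (integrable_const _).mono_measure (gaussMeasure_mono hr.1.le hr.2.le)
  refine hb.mono' ((aestronglyMeasurable_of_openStrip hr (h.continuousOn_openStrip.aestronglyMeasurable
    (isOpen_openStrip n).measurableSet)).pow 2) ?_
  filter_upwards [ae_mem_lowerStrip a r] with p hp
  rw [Real.norm_eq_abs, abs_pow]
  exact pow_le_pow_left₀ (abs_nonneg _)
    (hN p (openStrip_subset_strip n (openStrip_of_lowerStrip hr hp))) 2

theorem integrable_sq_dil (h : Regular a U g K α) (ha : -1 < a) (hn : 1 ≤ n)
    (hr : r ∈ Ioo (0 : ℝ) 1) : Integrable (fun q => U (dil r q) ^ 2) (gaussMeasure n a 1) := by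
  rw [integrable_comp_dil (f := fun p => U p ^ 2) hr.1, mul_one]
  exact h.integrable_sq ha hn hr

theorem sq_mul_height_mono (h : Regular a U g K α) (ha : -1 < a) (hn : 1 ≤ n)
    (hr : r ∈ Ioo (0 : ℝ) 1) (hs : s ∈ Ioo (0 : ℝ) 1) (hrs : r ≤ s) :
    r ^ 2 * height a U r ≤ s ^ 2 * height a U s := by
  rw [height_eq ha hr.1, height_eq ha hs.1, sq_mul_integral_dil hr.1 fun p => U p ^ 2,
    sq_mul_integral_dil hs.1 fun p => U p ^ 2]
  exact integral_mono_measure (gaussMeasure_mono hr.1.le hrs)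
    (Eventually.of_forall fun _ => sq_nonneg _) (h.integrable_sq ha hn hs)

theorem abs_forcing_le (h : Regular a U g K α) (ha : -1 < a) (hn : 1 ≤ n) (hℓ : 2 ≤ ℓ)
    (hFb : ∀ᵐ p ∂(volume.restrict (strip n 1)), |F p| ≤ c * parNorm p ^ (ℓ - 2))
    (hr : r ∈ Ioo (0 : ℝ) 1) :
    |forcing a F U r| ≤ √(forceConst n a c ℓ) * r ^ ℓ * √(height a U r) := by
  have hA := forceConst_nonneg n a c ℓ
  have hrl := Real.rpow_nonneg hr.1.le ℓ
  have := abs_integral_mul_le_sqrt (f := fun q => force F (dil r q))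
    (k := fun q => r ^ ℓ * forceBound c ℓ q) (v := fun q => U (dil r q)) (μ := gaussMeasure n a 1)
    ?_ ((measurable_forceBound c ℓ).const_mul _).aestronglyMeasurable (h.aestronglyMeasurable_dil hr)
    ?_ (h.integrable_sq_dil ha hn hr)
  · refine this.trans_eq ?_
    simp only [mul_pow]
    rw [integral_const_mul, ← height_eq ha hr.1, ← forceConst, Real.sqrt_mul (by positivity),
      Real.sqrt_mul (by positivity), Real.sqrt_sq hrl]
    ring
  · filter_upwards [ae_dil_of_openStrip hr (ae_abs_force_le hFb)] with q hq
    rwa [forceBound_dil hr.1] at hq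
  · simp only [mul_pow]
    exact (integrable_forceBound_sq ha hℓ).const_mul _

theorem integrable_force_mul (h : Regular a U g K α) (ha : -1 < a) (hn : 1 ≤ n)
    (hF : MemLp F ⊤ (volume.restrict (strip n 1))) (hr : r ∈ Ioo (0 : ℝ) 1) :
    Integrable (fun p => force F p * U p) (gaussMeasure n a r) := by
  have hfin := isFiniteMeasure_gaussMeasure (n := n) ha
  obtain ⟨N, hN0, hN⟩ := h.exists_abs_le hn
  have hm := aestronglyMeasurable_of_openStrip (a := a) hr (aestronglyMeasurable_force hF)
  rw [restrict_strip_one] at hF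
  obtain ⟨L, hL0, hL⟩ := ae_abs_le_of_memLp_top hF
  have hb : Integrable (fun _ : Pt n => 2 * 1 * L * N) (gaussMeasure n a r) :=
    (integrable_const _).mono_measure (gaussMeasure_mono hr.1.le hr.2.le)
  refine hb.mono' (hm.mul (aestronglyMeasurable_of_openStrip hr
    (h.continuousOn_openStrip.aestronglyMeasurable (isOpen_openStrip n).measurableSet))) ?_
  filter_upwards [ae_mem_lowerStrip a r, ae_restrict_lowerStrip hr hL] with p hp hFp
  have ht := abs_time_le_one hr hp
  have hU := hN p (openStrip_subset_strip n (openStrip_of_lowerStrip hr hp))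
  rw [norm_mul, Real.norm_eq_abs, Real.norm_eq_abs, force, abs_mul, abs_mul, abs_two]
  gcongr

/-- The function r²ψ(r) is the integral of 2tFU over the strip of scale r, so its increment is an
integral over a shell. Cauchy–Schwarz there produces the increments of r^{2ℓ+2} and of r²H. -/
theorem forcing_variation (h : Regular a U g K α) (ha : -1 < a) (hn : 1 ≤ n) (hℓ : 2 ≤ ℓ)
    (hF : MemLp F ⊤ (volume.restrict (strip n 1)))
    (hFb : ∀ᵐ p ∂(volume.restrict (strip n 1)), |F p| ≤ c * parNorm p ^ (ℓ - 2))
    (hr : r ∈ Ioo (0 : ℝ) 1) (hs : s ∈ Ioo (0 : ℝ) 1) (hrs : r ≤ s) :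
    |s ^ 2 * forcing a F U s - r ^ 2 * forcing a F U r| ≤ √(forceConst n a c ℓ) *
      √((s ^ (2 * ℓ + 2) - r ^ (2 * ℓ + 2)) * (s ^ 2 * height a U s - r ^ 2 * height a U r)) := by
  have hA := forceConst_nonneg n a c ℓ
  have hki : Integrable (fun p : Pt n => forceBound c ℓ p ^ 2) (gaussMeasure n a s) :=
    (integrable_forceBound_sq ha hℓ).mono_measure (gaussMeasure_mono hs.1.le hs.2.le)
  have hU := h.integrable_sq ha hn hs
  rw [forcing, forcing, height_eq ha hr.1, height_eq ha hs.1,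
    sq_mul_integral_dil hs.1 fun p => force F p * U p,
    sq_mul_integral_dil hr.1 fun p => force F p * U p,
    sq_mul_integral_dil hs.1 fun p => U p ^ 2, sq_mul_integral_dil hr.1 fun p => U p ^ 2,
    integral_sub_gaussMeasure hr.1.le hrs (h.integrable_force_mul ha hn hF hs),
    integral_sub_gaussMeasure hr.1.le hrs hU]
  have hk := integral_sub_gaussMeasure hr.1.le hrs hki
  rw [integral_forceBound_sq hs.1, integral_forceBound_sq hr.1, ← sub_mul] at hk
  rw [← Real.sqrt_mul hA, ← mul_assoc, mul_comm (forceConst n a c ℓ), hk]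
  refine abs_integral_mul_le_sqrt (ae_restrict_of_ae ?_)
    (measurable_forceBound c ℓ).aestronglyMeasurable ?_ hki.restrict hU.restrict
  · exact ae_restrict_lowerStrip hs (ae_abs_force_le hFb)
  · exact (aestronglyMeasurable_of_openStrip hs (h.continuousOn_openStrip.aestronglyMeasurable
      (isOpen_openStrip n).measurableSet)).restrict

theorem pairing_decomposition (h : Regular a U g K α) (hS : SolutionClass n a F U)
    (ha : a ∈ Ioo (-1 : ℝ) 1) (hn : 1 ≤ n) (hr : r ∈ Ioo (0 : ℝ) 1) :
    ∫ q, euler U g (dil r q) * U (dil r q) ∂gaussMeasure n a 1 =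
      2 * energy a U r + forcing a F U r := by
  have hf : Integrable (fun q => force F (dil r q) * U (dil r q)) (gaussMeasure n a 1) := by
    rw [integrable_comp_dil (f := fun p => force F p * U p) hr.1, mul_one]
    exact h.integrable_force_mul ha.1 hn hS.rhs_bounded hr
  rw [h.two_mul_energy hS ha hn hr, pairing, forcing,
    ← integral_add (h.integrable_drift_mul_dil ha hS.rhs_bounded hn hr hr) hf]
  refine integral_congr_ae (Eventually.of_forall fun q => ?_)
  simp only [drift, force]
  ring

/-- With Z the Euler field, f the force and m = P/H, expand (2(Z - mU) - f)² ≥ 0 into a lower bound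
for 2Z(Z - f) and integrate. The choice of m turns 4mP - 2m²H into 2P²/H, which cancels the 2N²
coming from the derivative of P/H. -/
theorem euler_cauchy_schwarz (h : Regular a U g K α) (ha : a ∈ Ioo (-1 : ℝ) 1) (hn : 1 ≤ n)
    (hℓ : 2 ≤ ℓ) (hF : MemLp F ⊤ (volume.restrict (strip n 1)))
    (hFb : ∀ᵐ p ∂(volume.restrict (strip n 1)), |F p| ≤ c * parNorm p ^ (ℓ - 2))
    (hr : r ∈ Ioo (0 : ℝ) 1) {P : ℝ}
    (hP : P = ∫ q, euler U g (dil r q) * U (dil r q) ∂gaussMeasure n a 1)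
    (hH : 0 < height a U r) :
    2 * P ^ 2 / height a U r - 2 * (P / height a U r) * forcing a F U r -
      √(forceConst n a c ℓ) ^ 2 * r ^ (2 * ℓ) / 2 ≤
    2 * r * ∫ q, drift F U g (dil r q) * (euler U g (dil r q) / r) ∂gaussMeasure n a 1 := by
  obtain ⟨N, hN0, hN⟩ := h.exists_abs_le hn
  obtain ⟨D, hD0, hD⟩ := h.exists_abs_drift_le ha hF
  have hK := h.nonneg
  have hwb := ae_abs_le_growth_dil (a := a) (by positivity) (h.ae_abs_euler_le ha) hr
  have hdb := ae_abs_le_growth_dil (a := a) hD0 hD hr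
  have hwm : AEStronglyMeasurable (fun q => euler U g (dil r q)) (gaussMeasure n a 1) :=
    aestronglyMeasurable_dil_of_openStrip hr h.aestronglyMeasurable_euler
  have hdm : AEStronglyMeasurable (fun q => drift F U g (dil r q)) (gaussMeasure n a 1) :=
    aestronglyMeasurable_dil_of_openStrip hr (h.aestronglyMeasurable_drift hF)
  have hvm := h.aestronglyMeasurable_dil (a := a) hr
  have i1 : Integrable (fun q => drift F U g (dil r q) * euler U g (dil r q))
      (gaussMeasure n a 1) := by
    refine integrable_of_abs_le_growth (k := 2) (D := D * (K * (n + 3))) ha.1 (hdm.mul hwm) ?_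
    filter_upwards [hwb, hdb] with q h1 h2
    rw [abs_mul]
    calc _ ≤ D * growth q * (K * (n + 3) * growth q) :=
          mul_le_mul h2 h1 (abs_nonneg _) ((abs_nonneg _).trans h2)
      _ = _ := by ring
  have i2 : Integrable (fun q => euler U g (dil r q) * U (dil r q)) (gaussMeasure n a 1) := by
    refine integrable_of_abs_le_growth (k := 1) (D := K * (n + 3) * N) ha.1 (hwm.mul hvm) ?_
    filter_upwards [hwb, ae_abs_dil_le hN hr] with q h1 h2
    rw [abs_mul, pow_one]
    calc _ ≤ K * (n + 3) * growth q * N := mul_le_mul h1 h2 (abs_nonneg _) ((abs_nonneg _).trans h1)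
      _ = _ := by ring
  have i3 := h.integrable_sq_dil ha.1 hn hr
  have i4 : Integrable (fun q => force F (dil r q) * U (dil r q)) (gaussMeasure n a 1) := by
    rw [integrable_comp_dil (f := fun p => force F p * U p) hr.1, mul_one]
    exact h.integrable_force_mul ha.1 hn hF hr
  have i5 : Integrable (fun q : Pt n => (r ^ ℓ) ^ 2 * forceBound c ℓ q ^ 2) (gaussMeasure n a 1) :=
    (integrable_forceBound_sq ha.1 hℓ).const_mul _
  set H := height a U r with hHdef
  set m := P / H with hm
  have hpt : ∀ᵐ q ∂gaussMeasure n a 1,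
      4 * m * (euler U g (dil r q) * U (dil r q)) - 2 * m ^ 2 * U (dil r q) ^ 2 -
        2 * m * (force F (dil r q) * U (dil r q)) - 1 / 2 * ((r ^ ℓ) ^ 2 * forceBound c ℓ q ^ 2) ≤
      2 * (drift F U g (dil r q) * euler U g (dil r q)) := by
    filter_upwards [ae_dil_of_openStrip hr (ae_abs_force_le hFb)] with q hq
    rw [forceBound_dil hr.1] at hq
    have hsq : force F (dil r q) ^ 2 ≤ (r ^ ℓ) ^ 2 * forceBound c ℓ q ^ 2 := by
      rw [← mul_pow, ← sq_abs]; exact pow_le_pow_left₀ (abs_nonneg _) hq 2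
    have e : drift F U g (dil r q) = euler U g (dil r q) - force F (dil r q) := rfl
    rw [e]
    nlinarith [sq_nonneg (2 * (euler U g (dil r q) - m * U (dil r q)) - force F (dil r q))]
  have j1 := i2.const_mul (4 * m)
  have j2 := i3.const_mul (2 * m ^ 2)
  have j3 := i4.const_mul (2 * m)
  have j4 := i5.const_mul (1 / 2)
  have hint := integral_mono_ae (((j1.sub j2).sub j3).sub j4) (i1.const_mul 2) hpt
  have s1 := integral_sub ((j1.sub j2).sub j3) j4
  have s2 := integral_sub (j1.sub j2) j3
  have s3 := integral_sub j1 j2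
  simp only [Pi.sub_apply] at hint s1 s2 s3
  rw [s1, s2, s3, integral_const_mul, integral_const_mul, integral_const_mul, integral_const_mul,
    integral_const_mul, integral_const_mul, ← hP, ← height_eq ha.1 hr.1, ← hHdef, ← forcing,
    ← forceConst] at hint
  have er : 2 * r * ∫ q, drift F U g (dil r q) * (euler U g (dil r q) / r) ∂gaussMeasure n a 1 =
      2 * ∫ q, drift F U g (dil r q) * euler U g (dil r q) ∂gaussMeasure n a 1 := by
    rw [mul_assoc, ← integral_const_mul]
    congr 1
    refine integral_congr_ae (Eventually.of_forall fun q => ?_)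
    have := hr.1.ne'
    dsimp only
    field_simp
  have e2 : r ^ (2 * ℓ) = (r ^ ℓ) ^ 2 := by
    rw [mul_comm 2 ℓ, Real.rpow_mul hr.1.le, Real.rpow_two]
  have e3 : m * H = P := div_mul_cancel₀ P hH.ne'
  have e4 : 2 * P ^ 2 / H = 4 * m * P - 2 * m ^ 2 * H := by
    rw [hm]; field_simp; ring
  rw [er, e2, e4, Real.sq_sqrt (forceConst_nonneg n a c ℓ)]
  linarith

end Regular

end ThinObstacle

end

/-! ### Assembly. -/

noncomputable section

namespace ThinObstacle

variable {n : ℕ} {a K α c ℓ : ℝ} {F U g : Pt n → ℝ}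

theorem Regular.frequencyData (h : Regular a U g K α) (hS : SolutionClass n a F U)
    (ha : a ∈ Ioo (-1 : ℝ) 1) (hn : 1 ≤ n) (hℓ : 2 ≤ ℓ)
    (hFb : ∀ᵐ p ∂(volume.restrict (strip n 1)), |F p| ≤ c * parNorm p ^ (ℓ - 2)) :
    FrequencyData (√(forceConst n a c ℓ)) ℓ (height a U)
      (fun r => ∫ q, euler U g (dil r q) * U (dil r q) ∂gaussMeasure n a 1) (energy a U)
      (forcing a F U)
      (fun r => ∫ q, drift F U g (dil r q) * (euler U g (dil r q) / r) ∂gaussMeasure n a 1)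
      (pairing a F U g) where
  hasDerivAt_height r hr := by
    refine (h.hasDerivAt_integral_sq_dil ha hn hr).congr_of_eventuallyEq ?_
    filter_upwards [Ioi_mem_nhds hr.1] with s hs using height_eq ha.1 hs
  decomposition r hr := h.pairing_decomposition hS ha hn hr
  continuousOn_energy := h.continuousOn_energy hS ha hn
  energy_sub_ge r hr s hs := h.energy_sub_ge hS ha hn hr hs
  hasDerivAt_pairing r hr := h.hasDerivAt_pairing ha hS.rhs_bounded hn hr
  abs_forcing_le r hr := h.abs_forcing_le ha.1 hn hℓ hFb hr
  forcing_variation r hr s hs hrs := h.forcing_variation ha.1 hn hℓ hS.rhs_bounded hFb hr hs hrs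
  sq_height_mono r hr s hs hrs := h.sq_mul_height_mono ha.1 hn hr hs hrs
  cauchy_schwarz r hr hH := h.euler_cauchy_schwarz ha hn hℓ hS.rhs_bounded hFb hr rfl hH

theorem Regular.integrableOn_height (h : Regular a U g K α) (ha : -1 < a) (hn : 1 ≤ n) {r : ℝ}
    (hr : r ∈ Ioo (0 : ℝ) 1) :
    IntegrableOn (fun p => U p ^ 2 * gaussianKernel a p * p.2.1 ^ a) (strip n r) := by
  have := (integrable_gaussMeasure_iff ha).1 (h.integrable_sq ha hn hr)
  rw [IntegrableOn, restrict_strip]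
  simpa only [gaussWeight, mul_assoc, IntegrableOn] using this

end ThinObstacle

end

theorem mainTheorem3 (n : ℕ) (hn : 1 ≤ n) (a : ℝ) (ha : a ∈ Ioo (-1 : ℝ) 1)
    (ℓ : ℝ) (hℓ : 2 ≤ ℓ) (Cℓ : ℝ) (σ : ℝ) (hσ : σ ∈ Ioo (0 : ℝ) 1) :
    ∃ C : ℝ, 0 < C ∧ ∀ F U : ThinObstacle.Pt n → ℝ,
      ThinObstacle.SolutionClass n a F U →
      (∀ᵐ p ∂(volume.restrict (ThinObstacle.strip n 1)),
        |F p| ≤ Cℓ * ThinObstacle.parNorm p ^ (ℓ - 2)) →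
      (∀ r ∈ Ioo (0 : ℝ) 1, IntegrableOn
        (fun p => U p ^ 2 * ThinObstacle.gaussianKernel a p * p.2.1 ^ a)
        (ThinObstacle.strip n r)) ∧
      ContinuousOn (ThinObstacle.logTruncatedHeight a ℓ σ U) (Ioo 0 1) ∧
      (Ioo (0 : ℝ) 1 \ ThinObstacle.frequencyDomain a ℓ σ U).Countable ∧
      MonotoneOn (ThinObstacle.truncatedFrequency a ℓ σ C U)
        (ThinObstacle.frequencyDomain a ℓ σ U) ∧
      ∃ L : ℝ, Tendsto (ThinObstacle.truncatedFrequency a ℓ σ C U)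
        (𝓝[ThinObstacle.frequencyDomain a ℓ σ U] 0) (𝓝 L) := by
  -- This number depends only on n, a, ℓ and the growth constant, hence so does C. The summand 1
  -- keeps C positive when A = 0.
  set A := √(ThinObstacle.forceConst n a Cℓ ℓ)
  have hA : 0 ≤ A := Real.sqrt_nonneg _
  have hσ1 : 0 < 1 - σ := sub_pos.2 hσ.2
  refine ⟨(4 * A + A ^ 2 / 2 + A * √(2 * (2 * ℓ + 2)) + 1) / (1 - σ), by positivity,
    fun F U hS hF => ?_⟩
  obtain ⟨g, K, α, h⟩ := hS.exists_regular
  exact ⟨fun r hr => h.integrableOn_height ha.1 hn hr,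
    (h.frequencyData hS ha hn hℓ hF).truncated_frequency hA hℓ hσ rfl rfl rfl rfl rfl⟩
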